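/- Let $(X,\omega,J)$ be a compact Kähler manifold and let $(L,h)$ be a holomorphic Hermitian line bundle on $X$ whose Chern connection $\nabla$ satisfies the prequantum condition $\omega=\sqrt{-1}\,F_\nabla$, where $F_\nabla=\nabla^2$ is the curvature. For $k\ge 1$ equip $L^{\otimes k}$ with the metric and the connection (again denoted $\nabla$) induced by those of $L$, and put $\|s\|=\left(\int_X |s|^2\,\omega^n/n!\right)^{1/2}$ for sections $s$ of $L^{\otimes k}$, where $n=\dim_{\mathbb C}X$. Let $TX$ denote the holomorphic tangent bundle (the bundle $T^{1,0}X$ of vectors of type $(1,0)$), with the Levi-Civita connection of the Kähler metric, which induces a connection on each $(TX)^{\otimes m}$. For a smooth tensor field $G\in\Gamma(X,(TX)^{\otimes m})$, the higher covariant derivative $\nabla_G s$ of a section $s$ of $L^{\otimes k}$ is defined by $\nabla_G s=G\cdot s$ if $m=0$ (so that $G$ is a function) and, if $m\ge 1$, by $$\nabla_{Y\otimes G'}\,s=\nabla_Y(\nabla_{G'}s)-\nabla_{\nabla_Y G'}\,s,$$ where $Y$ is a section of $TX$ and $G'$ a section of $(TX)^{\otimes(m-1)}$, extended additively to all $G$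 (it is $C^\infty(X)$-linear in $G$). Let $m\ge 0$ be an integer and let $G\in\Gamma(X,(TX)^{\otimes m})$ be smooth. Then there is a constant $C=C_G>0$ such that, for all integers $k\ge 1$ and all holomorphic sections $s\in H^0(X,L^{\otimes k})$, $$\|\nabla_G s\|\le C\,k^{m/2}\,\|s\|.$$ -/

import Mathlib

open scoped Manifold ContDiff TensorProduct ENNReal
open MeasureTheory Bundle

noncomputable section

namespace BerezinToeplitz

/-- The model space `ℂⁿ` of `n`-dimensional complex manifolds. -/
abbrev Cn (n : ℕ) : Type := EuclideanSpace ℂ (Fin n)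

/-- The `j`-th standard basis vector of `ℂⁿ`. -/
abbrev stdVec {n : ℕ} (j : Fin n) : Cn n := EuclideanSpace.single j (1 : ℂ)

/-! ### Calculus on `ℂⁿ`

A real tangent vector `u` is identified with the vector `(u - √-1 J u) / 2` of type `(1,0)`. In this
way the tangent space of a complex manifold, with multiplication by `√-1` as complex structure, is
the space `T^{1,0}`, and the basis vector `stdVec j` is `∂/∂z^j`. -/

/-- The derivative `∂f(u) = (df(u) - √-1 df(√-1 u)) / 2` of a function `f` in the direction of the
`(1,0)`-vector corresponding to `u`; for `u = stdVec j` it is `∂f/∂z^j`. -/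
def delHol {n : ℕ} (f : Cn n → ℂ) (z u : Cn n) : ℂ :=
  (1 / 2) * (fderiv ℝ f z u - Complex.I * fderiv ℝ f z (Complex.I • u))

/-- The exterior derivative of a complex-valued 1-form `θ` (written `θ z u`), evaluated on `u, v`. -/
def dOneForm {n : ℕ} (θ : Cn n → Cn n → ℂ) (z u v : Cn n) : ℂ :=
  fderiv ℝ (fun w => θ w v) z u - fderiv ℝ (fun w => θ w u) z v

/-- The exterior derivative of a real 2-form `η`, evaluated on `u, v, w`. -/
def dTwoForm {n : ℕ} (η : Cn n → Cn n → Cn n → ℝ) (z u v w : Cn n) : ℝ :=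
  fderiv ℝ (fun p => η p v w) z u + fderiv ℝ (fun p => η p w u) z v
    + fderiv ℝ (fun p => η p u v) z w

/-- The covariant derivative `∇_{∂/∂z^i} G` of a contravariant tensor field with components
`G z I = G^{I 0 … I (m-1)}(z)`, where `∇_{∂/∂z^i} ∂/∂z^l = ∑ p, Γ z i l p • ∂/∂z^p`. -/
def tensorNabla {n m : ℕ} (Γ : Cn n → Fin n → Fin n → Fin n → ℂ) (i : Fin n)
    (G : Cn n → (Fin m → Fin n) → ℂ) (z : Cn n) (I : Fin m → Fin n) : ℂ :=
  delHol (fun w => G w I) z (stdVec i)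
    + ∑ j : Fin m, ∑ l : Fin n, Γ z i l (I j) * G z (Function.update I j l)

/-- The covariant derivative `∇_{∂/∂z^i} f` of a section of a line bundle, written as a function `f`
with respect to a frame with connection form `θ`. -/
def lineNabla {n : ℕ} (θ : Cn n → Cn n → ℂ) (i : Fin n) (f : Cn n → ℂ) (z : Cn n) : ℂ :=
  delHol f z (stdVec i) + θ z (stdVec i) * f z

/-- The higher covariant derivative `∇_G f`, defined by `∇_G f = G • f` in degree `0` and by the
recursion `∇_{Y ⊗ G'} f = ∇_Y (∇_{G'} f) - ∇_{∇_Y G'} f`, applied to the decomposition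
`G = ∑ i, ∂/∂z^i ⊗ G_i` in positive degree. -/
def higherNabla {n : ℕ} (Γ : Cn n → Fin n → Fin n → Fin n → ℂ) (θ : Cn n → Cn n → ℂ) :
    (m : ℕ) → (Cn n → (Fin m → Fin n) → ℂ) → (Cn n → ℂ) → Cn n → ℂ
  | 0, G, f => fun z => G z Fin.elim0 * f z
  | m + 1, G, f => fun z => ∑ i : Fin n,
      (lineNabla θ i (higherNabla Γ θ m (fun w I => G w (Fin.cons i I)) f) z
        - higherNabla Γ θ m (tensorNabla Γ i (fun w I => G w (Fin.cons i I))) f z)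

/-! ### Kähler manifolds -/

section Kahler

variable {n : ℕ} {X : Type*} [TopologicalSpace X] [ChartedSpace (Cn n) X]

/-- The tangent vector at `φ⁻¹(z)` with coordinates `u` in the chart `φ` around `x`. -/
def chartVec (x : X) (z u : Cn n) :
    TangentSpace 𝓘(ℂ, Cn n) ((chartAt (Cn n) x).symm z) :=
  mfderiv 𝓘(ℂ, Cn n) 𝓘(ℂ, Cn n) (chartAt (Cn n) x).symm z u

variable (n X) in
/-- Kähler forms on `X`: smooth closed real 2-forms of type `(1,1)` such that `ω(u, J u) > 0` for all
`u ≠ 0`. The Kähler metric is `g(u, v) = ω(u, J v)`. -/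
structure KahlerForm where
  /-- the 2-form -/
  form : ∀ x : X, TangentSpace 𝓘(ℂ, Cn n) x →ₗ[ℝ] TangentSpace 𝓘(ℂ, Cn n) x →ₗ[ℝ] ℝ
  alternating : ∀ x u, form x u u = 0
  invariant : ∀ x u v, form x (Complex.I • u) (Complex.I • v) = form x u v
  positive : ∀ x u, u ≠ 0 → 0 < form x u (Complex.I • u)
  smooth : ∀ (x : X) (u v : Cn n),
    ContDiffOn ℝ ∞ (fun z => form ((chartAt (Cn n) x).symm z) (chartVec x z u) (chartVec x z v))
      (chartAt (Cn n) x).target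
  closed : ∀ (x : X), ∀ z ∈ (chartAt (Cn n) x).target, ∀ u v w : Cn n,
    dTwoForm (fun p a b =>
      form ((chartAt (Cn n) x).symm p) (chartVec x p a) (chartVec x p b)) z u v w = 0

namespace KahlerForm

variable (Ω : KahlerForm n X)

/-- The form `ω` in the chart around `x`. -/
def inChart (x : X) (z u v : Cn n) : ℝ :=
  Ω.form ((chartAt (Cn n) x).symm z) (chartVec x z u) (chartVec x z v)

/-- The components `ω_{j l̄} = ω(∂/∂z^j, ∂/∂z̄^l)`, that is `ω = ∑ ω_{j l̄} dz^j ∧ dz̄^l`, in the chart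
around `x`, where `ω` is extended complex bilinearly. -/
def components (x : X) (z : Cn n) : Matrix (Fin n) (Fin n) ℂ := fun j l =>
  (1 / 2) * ((Ω.inChart x z (stdVec j) (stdVec l) : ℂ)
    + Complex.I * (Ω.inChart x z (stdVec j) (Complex.I • stdVec l) : ℂ))

/-- The Christoffel symbols `Γ_{ij}^p = ∑ l, ω^{l̄ p} ∂ω_{j l̄}/∂z^i` of the Levi-Civita connection of
the Kähler metric on `T^{1,0}`, where `ω^{l̄ p}` is the inverse matrix of `ω_{p l̄}`. -/
def christoffel (x : X) (z : Cn n) (i j p : Fin n) : ℂ :=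
  ∑ l : Fin n, (Ω.components x z)⁻¹ l p *
    delHol (fun w => Ω.components x w j l) z (stdVec i)

/-- The density of `ωⁿ / n!` with respect to Lebesgue measure in the chart around `x`: the
determinant of the Hermitian matrix `-2 √-1 ω_{j l̄}`. -/
def density (x : X) (z : Cn n) : ℝ :=
  (((-2 * Complex.I) • Ω.components x z).det).re

/-- The measure `ωⁿ / n!` on `X`, as the supremum of its restrictions to the domains of charts. -/
def volumeMeasure [MeasurableSpace X] : Measure X :=
  ⨆ x : X, Measure.map (chartAt (Cn n) x).symm
    (((volume : Measure (Cn n)).restrict (chartAt (Cn n) x).target).withDensity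
      (fun z => ENNReal.ofReal (Ω.density x z)))

end KahlerForm

/-- The components `G^{I 0 … I (m-1)}`, in the chart around `x`, of a section `G` of the `m`-th tensor
power of the holomorphic tangent bundle. -/
def tensorCoord {m : ℕ} (G : ∀ x : X, ⨂[ℂ]^m (TangentSpace 𝓘(ℂ, Cn n) x)) (x : X) (z : Cn n)
    (I : Fin m → Fin n) : ℂ :=
  PiTensorProduct.lift ((MultilinearMap.mkPiAlgebra ℂ (Fin m) ℂ).compLinearMap (fun j =>
      (EuclideanSpace.proj (I j) : Cn n →L[ℂ] ℂ).toLinearMap ∘ₗ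
        (mfderiv 𝓘(ℂ, Cn n) 𝓘(ℂ, Cn n) (chartAt (Cn n) x)
          ((chartAt (Cn n) x).symm z)).toLinearMap))
    (G ((chartAt (Cn n) x).symm z))

/-- `G` is a smooth section of the `m`-th tensor power of the holomorphic tangent bundle. -/
def IsSmoothTensor {m : ℕ} (G : ∀ x : X, ⨂[ℂ]^m (TangentSpace 𝓘(ℂ, Cn n) x)) : Prop :=
  ∀ (x : X) (I : Fin m → Fin n),
    ContDiffOn ℝ ∞ (fun z => tensorCoord G x z I) (chartAt (Cn n) x).target

end Kahler

/-! ### Hermitian holomorphic line bundles -/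

section LineBundle

variable {n : ℕ} {X : Type*} [TopologicalSpace X] [ChartedSpace (Cn n) X]
  {L : X → Type*} [TopologicalSpace (TotalSpace ℂ L)] [∀ x, AddCommGroup (L x)]
  [∀ x, Module ℂ (L x)] [∀ x, TopologicalSpace (L x)] [FiberBundle ℂ L] [VectorBundle ℂ ℂ L]

variable (n L) in
/-- The open subset of `ℂⁿ` on which both the chart and the trivialization of `L` around `x` are
defined. -/
def localDomain (x : X) : Set (Cn n) :=
  (chartAt (Cn n) x).target ∩ (chartAt (Cn n) x).symm ⁻¹' (trivializationAt ℂ L x).baseSet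

variable (L) in
/-- The local holomorphic frame of `L` given by the trivialization around `x`. -/
def frame (x y : X) : L y := (trivializationAt ℂ L x).symm y (1 : ℂ)

/-- The coordinate of a vector `v` of `L_y^{⊗k}` with respect to the frame `e ⊗ ⋯ ⊗ e`, where
`e = frame L x`: the vector `v_1 ⊗ ⋯ ⊗ v_k` is sent to the product of the coordinates of the `v_j`. -/
def powCoord (k : ℕ) (x y : X) : ⨂[ℂ]^k (L y) →ₗ[ℂ] ℂ :=
  PiTensorProduct.lift ((MultilinearMap.mkPiAlgebra ℂ (Fin k) ℂ).compLinearMap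
    (fun _ => ((trivializationAt ℂ L x).continuousLinearMapAt ℂ y).toLinearMap))

/-- A section of `L^{⊗k}` as a function on `localDomain n L x`. -/
def sectionCoord {k : ℕ} (s : ∀ x : X, ⨂[ℂ]^k (L x)) (x : X) (z : Cn n) : ℂ :=
  powCoord k x ((chartAt (Cn n) x).symm z) (s ((chartAt (Cn n) x).symm z))

variable (n) in
/-- `s ∈ H⁰(X, L^{⊗k})`: `s` is a holomorphic section of `L^{⊗k}`. -/
def IsHolomorphicSection {k : ℕ} (s : ∀ x : X, ⨂[ℂ]^k (L x)) : Prop :=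
  ∀ x : X, DifferentiableOn ℂ (fun z : Cn n => sectionCoord s x z) (localDomain n L x)

variable (n L) in
/-- Smooth Hermitian metrics on the line bundle `L`. -/
structure HermitianMetric where
  /-- the Hermitian form on each fibre -/
  form : ∀ x : X, L x →ₗ⋆[ℂ] L x →ₗ[ℂ] ℂ
  hermitian : ∀ x u v, form x u v = starRingEnd ℂ (form x v u)
  positive : ∀ x u, u ≠ 0 → 0 < (form x u u).re
  smooth : ∀ x : X,
    ContDiffOn ℝ ∞ (fun z : Cn n => (form ((chartAt (Cn n) x).symm z)
        (frame L x ((chartAt (Cn n) x).symm z)) (frame L x ((chartAt (Cn n) x).symm z))).re)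
      (localDomain n L x)

namespace HermitianMetric

variable (h : HermitianMetric n L)

/-- The squared length `|e|_h²` at `y` of the frame `e` of `L` around `x`. -/
def frameNormSq (x y : X) : ℝ := (h.form y (frame L x y) (frame L x y)).re

/-- The connection form `θ = ∂ log |e|_h²` of the Chern connection of `(L, h)` with respect to the
holomorphic frame `e` around `x`, in the chart around `x`. -/
def connectionForm (x : X) (z u : Cn n) : ℂ :=
  delHol (fun w => (Real.log (h.frameNormSq x ((chartAt (Cn n) x).symm w)) : ℂ)) z u

/-- The prequantum condition `ω = √-1 F`, where `F` is the curvature of the Chern connection of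
`(L, h)`, which is `dθ` in a local holomorphic frame with connection form `θ`. -/
def IsPrequantum (Ω : KahlerForm n X) : Prop :=
  ∀ (x : X), ∀ z ∈ localDomain n L x, ∀ u v : Cn n,
    (Ω.inChart x z u v : ℂ) = Complex.I * dOneForm (h.connectionForm x) z u v

/-- The squared pointwise norm `|v|²` of a vector `v ∈ L_x^{⊗k}` for the metric induced by `h`. -/
def powNormSq {k : ℕ} (x : X) (v : ⨂[ℂ]^k (L x)) : ℝ :=
  ‖powCoord k x x v‖ ^ 2 * h.frameNormSq x x ^ k

/-- The `L²`-norm `(∫ |s|² ωⁿ / n!)^{1/2}` of a section `s` of `L^{⊗k}`. -/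
def l2Norm [MeasurableSpace X] (Ω : KahlerForm n X) {k : ℕ} (s : ∀ x : X, ⨂[ℂ]^k (L x)) : ℝ≥0∞ :=
  (∫⁻ x, ENNReal.ofReal (h.powNormSq x (s x)) ∂Ω.volumeMeasure) ^ (1 / 2 : ℝ)

/-- The higher covariant derivative `∇_G s` of a section `s` of `L^{⊗k}`, for the Levi-Civita
connection of the Kähler metric and the connection on `L^{⊗k}` induced by the Chern connection of
`(L, h)`, whose connection form is `k θ`. -/
def higherCovariantDerivative (Ω : KahlerForm n X) {m k : ℕ}
    (G : ∀ x : X, ⨂[ℂ]^m (TangentSpace 𝓘(ℂ, Cn n) x)) (s : ∀ x : X, ⨂[ℂ]^k (L x)) (x : X) :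
    ⨂[ℂ]^k (L x) :=
  higherNabla (Ω.christoffel x) (fun z u => (k : ℂ) * h.connectionForm x z u) m
      (tensorCoord G x) (sectionCoord s x) (chartAt (Cn n) x x) •
    PiTensorProduct.tprod ℂ (fun _ : Fin k => frame L x x)

end HermitianMetric

end LineBundle

end BerezinToeplitz

end

/-! The estimate is local on `X`: no integration by parts is needed, and the constant comes from a
finite cover of `X` by compact parts of charts.

*Removing the connections.* Let `W = exp (-k φ)` be the squared length of the frame of `L^k` in a
chart, where `φ = -log |e|²`, and let `f` be the coefficient of a section. Multiplication by `W`
absorbs the connection form, and lowering the indices of `G` by the metric turns its covariant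
derivatives into derivatives of its components. Hence `W ∇_G f` is the contraction of the lowered
tensor `G` with iterated derivatives of `f W`, each `∂/∂z^i` being followed by the inverse matrix of
the metric (`IsChernData.higherNabla_mul_eq`). These iterated derivatives (`raisedDeriv`) take
values in antiholomorphic bundles, whose transition functions `∂/∂z^i` annihilates. This gives the
independence of charts and frames (`IsChernData.higherNabla_comp`).

*The pointwise estimate.* Near a point `z₀`, subtract from `φ` the holomorphic affine function
`affineGauge φ z₀` with the same value and the same `∂` at `z₀`. Then `f W` is the product of a
holomorphic function and of the exponential of `-k (φ - affineGauge φ z₀)`. On the ball of radius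
`δ / √k` around `z₀` the modulus of the first factor is comparable to the length of the section,
times the constant `exp (-k φ(z₀) / 2)`, so that by Cauchy's estimates each derivative costs a
factor `√k`. The exponent of the second factor
has vanishing `∂` at `z₀`, and its higher derivatives are of order `k`, so that here too each
derivative costs at most `√k`. The bookkeeping is done by the predicate `DerivBound`, and the result
is `exists_raisedDeriv_bound`: at `z₀` the length of `∇_G s` is at most a constant times `k^{m/2}`
times the supremum of `|s|` over the ball.

*The `L²` estimate.* In the same gauge, the sub-mean value inequality for holomorphic functions
(`norm_sq_mul_volume_le`) bounds this supremum by the mean square of `s` over the ball of twice the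
radius. Integration over `z₀`, with the order of integration exchanged
(`lintegral_lintegral_ball_le`), gives `exists_lintegral_higherNabla_bound`. On compact subsets of a
chart the measure `ωⁿ / n!` is comparable to the Lebesgue measure: the change of variables formula
shows that it has the expected density (`KahlerForm.volumeMeasure_restrict_le`).
-/

namespace BerezinToeplitz

/-! ### The operators `∂/∂z^i` -/

section Calculus

variable {n : ℕ}

theorem stdVec_sum (u : Cn n) : u = ∑ j, u j • stdVec j := by
  ext i
  simp [Finset.sum_apply, Pi.single_apply]

theorem delHol_add_right (f : Cn n → ℂ) (z u v : Cn n) :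
    delHol f z (u + v) = delHol f z u + delHol f z v := by
  simp only [delHol, smul_add, map_add]; ring

theorem delHol_smul_right (f : Cn n → ℂ) (z : Cn n) (c : ℂ) (u : Cn n) :
    delHol f z (c • u) = c * delHol f z u := by
  have h1 : ∀ v : Cn n, fderiv ℝ f z (c • v)
      = c.re * fderiv ℝ f z v + c.im * fderiv ℝ f z (Complex.I • v) := by
    intro v
    have : c • v = c.re • v + c.im • (Complex.I • v) := by
      conv_lhs => rw [← Complex.re_add_im c]
      rw [add_smul, mul_smul]
      rfl
    rw [this, map_add, map_smul, map_smul]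
    simp
  simp only [delHol]
  rw [smul_comm Complex.I c u, h1, h1, smul_smul Complex.I Complex.I, Complex.I_mul_I, neg_one_smul,
    map_neg]
  conv_rhs => rw [← Complex.re_add_im c]
  linear_combination ((1 : ℂ) / 2 * c.im * fderiv ℝ f z (Complex.I • u)) * Complex.I_mul_I

/-- The form `∂f` at a point, as a complex linear functional. -/
noncomputable def delHolLin (f : Cn n → ℂ) (z : Cn n) : Cn n →ₗ[ℂ] ℂ where
  toFun := delHol f z
  map_add' := delHol_add_right f z
  map_smul' := delHol_smul_right f z

theorem delHol_eq_sum (f : Cn n → ℂ) (z u : Cn n) :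
    delHol f z u = ∑ j, u j * delHol f z (stdVec j) := by
  have : delHolLin f z u = delHolLin f z (∑ j, u j • stdVec j) := by rw [← stdVec_sum]
  rw [map_sum] at this
  simpa [delHolLin, delHol_smul_right] using this

theorem delHol_congr {f g : Cn n → ℂ} {z : Cn n} (h : f =ᶠ[nhds z] g) (u : Cn n) :
    delHol f z u = delHol g z u := by
  simp only [delHol, h.fderiv_eq]

theorem delHol_congr_of_isOpen {U : Set (Cn n)} (hU : IsOpen U) {f g : Cn n → ℂ}
    (h : ∀ z ∈ U, f z = g z) {z : Cn n} (hz : z ∈ U) (u : Cn n) : delHol f z u = delHol g z u :=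
  delHol_congr (Filter.eventually_of_mem (hU.mem_nhds hz) h) u

theorem delHol_const (c : ℂ) (z u : Cn n) : delHol (fun _ => c) z u = 0 := by
  simp [delHol]

theorem delHol_add {f g : Cn n → ℂ} {z : Cn n} (hf : DifferentiableAt ℝ f z)
    (hg : DifferentiableAt ℝ g z) (u : Cn n) :
    delHol (fun w => f w + g w) z u = delHol f z u + delHol g z u := by
  simp only [delHol, fderiv_fun_add hf hg, add_apply]; ring

theorem delHol_neg (f : Cn n → ℂ) (z u : Cn n) :
    delHol (fun w => - f w) z u = - delHol f z u := by
  simp only [delHol, fderiv_fun_neg, neg_apply]; ring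

theorem delHol_sub {f g : Cn n → ℂ} {z : Cn n} (hf : DifferentiableAt ℝ f z)
    (hg : DifferentiableAt ℝ g z) (u : Cn n) :
    delHol (fun w => f w - g w) z u = delHol f z u - delHol g z u := by
  simp only [delHol, fderiv_fun_sub hf hg, sub_apply]; ring

theorem delHol_mul {f g : Cn n → ℂ} {z : Cn n} (hf : DifferentiableAt ℝ f z)
    (hg : DifferentiableAt ℝ g z) (u : Cn n) :
    delHol (fun w => f w * g w) z u = delHol f z u * g z + f z * delHol g z u := by
  simp only [delHol, fderiv_fun_mul hf hg, add_apply,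
    smul_apply, smul_eq_mul]; ring

theorem delHol_const_mul {f : Cn n → ℂ} {z : Cn n} (c : ℂ) (hf : DifferentiableAt ℝ f z)
    (u : Cn n) : delHol (fun w => c * f w) z u = c * delHol f z u := by
  rw [delHol_mul (differentiableAt_const c) hf, delHol_const]; ring

theorem delHol_sum {ι : Type*} (s : Finset ι) {f : ι → Cn n → ℂ} {z : Cn n}
    (hf : ∀ i ∈ s, DifferentiableAt ℝ (f i) z) (u : Cn n) :
    delHol (fun w => ∑ i ∈ s, f i w) z u = ∑ i ∈ s, delHol (f i) z u := by
  simp only [delHol, fderiv_fun_sum hf, sum_apply]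
  rw [Finset.mul_sum, ← Finset.sum_sub_distrib, Finset.mul_sum]

theorem delHol_prod {ι : Type*} [DecidableEq ι] (s : Finset ι) {f : ι → Cn n → ℂ} {z : Cn n}
    (hf : ∀ i ∈ s, DifferentiableAt ℝ (f i) z) (u : Cn n) :
    delHol (fun w => ∏ i ∈ s, f i w) z u
      = ∑ i ∈ s, (∏ j ∈ s.erase i, f j z) * delHol (f i) z u := by
  have h := fderiv_finsetProd (𝕜 := ℝ) hf
  simp only [delHol, h, sum_apply, smul_apply, smul_eq_mul]
  rw [Finset.mul_sum, ← Finset.sum_sub_distrib, Finset.mul_sum]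
  exact Finset.sum_congr rfl fun i _ => by ring

theorem delHol_exp {f : Cn n → ℂ} {z : Cn n} (hf : DifferentiableAt ℝ f z) (u : Cn n) :
    delHol (fun w => Complex.exp (f w)) z u = delHol f z u * Complex.exp (f z) := by
  simp only [delHol, hf.hasFDerivAt.cexp.fderiv, smul_apply, smul_eq_mul]
  ring

theorem fderiv_real_eq {E : Type*} [NormedAddCommGroup E] [NormedSpace ℂ E] [NormedSpace ℝ E]
    [IsScalarTower ℝ ℂ E] {f : Cn n → E} {z : Cn n}
    (hf : DifferentiableAt ℂ f z) (u : Cn n) : fderiv ℝ f z u = fderiv ℂ f z u := by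
  rw [hf.fderiv_restrictScalars ℝ]; rfl

theorem delHol_of_holomorphic {f : Cn n → ℂ} {z : Cn n} (hf : DifferentiableAt ℂ f z) (u : Cn n) :
    delHol f z u = fderiv ℂ f z u := by
  simp only [delHol, fderiv_real_eq hf, map_smul, smul_eq_mul]
  linear_combination (-(1 : ℂ) / 2 * fderiv ℂ f z u) * Complex.I_mul_I

/-- `∂/∂z^i` annihilates antiholomorphic functions. -/
theorem delHol_star {f : Cn n → ℂ} {z : Cn n} (hf : DifferentiableAt ℂ f z) (u : Cn n) :
    delHol (fun w => starRingEnd ℂ (f w)) z u = 0 := by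
  have h1 : HasFDerivAt (fun w => starRingEnd ℂ (f w))
      ((Complex.conjCLE : ℂ →L[ℝ] ℂ).comp (fderiv ℝ f z)) z :=
    (Complex.conjCLE : ℂ →L[ℝ] ℂ).hasFDerivAt.comp z (hf.restrictScalars ℝ).hasFDerivAt
  simp only [delHol, h1.fderiv, ContinuousLinearMap.comp_apply, fderiv_real_eq hf, map_smul,
    smul_eq_mul]
  simp only [ContinuousLinearEquiv.coe_coe, Complex.conjCLE_apply, map_mul, Complex.conj_I]
  linear_combination ((1 : ℂ) / 2 * starRingEnd ℂ (fderiv ℂ f z u)) * Complex.I_mul_I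

theorem delHol_comp {f : Cn n → ℂ} {τ : Cn n → Cn n} {z : Cn n}
    (hf : DifferentiableAt ℝ f (τ z)) (hτ : DifferentiableAt ℂ τ z) (u : Cn n) :
    delHol (fun w => f (τ w)) z u = delHol f (τ z) (fderiv ℂ τ z u) := by
  have : fderiv ℝ (fun w => f (τ w)) z = (fderiv ℝ f (τ z)).comp (fderiv ℝ τ z) :=
    fderiv_comp z hf (hτ.restrictScalars ℝ)
  simp only [delHol, this, ContinuousLinearMap.comp_apply, fderiv_real_eq hτ, map_smul]

theorem contDiffOn_delHol {U : Set (Cn n)} (hU : IsOpen U) {f : Cn n → ℂ}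
    (hf : ContDiffOn ℝ ∞ f U) (u : Cn n) : ContDiffOn ℝ ∞ (fun z => delHol f z u) U := by
  have h := hf.fderiv_of_isOpen hU (m := ∞) (by simp)
  have h1 : ∀ v : Cn n, ContDiffOn ℝ ∞ (fun z => fderiv ℝ f z v) U := fun v =>
    h.clm_apply contDiffOn_const
  exact contDiffOn_const.mul ((h1 u).sub (contDiffOn_const.mul (h1 _)))

theorem differentiableAt_of_contDiffOn {E : Type*} [NormedAddCommGroup E] [NormedSpace ℝ E]
    {U : Set (Cn n)} (hU : IsOpen U) {f : Cn n → E}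
    (hf : ContDiffOn ℝ ∞ f U) {z : Cn n} (hz : z ∈ U) : DifferentiableAt ℝ f z :=
  (hf.differentiableOn (by simp) z hz).differentiableAt (hU.mem_nhds hz)

theorem contDiffOn_real_of_holomorphic {E : Type*} [NormedAddCommGroup E] [NormedSpace ℂ E]
    {U : Set (Cn n)} {f : Cn n → E}
    (hf : ContDiffOn ℂ ∞ f U) : ContDiffOn ℝ ∞ f U := hf.restrict_scalars ℝ

end Calculus

/-! ### Covariant derivatives through antiholomorphic frames -/

section Lowering

variable {n : ℕ}

theorem sum_fin_succ_fun {M : Type*} [AddCommMonoid M] {m : ℕ} (F : (Fin (m + 1) → Fin n) → M) :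
    ∑ I, F I = ∑ i : Fin n, ∑ I : Fin m → Fin n, F (Fin.cons i I) := by
  rw [← (Fin.consEquiv (fun _ => Fin n)).sum_comp, Fintype.sum_prod_type]
  rfl

/-- Exchange of a summation index with the `j`-th entry of a summation multi-index. -/
theorem sum_update_swap {M : Type*} [AddCommMonoid M] {m : ℕ} (j : Fin m)
    (F : (Fin m → Fin n) → Fin n → M) :
    ∑ I, ∑ l, F I l = ∑ I, ∑ l, F (Function.update I j l) (I j) := by
  have hinv : Function.Involutive
      (fun q : (Fin m → Fin n) × Fin n => (Function.update q.1 j q.2, q.1 j)) := by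
    intro q
    simp
  rw [← Fintype.sum_prod_type', ← Fintype.sum_prod_type', ← Equiv.sum_comp hinv.toPerm]
  rfl

/-- The iterated `(1,0)`-derivative of a section of the dual of the conjugate of a line bundle, with
values in the tensor powers of the conjugate tangent bundle: each derivative `∂/∂z^i` is turned into
a conjugate tangent index by `Hi`, the inverse of the matrix of the metric. On such
antiholomorphic bundles `∂/∂z^i` needs no connection form. -/
noncomputable def raisedDeriv (Hi : Cn n → Matrix (Fin n) (Fin n) ℂ) (u : Cn n → ℂ) :
    (m : ℕ) → (Fin m → Fin n) → Cn n → ℂ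
  | 0, _ => u
  | m + 1, L => fun z =>
      ∑ i, Hi z (L 0) i * delHol (raisedDeriv Hi u m (Fin.tail L)) z (stdVec i)

theorem contDiffOn_raisedDeriv {U : Set (Cn n)} (hU : IsOpen U)
    {Hi : Cn n → Matrix (Fin n) (Fin n) ℂ} {u : Cn n → ℂ}
    (hHi : ∀ j l, ContDiffOn ℝ ∞ (fun z => Hi z j l) U) (hu : ContDiffOn ℝ ∞ u U) :
    ∀ (m : ℕ) (L : Fin m → Fin n), ContDiffOn ℝ ∞ (raisedDeriv Hi u m L) U
  | 0, _ => hu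
  | m + 1, L => ContDiffOn.sum fun _ _ => (hHi _ _).mul
      (contDiffOn_delHol hU (contDiffOn_raisedDeriv hU hHi hu m (Fin.tail L)) _)

theorem contDiffOn_tensorNabla {U : Set (Cn n)} (hU : IsOpen U) {m : ℕ}
    {Γ : Cn n → Fin n → Fin n → Fin n → ℂ} (hΓ : ∀ i j p, ContDiffOn ℝ ∞ (fun z => Γ z i j p) U)
    {G : Cn n → (Fin m → Fin n) → ℂ} (hG : ∀ I, ContDiffOn ℝ ∞ (fun z => G z I) U)
    (i : Fin n) (I : Fin m → Fin n) :
    ContDiffOn ℝ ∞ (fun z => tensorNabla Γ i G z I) U :=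
  (contDiffOn_delHol hU (hG I) _).add
    (ContDiffOn.sum fun _ _ => ContDiffOn.sum fun _ _ => (hΓ _ _ _).mul (hG _))

/-- Lowering all indices of a tensor field by the metric turns its covariant derivative into
the plain derivative of its components. -/
theorem sum_tensorNabla_mul_prod {U : Set (Cn n)} (hU : IsOpen U) {m : ℕ}
    {Γ : Cn n → Fin n → Fin n → Fin n → ℂ} {H : Cn n → Matrix (Fin n) (Fin n) ℂ}
    (hH : ∀ j l, ContDiffOn ℝ ∞ (fun z => H z j l) U)
    (hΓ : ∀ z ∈ U, ∀ i j l, delHol (fun w => H w j l) z (stdVec i) = ∑ p, Γ z i j p * H z p l)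
    {G : Cn n → (Fin m → Fin n) → ℂ} (hG : ∀ I, ContDiffOn ℝ ∞ (fun z => G z I) U)
    (i : Fin n) (L : Fin m → Fin n) {z : Cn n} (hz : z ∈ U) :
    ∑ I, tensorNabla Γ i G z I * ∏ j, H z (I j) (L j)
      = delHol (fun w => ∑ I, G w I * ∏ j, H w (I j) (L j)) z (stdVec i) := by
  have dG : ∀ I, DifferentiableAt ℝ (fun w => G w I) z := fun I =>
    differentiableAt_of_contDiffOn hU (hG I) hz
  have dH : ∀ j l, DifferentiableAt ℝ (fun w => H w j l) z := fun j l =>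
    differentiableAt_of_contDiffOn hU (hH j l) hz
  have dP : ∀ I : Fin m → Fin n, DifferentiableAt ℝ (fun w => ∏ j, H w (I j) (L j)) z := fun I =>
    differentiableAt_of_contDiffOn hU (contDiffOn_prod fun j _ => hH _ _) hz
  rw [delHol_sum _ fun I _ => (dG I).fun_mul (dP I)]
  simp only [delHol_mul (dG _) (dP _), tensorNabla, add_mul, Finset.sum_add_distrib]
  congr 1
  simp only [delHol_prod _ fun j _ => dH _ _, hΓ z hz, Finset.sum_mul, Finset.mul_sum]
  rw [Finset.sum_comm]
  conv_rhs => rw [Finset.sum_comm]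
  refine Finset.sum_congr rfl fun j _ => ?_
  rw [sum_update_swap j]
  refine Finset.sum_congr rfl fun I _ => Finset.sum_congr rfl fun l _ => ?_
  rw [← Finset.mul_prod_erase _ _ (Finset.mem_univ j)]
  simp only [Function.update_self, Function.update_idem, Function.update_eq_self]
  have : ∏ a ∈ Finset.univ.erase j, H z (Function.update I j l a) (L a)
      = ∏ a ∈ Finset.univ.erase j, H z (I a) (L a) :=
    Finset.prod_congr rfl fun a ha => by
      rw [Function.update_of_ne (Finset.ne_of_mem_erase ha)]
  rw [this]
  ring

/-- The local description of a Kähler manifold with a Hermitian holomorphic line bundle, on an open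
set `U` of a chart: `H` is the matrix of the metric, `Hi` its inverse, `Γ` are the Christoffel
symbols `∂H * H⁻¹`, `W` is the squared length of a holomorphic frame and `θ = ∂ log W` is the
connection form. -/
structure IsChernData (U : Set (Cn n)) (H Hi : Cn n → Matrix (Fin n) (Fin n) ℂ)
    (Γ : Cn n → Fin n → Fin n → Fin n → ℂ) (W : Cn n → ℂ) (θ : Cn n → Cn n → ℂ) : Prop where
  isOpen : IsOpen U
  smooth : ∀ j l, ContDiffOn ℝ ∞ (fun z => H z j l) U
  smooth_inv : ∀ j l, ContDiffOn ℝ ∞ (fun z => Hi z j l) U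
  mul_inv : ∀ z ∈ U, H z * Hi z = 1
  smooth_christoffel : ∀ i j p, ContDiffOn ℝ ∞ (fun z => Γ z i j p) U
  delHol_metric : ∀ z ∈ U, ∀ i j l,
    delHol (fun w => H w j l) z (stdVec i) = ∑ p, Γ z i j p * H z p l
  smooth_weight : ContDiffOn ℝ ∞ W U
  weight_ne_zero : ∀ z ∈ U, W z ≠ 0
  delHol_weight : ∀ z ∈ U, ∀ i, delHol W z (stdVec i) = θ z (stdVec i) * W z

/-- The higher covariant derivative of `f` is, up to the weight `W`, the contraction of `G`, with
its indices lowered by the metric, with the iterated derivative of `f * W`. By induction on `m`: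
multiplication by `W` absorbs the connection form, and in the Leibniz rule for the contraction the
derivative of the lowered components of `G` is the term that `∇_{∇_Y G'}` subtracts. -/
theorem IsChernData.higherNabla_mul_eq {U : Set (Cn n)}
    {Γ : Cn n → Fin n → Fin n → Fin n → ℂ} {θ : Cn n → Cn n → ℂ}
    {H Hi : Cn n → Matrix (Fin n) (Fin n) ℂ} {W f : Cn n → ℂ} (hD : IsChernData U H Hi Γ W θ)
    (hf : ContDiffOn ℝ ∞ f U) :
    ∀ (m : ℕ) (G : Cn n → (Fin m → Fin n) → ℂ) (_ : ∀ I, ContDiffOn ℝ ∞ (fun z => G z I) U),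
      ∀ z ∈ U, higherNabla Γ θ m G f z * W z
        = ∑ L, (∑ I, G z I * ∏ j, H z (I j) (L j)) * raisedDeriv Hi (fun w => f w * W w) m L z
  | 0, G, hG, z, hz => by
      simp [higherNabla, raisedDeriv, mul_assoc,
        Subsingleton.elim (default : Fin 0 → Fin n) Fin.elim0]
  | m + 1, G, hG, z, hz => by
      obtain ⟨hU, hH, hHi, hinv, hΓs, hΓ, hW, hW0, hθ⟩ := id hD
      have hu : ContDiffOn ℝ ∞ (fun w => f w * W w) U := hf.mul hW
      have hS := contDiffOn_raisedDeriv hU hHi hu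
      have hP : ∀ (i : Fin n) (L : Fin m → Fin n), ContDiffOn ℝ ∞
          (fun w => ∑ I, G w (Fin.cons i I) * ∏ j, H w (I j) (L j)) U := fun i L =>
        ContDiffOn.sum fun I _ => (hG _).mul (contDiffOn_prod fun j _ => hH _ _)
      -- the summand of `higherNabla` for one direction `i`, in terms of derivatives of `f * W`
      have step : ∀ i : Fin n,
          (lineNabla θ i (higherNabla Γ θ m (fun w I => G w (Fin.cons i I)) f) z
            - higherNabla Γ θ m (tensorNabla Γ i (fun w I => G w (Fin.cons i I))) f z) * W z
          = ∑ L, (∑ I, G z (Fin.cons i I) * ∏ j, H z (I j) (L j))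
              * delHol (raisedDeriv Hi (fun w => f w * W w) m L) z (stdVec i) := by
        intro i
        have IH := higherNabla_mul_eq hD hf m
          (fun w I => G w (Fin.cons i I)) (fun I => hG _)
        have IH2 := higherNabla_mul_eq hD hf m
          (tensorNabla Γ i (fun w I => G w (Fin.cons i I)))
          (fun I => contDiffOn_tensorNabla hU hΓs (fun I => hG _) i I) z hz
        set v := higherNabla Γ θ m (fun w I => G w (Fin.cons i I)) f with hv
        have dv : DifferentiableAt ℝ v z := by
          have h1 : ContDiffOn ℝ ∞ v U := by
            have h2 : ContDiffOn ℝ ∞ (fun w => (∑ L, (∑ I, G w (Fin.cons i I) *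
                ∏ j, H w (I j) (L j)) * raisedDeriv Hi (fun w => f w * W w) m L w) * (W w)⁻¹) U :=
              (ContDiffOn.sum fun L _ => (hP i L).mul (hS m L)).mul (hW.inv hW0)
            exact h2.congr fun w hw => by rw [← IH w hw, mul_inv_cancel_right₀ (hW0 w hw)]
          exact differentiableAt_of_contDiffOn hU h1 hz
        have e1 : lineNabla θ i v z * W z = delHol (fun w => v w * W w) z (stdVec i) := by
          rw [delHol_mul dv (differentiableAt_of_contDiffOn hU hW hz), hθ z hz, lineNabla]; ring
        rw [sub_mul, e1, IH2, delHol_congr_of_isOpen hU IH hz,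
          delHol_sum _ fun L _ => differentiableAt_of_contDiffOn hU ((hP i L).mul (hS m L)) hz,
          ← Finset.sum_sub_distrib]
        refine Finset.sum_congr rfl fun L _ => ?_
        rw [delHol_mul (differentiableAt_of_contDiffOn hU (hP i L) hz)
          (differentiableAt_of_contDiffOn hU (hS m L) hz),
          sum_tensorNabla_mul_prod hU hH hΓ (fun I => hG _) i L hz]
        ring
      -- inserting `H * Hi = 1` turns the derivative index `i` into a lowered index of `G`
      have hdelta : ∀ i q, ∑ l, H z i l * Hi z l q = if i = q then 1 else 0 := fun i q => by
        rw [← Matrix.mul_apply, hinv z hz, Matrix.one_apply]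
      simp only [higherNabla]
      rw [Finset.sum_mul, Finset.sum_congr rfl fun i _ => step i, sum_fin_succ_fun]
      simp only [raisedDeriv, Fin.cons_zero, Fin.tail_cons, sum_fin_succ_fun (n := n) (m := m),
        Fin.prod_univ_succ, Fin.cons_succ]
      rw [Finset.sum_comm]
      conv_rhs => rw [Finset.sum_comm]
      refine Finset.sum_congr rfl fun L _ => ?_
      set D := fun q => delHol (raisedDeriv Hi (fun w => f w * W w) m L) z (stdVec q)
      set c := fun i => ∑ I, G z (Fin.cons i I) * ∏ j, H z (I j) (L j)
      have e : ∀ l, (∑ i, ∑ I : Fin m → Fin n,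
          G z (Fin.cons i I) * (H z i l * ∏ j, H z (I j) (L j)))
          = ∑ i, c i * H z i l := fun l => Finset.sum_congr rfl fun i _ => by
        rw [Finset.sum_mul]; exact Finset.sum_congr rfl fun I _ => by ring
      calc ∑ i, c i * D i = ∑ i, ∑ q, c i * (∑ l, H z i l * Hi z l q) * D q := by
            refine Finset.sum_congr rfl fun i _ => ?_
            simp [hdelta]
        _ = ∑ l, (∑ i, c i * H z i l) * ∑ q, Hi z l q * D q := by
            simp only [Finset.mul_sum, Finset.sum_mul]
            rw [Finset.sum_congr rfl fun i _ => Finset.sum_comm, Finset.sum_comm]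
            refine Finset.sum_congr rfl fun l _ => ?_
            conv_rhs => rw [Finset.sum_comm]
            exact Finset.sum_congr rfl fun i _ => Finset.sum_congr rfl fun q _ => by ring
        _ = _ := Finset.sum_congr rfl fun l _ => by rw [e]

end Lowering

/-! ### Change of coordinates and frames -/

section Invariance

variable {n : ℕ}

/-- The Jacobian matrix `∂τ^p/∂z^i` of a holomorphic map, with row index `i`. -/
noncomputable def jacobian (τ : Cn n → Cn n) (z : Cn n) : Matrix (Fin n) (Fin n) ℂ :=
  Matrix.of fun i p => fderiv ℂ τ z (stdVec i) p

theorem contDiffOn_jacobian {V : Set (Cn n)} (hV : IsOpen V) {τ : Cn n → Cn n}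
    (hτ : ContDiffOn ℂ ∞ τ V) (i p : Fin n) : ContDiffOn ℂ ∞ (fun w => jacobian τ w i p) V := by
  have h := hτ.fderiv_of_isOpen hV (m := ∞) (by simp)
  have h1 : ContDiffOn ℂ ∞ (fun w => fderiv ℂ τ w (stdVec i)) V := h.clm_apply contDiffOn_const
  exact (EuclideanSpace.proj p : Cn n →L[ℂ] ℂ).contDiff.comp_contDiffOn h1

theorem delHol_comp_eq_sum {f : Cn n → ℂ} {τ : Cn n → Cn n} {z : Cn n}
    (hf : DifferentiableAt ℝ f (τ z)) (hτ : DifferentiableAt ℂ τ z) (i : Fin n) :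
    delHol (fun w => f (τ w)) z (stdVec i)
      = ∑ p, jacobian τ z i p * delHol f (τ z) (stdVec p) := by
  rw [delHol_comp hf hτ, delHol_eq_sum]
  rfl

theorem inverse_eq_of_congruent {A H H' Hi Hi' : Matrix (Fin n) (Fin n) ℂ}
    (h : H = A * H' * A.conjTranspose) (h1 : H * Hi = 1) (h2 : H' * Hi' = 1) :
    Hi' = A.conjTranspose * Hi * A := by
  have h3 : A * (H' * A.conjTranspose * Hi) = 1 := by
    rw [← h1, h]; simp only [Matrix.mul_assoc]
  have h4 : H' * (A.conjTranspose * Hi * A) = 1 := by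
    rw [← mul_eq_one_comm.mp h3]; simp only [Matrix.mul_assoc]
  have h5 := mul_eq_one_comm.mp h2
  calc Hi' = Hi' * (H' * (A.conjTranspose * Hi * A)) := by rw [h4, Matrix.mul_one]
    _ = _ := by rw [← Matrix.mul_assoc, h5, Matrix.one_mul]

/-- The iterated derivatives transform like tensors with conjugate indices. No derivative of the
Jacobian enters, because `∂/∂z^i` annihilates its conjugate. -/
theorem raisedDeriv_comp {V U' : Set (Cn n)} (hV : IsOpen V) (hU' : IsOpen U')
    {τ : Cn n → Cn n} (hτ : ContDiffOn ℂ ∞ τ V) (hmap : Set.MapsTo τ V U')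
    {Hi Hi' : Cn n → Matrix (Fin n) (Fin n) ℂ} {b u u' : Cn n → ℂ}
    (hHi : ∀ j l, ContDiffOn ℝ ∞ (fun z => Hi z j l) V)
    (hHi' : ∀ j l, ContDiffOn ℝ ∞ (fun z => Hi' z j l) U')
    (hH : ∀ z ∈ V, Hi' (τ z) = (jacobian τ z).conjTranspose * Hi z * jacobian τ z)
    (hb : DifferentiableOn ℂ b V)
    (hu : ContDiffOn ℝ ∞ u V) (hu' : ContDiffOn ℝ ∞ u' U')
    (huu : ∀ z ∈ V, u z = starRingEnd ℂ (b z) * u' (τ z)) :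
    ∀ (m : ℕ) (L : Fin m → Fin n), ∀ z ∈ V,
      starRingEnd ℂ (b z) * raisedDeriv Hi' u' m L (τ z)
        = ∑ K : Fin m → Fin n, (∏ j, starRingEnd ℂ (jacobian τ z (K j) (L j)))
            * raisedDeriv Hi u m K z
  | 0, L, z, hz => by simp [raisedDeriv, huu z hz]
  | m + 1, L, z, hz => by
      have IH := raisedDeriv_comp hV hU' hτ hmap hHi hHi' hH hb hu hu' huu m (Fin.tail L)
      have hτz : DifferentiableAt ℂ τ z :=
        (hτ.differentiableOn (by simp) z hz).differentiableAt (hV.mem_nhds hz)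
      have hbz : DifferentiableAt ℂ b z := (hb z hz).differentiableAt (hV.mem_nhds hz)
      have star_diff : ∀ {f : Cn n → ℂ}, DifferentiableAt ℂ f z →
          DifferentiableAt ℝ (fun w => starRingEnd ℂ (f w)) z := fun hf =>
        (Complex.conjCLE : ℂ →L[ℝ] ℂ).differentiableAt.comp z (hf.restrictScalars ℝ)
      have hS' := differentiableAt_of_contDiffOn hU'
        (contDiffOn_raisedDeriv hU' hHi' hu' m (Fin.tail L)) (hmap hz)
      have hS := fun K => differentiableAt_of_contDiffOn hV
        (contDiffOn_raisedDeriv hV hHi hu m K) hz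
      have hprod : ∀ K : Fin m → Fin n,
          DifferentiableAt ℂ (fun w => ∏ j, jacobian τ w (K j) (Fin.tail L j)) z := fun K =>
        ((contDiffOn_prod fun j _ => contDiffOn_jacobian hV hτ _ _).differentiableOn
          (by simp) z hz).differentiableAt (hV.mem_nhds hz)
      have hSτ : DifferentiableAt ℝ (fun w => raisedDeriv Hi' u' m (Fin.tail L) (τ w)) z :=
        hS'.comp z (hτz.restrictScalars ℝ)
      -- the inductive identity differentiated; conjugates of holomorphic factors are constants
      have key : ∀ i, starRingEnd ℂ (b z) * ∑ p, jacobian τ z i p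
            * delHol (raisedDeriv Hi' u' m (Fin.tail L)) (τ z) (stdVec p)
          = ∑ K : Fin m → Fin n, (∏ j, starRingEnd ℂ (jacobian τ z (K j) (Fin.tail L j)))
            * delHol (raisedDeriv Hi u m K) z (stdVec i) := by
        intro i
        have h1 := delHol_congr_of_isOpen hV IH hz (stdVec i)
        simp only [← map_prod] at h1
        rw [delHol_mul (star_diff hbz) hSτ, delHol_star hbz,
          zero_mul, zero_add, delHol_comp_eq_sum hS' hτz,
          delHol_sum _ fun K _ => (star_diff (hprod K)).fun_mul (hS K)] at h1
        rw [h1]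
        refine Finset.sum_congr rfl fun K _ => ?_
        rw [delHol_mul (star_diff (hprod K)) (hS K), delHol_star (hprod K), zero_mul, zero_add,
          map_prod]
      simp only [raisedDeriv]
      rw [sum_fin_succ_fun]
      simp only [Fin.prod_univ_succ, Fin.cons_zero, Fin.cons_succ, Fin.tail_cons]
      set D' := fun p => delHol (raisedDeriv Hi' u' m (Fin.tail L)) (τ z) (stdVec p)
      set D := fun K i => delHol (raisedDeriv Hi u m K) z (stdVec i)
      set A := jacobian τ z with hA
      have hE : ∀ p, Hi' (τ z) (L 0) p
          = ∑ l, ∑ i, starRingEnd ℂ (A l (L 0)) * Hi z l i * A i p := fun p => by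
        rw [hH z hz, Matrix.mul_apply]
        simp only [Matrix.mul_apply, Finset.sum_mul, Matrix.conjTranspose_apply]
        rw [Finset.sum_comm]
        rfl
      calc starRingEnd ℂ (b z) * ∑ p, Hi' (τ z) (L 0) p * D' p
          = ∑ l, ∑ i, starRingEnd ℂ (A l (L 0)) * Hi z l i
              * (starRingEnd ℂ (b z) * ∑ p, A i p * D' p) := by
            simp only [hE, Finset.mul_sum, Finset.sum_mul]
            rw [Finset.sum_comm]
            refine Finset.sum_congr rfl fun l _ => ?_
            rw [Finset.sum_comm]
            exact Finset.sum_congr rfl fun i _ => Finset.sum_congr rfl fun p _ => by ring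
        _ = _ := by
            simp only [D', key]
            refine Finset.sum_congr rfl fun l _ => ?_
            simp only [Finset.mul_sum]
            rw [Finset.sum_comm]
            exact Finset.sum_congr rfl fun K _ => Finset.sum_congr rfl fun i _ => by
              simp only [Fin.tail]; ring

theorem prod_sum_sum_eq {m : ℕ} (F : Fin m → Fin n → Fin n → ℂ) :
    ∏ j, ∑ p, ∑ q, F j p q = ∑ P : Fin m → Fin n, ∑ Q : Fin m → Fin n, ∏ j, F j (P j) (Q j) := by
  rw [Finset.prod_univ_sum, Fintype.piFinset_univ]
  refine Finset.sum_congr rfl fun P _ => ?_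
  rw [Finset.prod_univ_sum, Fintype.piFinset_univ]

/-- Invariance of the higher covariant derivative under a holomorphic change of coordinates `τ` and
of the frame: if `G'`, `H'` are obtained from `G`, `H` by `τ` and the coefficients of the section
are related by the transition function `b`, so are the coefficients of its covariant derivative. -/
theorem IsChernData.higherNabla_comp {V U' : Set (Cn n)}
    {Γ Γ' : Cn n → Fin n → Fin n → Fin n → ℂ} {θ θ' : Cn n → Cn n → ℂ}
    {H Hi H' Hi' : Cn n → Matrix (Fin n) (Fin n) ℂ} {W W' f f' b : Cn n → ℂ}
    (hD : IsChernData V H Hi Γ W θ) (hD' : IsChernData U' H' Hi' Γ' W' θ')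
    {τ : Cn n → Cn n} (hτ : ContDiffOn ℂ ∞ τ V) (hmap : Set.MapsTo τ V U')
    (hH : ∀ z ∈ V, H z = jacobian τ z * H' (τ z) * (jacobian τ z).conjTranspose)
    (hb : DifferentiableOn ℂ b V)
    (hW : ∀ z ∈ V, W z = b z * starRingEnd ℂ (b z) * W' (τ z))
    (hf : ContDiffOn ℝ ∞ f V) (hf' : ContDiffOn ℝ ∞ f' U')
    (hff : ∀ z ∈ V, f' (τ z) = b z * f z) {m : ℕ}
    {G G' : Cn n → (Fin m → Fin n) → ℂ} (hG : ∀ I, ContDiffOn ℝ ∞ (fun z => G z I) V)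
    (hG' : ∀ I, ContDiffOn ℝ ∞ (fun z => G' z I) U') {z : Cn n} (hz : z ∈ V)
    (hGG : ∀ J, G' (τ z) J = ∑ I, (∏ j, jacobian τ z (I j) (J j)) * G z I) :
    higherNabla Γ' θ' m G' f' (τ z) = b z * higherNabla Γ θ m G f z := by
  have h1 := hD.higherNabla_mul_eq hf m G hG z hz
  have h2 := hD'.higherNabla_mul_eq hf' m G' hG' (τ z) (hmap hz)
  have hinv : ∀ w ∈ V, Hi' (τ w) = (jacobian τ w).conjTranspose * Hi w * jacobian τ w :=
    fun w hw => inverse_eq_of_congruent (hH w hw) (hD.mul_inv w hw) (hD'.mul_inv _ (hmap hw))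
  have h3 := raisedDeriv_comp hD.isOpen hD'.isOpen hτ hmap hD.smooth_inv hD'.smooth_inv hinv hb
    (hf.mul hD.smooth_weight) (hf'.mul hD'.smooth_weight)
    (fun w hw => by rw [hW w hw, hff w hw]; ring) m
  set S := raisedDeriv Hi (fun w => f w * W w) m
  set S' := raisedDeriv Hi' (fun w => f' w * W' w) m
  set A := jacobian τ z
  have hHe : ∀ j l, H z j l = ∑ p, ∑ q, A j p * H' (τ z) p q * starRingEnd ℂ (A l q) := by
    intro j l
    rw [hH z hz, Matrix.mul_apply]
    simp only [Matrix.mul_apply, Finset.sum_mul, Matrix.conjTranspose_apply]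
    rw [Finset.sum_comm]
    rfl
  -- `conj b * W' ∘ τ` and `W` differ by the factor `b`, so this is the claim times `conj b * W'`
  have h4 : starRingEnd ℂ (b z) * (higherNabla Γ' θ' m G' f' (τ z) * W' (τ z))
      = higherNabla Γ θ m G f z * W z := by
    rw [h1, h2]
    change starRingEnd ℂ (b z) * ∑ L, (∑ J, G' (τ z) J * ∏ j, H' (τ z) (J j) (L j)) * S' L (τ z)
      = ∑ K, (∑ I, G z I * ∏ j, H z (I j) (K j)) * S K z
    have h5 : ∀ I K : Fin m → Fin n, ∏ j, H z (I j) (K j)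
        = ∑ J : Fin m → Fin n, ∑ L : Fin m → Fin n, (∏ j, A (I j) (J j))
          * (∏ j, H' (τ z) (J j) (L j)) * ∏ j, starRingEnd ℂ (A (K j) (L j)) := by
      intro I K
      simp only [hHe, prod_sum_sum_eq, Finset.prod_mul_distrib]
    calc starRingEnd ℂ (b z) * ∑ L, (∑ J, G' (τ z) J * ∏ j, H' (τ z) (J j) (L j)) * S' L (τ z)
        = ∑ L, (∑ J, G' (τ z) J * ∏ j, H' (τ z) (J j) (L j))
            * (starRingEnd ℂ (b z) * S' L (τ z)) := by
          rw [Finset.mul_sum]; exact Finset.sum_congr rfl fun L _ => by ring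
      _ = ∑ K : Fin m → Fin n, ∑ I : Fin m → Fin n, ∑ J : Fin m → Fin n, ∑ L : Fin m → Fin n,
          G z I * ((∏ j, A (I j) (J j)) * (∏ j, H' (τ z) (J j) (L j))
            * ∏ j, starRingEnd ℂ (A (K j) (L j))) * S K z := by
          simp only [h3 _ z hz, hGG, Finset.mul_sum, Finset.sum_mul]
          rw [Finset.sum_comm]
          refine Finset.sum_congr rfl fun K _ => ?_
          rw [Finset.sum_congr rfl fun L _ => Finset.sum_comm, Finset.sum_comm]
          refine Finset.sum_congr rfl fun I _ => ?_
          rw [Finset.sum_comm]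
          exact Finset.sum_congr rfl fun J _ => Finset.sum_congr rfl fun L _ => by
            simp only [A, S]; ring
      _ = _ := by
          simp only [h5, Finset.mul_sum, Finset.sum_mul]
  have hb0 : starRingEnd ℂ (b z) ≠ 0 := fun h0 =>
    hD.weight_ne_zero z hz (by rw [hW z hz, h0]; ring)
  have hW0 := hD'.weight_ne_zero _ (hmap hz)
  rw [hW z hz] at h4
  refine mul_left_cancel₀ hb0 (mul_right_cancel₀ hW0 ?_)
  linear_combination h4

end Invariance

/-! ### Holomorphic functions of several variables -/

section Holomorphic

variable {n : ℕ}

theorem norm_fderiv_le_of_ball {f : Cn n → ℂ} {z : Cn n} {R B : ℝ} (hR : 0 < R)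
    (hf : DifferentiableOn ℂ f (Metric.ball z R)) (hB : ∀ w ∈ Metric.ball z R, ‖f w‖ ≤ B) :
    ‖fderiv ℂ f z‖ ≤ 2 * B / R := by
  refine Complex.norm_fderiv_le_div_of_mapsTo_ball hf (fun w hw => ?_) hR
  rw [Metric.mem_closedBall, dist_eq_norm]
  have := norm_sub_le (f w) (f z)
  linarith [hB w hw, hB z (Metric.mem_ball_self hR)]

/-- A directional derivative of a holomorphic function is holomorphic: differentiate Cauchy's
formula for it under the integral sign. -/
theorem differentiableOn_fderiv_apply {f : Cn n → ℂ} {U : Set (Cn n)} (hU : IsOpen U)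
    (hf : DifferentiableOn ℂ f U) (v : Cn n) :
    DifferentiableOn ℂ (fun w => fderiv ℂ f w v) U := by
  intro z hz
  obtain ⟨ε, hε, hεU⟩ := Metric.isOpen_iff.mp hU z hz
  obtain ⟨δ, hδ, hδε⟩ : ∃ δ : ℝ, 0 < δ ∧ 3 * δ < ε := ⟨ε / 4, by positivity, by linarith⟩
  have hK : Metric.closedBall z (3 * δ) ⊆ U :=
    (Metric.closedBall_subset_ball hδε).trans hεU
  obtain ⟨B, hB⟩ := (isCompact_closedBall z (3 * δ)).exists_bound_of_continuousOn
    (hf.continuousOn.mono hK)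
  -- circles of radius `r` in the direction `v`, centred near `z`, stay inside `U`
  set r : ℝ := δ / (‖v‖ + 1) with hr
  have hr0 : 0 < r := by positivity
  have hrv : r * ‖v‖ < δ := by
    rw [hr, div_mul_eq_mul_div, div_lt_iff₀ (by positivity)]
    nlinarith [norm_nonneg v]
  have hmem : ∀ w ∈ Metric.ball z δ, ∀ t : ℂ, ‖t‖ ≤ r → w + t • v ∈ Metric.ball z (2 * δ) := by
    intro w hw t ht
    rw [Metric.mem_ball, dist_eq_norm] at hw ⊢
    calc ‖w + t • v - z‖ = ‖(w - z) + t • v‖ := by congr 1; abel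
      _ ≤ ‖w - z‖ + ‖t‖ * ‖v‖ := (norm_add_le _ _).trans (by rw [norm_smul])
      _ < δ + δ := by
        have : ‖t‖ * ‖v‖ ≤ r * ‖v‖ := by gcongr
        linarith
      _ = 2 * δ := by ring
  have hsub : Metric.ball z (2 * δ) ⊆ U :=
    (Metric.ball_subset_closedBall.trans
      (Metric.closedBall_subset_closedBall (by linarith))).trans hK
  have hder : ∀ y ∈ Metric.ball z (2 * δ), ‖fderiv ℂ f y‖ ≤ 2 * B / δ := by
    intro y hy
    have hs : Metric.ball y δ ⊆ Metric.closedBall z (3 * δ) := by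
      intro w hw
      rw [Metric.mem_ball] at hw hy
      rw [Metric.mem_closedBall]
      linarith [dist_triangle w y z]
    exact norm_fderiv_le_of_ball hδ (hf.mono (hs.trans hK)) fun w hw => hB w (hs hw)
  set c : ℝ → ℂ := fun θ => deriv (circleMap 0 r) θ * ((circleMap 0 r θ) ^ 2)⁻¹ with hc
  have hccont : Continuous c := by
    have h0 : ∀ θ, circleMap 0 r θ ^ 2 ≠ 0 := fun θ =>
      pow_ne_zero 2 (by simp [circleMap, hr0.ne', Complex.exp_ne_zero])
    simp only [hc, deriv_circleMap]
    exact ((continuous_circleMap 0 r).mul continuous_const).mul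
      (((continuous_circleMap 0 r).pow 2).inv₀ h0)
  have hct : ∀ θ, ‖circleMap 0 r θ‖ ≤ r := fun θ => by simp [abs_of_pos hr0]
  have hline : Continuous fun θ => z + circleMap 0 r θ • v :=
    continuous_const.add ((continuous_circleMap 0 r).smul continuous_const)
  have hlinew : ∀ w, Continuous fun θ => w + circleMap 0 r θ • v := fun w =>
    continuous_const.add ((continuous_circleMap 0 r).smul continuous_const)
  have hFc : ∀ w ∈ Metric.ball z δ, Continuous fun θ => c θ * f (w + circleMap 0 r θ • v) := by
    intro w hw
    refine hccont.mul (continuous_iff_continuousAt.mpr fun θ => ?_)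
    have h1 := hsub (hmem w hw _ (hct θ))
    exact ContinuousAt.comp (f := fun θ => w + circleMap 0 r θ • v)
      (hf.continuousOn.continuousAt (hU.mem_nhds h1)) (hlinew w).continuousAt
  have hcauchy : ∀ w ∈ Metric.ball z δ, fderiv ℂ f w v
      = (2 * Real.pi * Complex.I : ℂ)⁻¹ *
        ∫ θ in (0 : ℝ)..2 * Real.pi, c θ * f (w + circleMap 0 r θ • v) := by
    intro w hw
    have hlin : ∀ t : ℂ, HasDerivAt (fun t : ℂ => w + t • v) v t := fun t => by
      simpa using ((hasDerivAt_id t).smul_const v).const_add w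
    have hcomp : ∀ t : ℂ, w + t • v ∈ U →
        HasDerivAt (fun t : ℂ => f (w + t • v)) (fderiv ℂ f (w + t • v) v) t := fun t ht =>
      ((hf _ ht).differentiableAt (hU.mem_nhds ht)).hasFDerivAt.comp_hasDerivAt t (hlin t)
    have hopen : IsOpen ((fun t : ℂ => w + t • v) ⁻¹' U) :=
      hU.preimage (continuous_const.add (continuous_id.smul continuous_const))
    have h1 := Complex.two_pi_I_inv_smul_circleIntegral_sub_sq_inv_smul_of_differentiable
      (f := fun t : ℂ => f (w + t • v)) (c := 0) (w₀ := 0) (R := r) hopen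
      (fun t ht => hsub (hmem w hw t (by simpa using ht)))
      (fun t ht => (hcomp t ht).differentiableAt.differentiableWithinAt)
      (Metric.mem_ball_self hr0)
    have hw0 : w + (0 : ℂ) • v ∈ U := hsub (hmem w hw 0 (by simpa using hr0.le))
    rw [(hcomp 0 hw0).deriv] at h1
    simp only [zero_smul, add_zero] at h1
    rw [← h1, circleIntegral, smul_eq_mul]
    congr 2
    funext θ
    simp only [sub_zero, smul_eq_mul, hc]
    ring
  have hint := intervalIntegral.hasFDerivAt_integral_of_dominated_of_fderiv_le (𝕜 := ℂ)
    (F := fun w θ => c θ * f (w + circleMap 0 r θ • v))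
    (F' := fun w θ => c θ • fderiv ℂ f (w + circleMap 0 r θ • v))
    (x₀ := z) (a := 0) (b := 2 * Real.pi) (μ := volume) (bound := fun θ => ‖c θ‖ * (2 * B / δ))
    (Metric.ball_mem_nhds z hδ)
    (Filter.eventually_of_mem (Metric.ball_mem_nhds z hδ) fun w hw =>
      (hFc w hw).aestronglyMeasurable)
    ((hFc z (Metric.mem_ball_self hδ)).intervalIntegrable _ _)
    (hccont.aestronglyMeasurable.smul
      ((measurable_fderiv ℂ f).comp hline.measurable).aestronglyMeasurable)
    (Filter.Eventually.of_forall fun θ _ w hw => by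
      rw [norm_smul]
      exact mul_le_mul_of_nonneg_left (hder _ (hmem w hw _ (hct θ))) (norm_nonneg _))
    ((hccont.norm.mul continuous_const).intervalIntegrable _ _)
    (Filter.Eventually.of_forall fun θ _ w hw => by
      have h1 := hsub (hmem w hw _ (hct θ))
      have h2 := ((hf _ h1).differentiableAt (hU.mem_nhds h1)).hasFDerivAt
      have h3 : HasFDerivAt (fun w => w + circleMap 0 r θ • v)
          (ContinuousLinearMap.id ℂ (Cn n)) w := (hasFDerivAt_id w).add_const _
      have h4 := (h2.comp w h3).const_mul (c θ)
      simpa using h4)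
  have hd := (hint.const_mul ((2 * Real.pi * Complex.I : ℂ)⁻¹)).differentiableAt
  refine (hd.congr_of_eventuallyEq ?_).differentiableWithinAt
  exact Filter.eventually_of_mem (Metric.ball_mem_nhds z hδ) hcauchy

/-- Holomorphic functions of several variables are smooth. -/
theorem contDiffOn_of_holomorphic {f : Cn n → ℂ} {U : Set (Cn n)} (hU : IsOpen U)
    (hf : DifferentiableOn ℂ f U) : ContDiffOn ℂ ∞ f U := by
  rw [contDiffOn_infty]
  intro N
  induction N generalizing f with
  | zero => exact contDiffOn_zero.mpr hf.continuousOn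
  | succ N ih =>
    push_cast
    rw [contDiffOn_succ_iff_fderiv_of_isOpen hU]
    refine ⟨hf, fun h => by simp at h, ?_⟩
    have h1 : ∀ w, fderiv ℂ f w = ∑ j, fderiv ℂ f w (stdVec j) •
        (EuclideanSpace.proj j : Cn n →L[ℂ] ℂ) := by
      intro w
      ext u
      conv_lhs => rw [stdVec_sum u]
      simp [mul_comm]
    rw [funext h1]
    exact ContDiffOn.sum fun j _ =>
      (ih (differentiableOn_fderiv_apply hU hf _)).smul contDiffOn_const

end Holomorphic

/-! ### Families of functions whose derivatives grow with a given weight -/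

section Weights

variable {n : ℕ} {P : Type*}

/-- The family `A` of functions, indexed by `q : P`, has weight `p` up to `N` derivatives: at the
point `x q` each iterated derivative of `A q` of order `r ≤ N` along the vectors `∂/∂z^i` is bounded
by a constant times `κ q ^ (p + r) * M q`. -/
def DerivBound (x : P → Cn n) (κ M : P → ℝ) : ℕ → ℕ → (P → Cn n → ℂ) → Prop
  | 0, p, A => ∃ C, ∀ q, ‖A q (x q)‖ ≤ C * κ q ^ p * M q
  | N + 1, p, A => (∃ C, ∀ q, ‖A q (x q)‖ ≤ C * κ q ^ p * M q) ∧
      ∀ i, DerivBound x κ M N (p + 1) (fun q w => delHol (A q) w (stdVec i))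

namespace DerivBound

variable {x : P → Cn n} {κ M : P → ℝ} {N p : ℕ} {A B : P → Cn n → ℂ} {U : Set (Cn n)}

theorem value (h : DerivBound x κ M N p A) : ∃ C, ∀ q, ‖A q (x q)‖ ≤ C * κ q ^ p * M q := by
  cases N with
  | zero => exact h
  | succ N => exact h.1

theorem of_succ (h : DerivBound x κ M (N + 1) p A) : DerivBound x κ M N p A := by
  induction N generalizing p A with
  | zero => exact h.1
  | succ N ih => exact ⟨h.1, fun i => ih (h.2 i)⟩

theorem congr (hU : IsOpen U) (hx : ∀ q, x q ∈ U) (h : DerivBound x κ M N p A)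
    (hAB : ∀ q, ∀ z ∈ U, A q z = B q z) : DerivBound x κ M N p B := by
  induction N generalizing p A B with
  | zero => simpa only [DerivBound, hAB _ _ (hx _)] using h
  | succ N ih =>
    refine ⟨by simpa only [hAB _ _ (hx _)] using h.1, fun i => ih (h.2 i) fun q z hz => ?_⟩
    exact delHol_congr_of_isOpen hU (hAB q) hz _

theorem add (hU : IsOpen U) (hx : ∀ q, x q ∈ U) (hA : ∀ q, ContDiffOn ℝ ∞ (A q) U)
    (hB : ∀ q, ContDiffOn ℝ ∞ (B q) U) (h : DerivBound x κ M N p A)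
    (h' : DerivBound x κ M N p B) : DerivBound x κ M N p (fun q z => A q z + B q z) := by
  have val : ∀ {p} {A B : P → Cn n → ℂ}, (∃ C, ∀ q, ‖A q (x q)‖ ≤ C * κ q ^ p * M q) →
      (∃ C, ∀ q, ‖B q (x q)‖ ≤ C * κ q ^ p * M q) →
      ∃ C, ∀ q, ‖A q (x q) + B q (x q)‖ ≤ C * κ q ^ p * M q := by
    rintro p A B ⟨C, hC⟩ ⟨C', hC'⟩
    refine ⟨C + C', fun q => (norm_add_le _ _).trans ?_⟩
    linarith [hC q, hC' q]
  induction N generalizing p A B with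
  | zero => exact val h h'
  | succ N ih =>
    refine ⟨val h.1 h'.1, fun i => ?_⟩
    refine (ih (fun q => contDiffOn_delHol hU (hA q) _) (fun q => contDiffOn_delHol hU (hB q) _)
      (h.2 i) (h'.2 i)).congr hU hx fun q z hz => ?_
    exact (delHol_add (differentiableAt_of_contDiffOn hU (hA q) hz)
      (differentiableAt_of_contDiffOn hU (hB q) hz) _).symm

theorem zero : DerivBound x κ M N p (fun _ _ => 0) := by
  induction N generalizing p with
  | zero => exact ⟨0, fun q => by simp⟩
  | succ N ih => exact ⟨⟨0, fun q => by simp⟩, fun i => by simpa only [delHol_const] using ih⟩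

theorem sum {ι : Type*} (s : Finset ι) {A : ι → P → Cn n → ℂ} (hU : IsOpen U)
    (hx : ∀ q, x q ∈ U) (hA : ∀ i q, ContDiffOn ℝ ∞ (A i q) U)
    (h : ∀ i, DerivBound x κ M N p (A i)) :
    DerivBound x κ M N p (fun q z => ∑ i ∈ s, A i q z) := by
  classical
  induction s using Finset.induction_on with
  | empty => simpa using zero
  | insert i s hi ih =>
    simp only [Finset.sum_insert hi]
    exact add hU hx (hA i) (fun q => ContDiffOn.sum fun j _ => hA j q) (h i) ih

theorem mul (hU : IsOpen U) (hx : ∀ q, x q ∈ U) {M' : P → ℝ} {p' : ℕ} (hκ : ∀ q, 0 ≤ κ q)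
    (hM : ∀ q, 0 ≤ M q) (hA : ∀ q, ContDiffOn ℝ ∞ (A q) U)
    (hB : ∀ q, ContDiffOn ℝ ∞ (B q) U) (h : DerivBound x κ M N p A)
    (h' : DerivBound x κ M' N p' B) :
    DerivBound x κ (fun q => M q * M' q) N (p + p') (fun q z => A q z * B q z) := by
  have val : ∀ {p p'} {A B : P → Cn n → ℂ}, (∃ C, ∀ q, ‖A q (x q)‖ ≤ C * κ q ^ p * M q) →
      (∃ C, ∀ q, ‖B q (x q)‖ ≤ C * κ q ^ p' * M' q) →
      ∃ C, ∀ q, ‖A q (x q) * B q (x q)‖ ≤ C * κ q ^ (p + p') * (M q * M' q) := by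
    rintro p p' A B ⟨C, hC⟩ ⟨C', hC'⟩
    refine ⟨|C| * C', fun q => ?_⟩
    rw [norm_mul]
    have h1 : ‖A q (x q)‖ ≤ |C| * κ q ^ p * M q := (hC q).trans (by
      have := hM q
      have := pow_nonneg (hκ q) p
      gcongr
      exact le_abs_self C)
    calc _ ≤ (|C| * κ q ^ p * M q) * (C' * κ q ^ p' * M' q) :=
          mul_le_mul h1 (hC' q) (norm_nonneg _) ((norm_nonneg _).trans h1)
      _ = _ := by rw [pow_add]; ring
  induction N generalizing p p' A B with
  | zero => exact val h h'
  | succ N ih =>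
    refine ⟨val h.1 h'.1, fun i => ?_⟩
    have h1 := ih (fun q => contDiffOn_delHol hU (hA q) _) hB (h.2 i) h'.of_succ
    have h2 := ih hA (fun q => contDiffOn_delHol hU (hB q) _) h.of_succ (h'.2 i)
    rw [show p + 1 + p' = p + p' + 1 by ring] at h1
    refine (h1.add hU hx (fun q => (contDiffOn_delHol hU (hA q) _).mul (hB q))
      (fun q => (hA q).mul (contDiffOn_delHol hU (hB q) _)) h2).congr hU hx fun q z hz => ?_
    exact (delHol_mul (differentiableAt_of_contDiffOn hU (hA q) hz)
      (differentiableAt_of_contDiffOn hU (hB q) hz) _).symm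

/-- A fixed smooth function has any weight, at points of a compact set. -/
theorem of_contDiffOn (hU : IsOpen U) {K : Set (Cn n)} (hK : IsCompact K) (hKU : K ⊆ U)
    (hx : ∀ q, x q ∈ K) (hκ : ∀ q, 1 ≤ κ q) {f : Cn n → ℂ} (hf : ContDiffOn ℝ ∞ f U) :
    DerivBound x κ (fun _ => 1) N p (fun _ => f) := by
  have val : ∀ {p} {f : Cn n → ℂ}, ContDiffOn ℝ ∞ f U →
      ∃ C, ∀ q, ‖f (x q)‖ ≤ C * κ q ^ p * (fun _ => (1 : ℝ)) q := by
    intro p f hf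
    obtain ⟨C, hC⟩ := hK.exists_bound_of_continuousOn (hf.continuousOn.mono hKU)
    refine ⟨C, fun q => ?_⟩
    have h1 := hC _ (hx q)
    have h2 : 1 ≤ κ q ^ p := one_le_pow₀ (hκ q)
    have h3 := (norm_nonneg _).trans h1
    nlinarith
  induction N generalizing p f with
  | zero => exact val hf
  | succ N ih => exact ⟨val hf, fun i => ih (contDiffOn_delHol hU hf _)⟩

/-- Cauchy's estimates: holomorphic functions that are bounded on balls of radius proportional to
`1 / κ` have weight zero, when the bounds are taken as scales. -/
theorem of_holomorphic (hU : IsOpen U) (hκ : ∀ q, 0 < κ q) {C ρ : ℝ} (hρ : 0 < ρ)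
    (hball : ∀ q, Metric.ball (x q) (ρ / κ q) ⊆ U) (hA : ∀ q, DifferentiableOn ℂ (A q) U)
    (h : ∀ q, ∀ z ∈ Metric.ball (x q) (ρ / κ q), ‖A q z‖ ≤ C * κ q ^ p * M q) :
    DerivBound x κ M N p A := by
  have hx : ∀ q, x q ∈ Metric.ball (x q) (ρ / κ q) := fun q =>
    Metric.mem_ball_self (div_pos hρ (hκ q))
  induction N generalizing p A C ρ with
  | zero => exact ⟨C, fun q => h q _ (hx q)⟩
  | succ N ih =>
    refine ⟨⟨C, fun q => h q _ (hx q)⟩, fun i => ?_⟩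
    have hx2 : ∀ q, x q ∈ U := fun q => hball q (hx q)
    have e : ∀ q, ∀ z ∈ U, fderiv ℂ (A q) z (stdVec i) = delHol (A q) z (stdVec i) :=
      fun q z hz =>
        (delHol_of_holomorphic ((hA q z hz).differentiableAt (hU.mem_nhds hz)) _).symm
    have hsub : ∀ q, Metric.ball (x q) (ρ / 2 / κ q) ⊆ Metric.ball (x q) (ρ / κ q) := fun q =>
      Metric.ball_subset_ball (by have := hκ q; gcongr; linarith)
    refine (ih (C := 4 * C / ρ) (half_pos hρ) (fun q => (hsub q).trans (hball q))
      (fun q => differentiableOn_fderiv_apply hU (hA q) (stdVec i)) (fun q z hz => ?_)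
      (fun q => Metric.mem_ball_self (div_pos (half_pos hρ) (hκ q)))).congr hU hx2 e
    have hb : Metric.ball z (ρ / 2 / κ q) ⊆ Metric.ball (x q) (ρ / κ q) := by
      intro w hw
      rw [Metric.mem_ball] at hw hz ⊢
      calc dist w (x q) ≤ dist w z + dist z (x q) := dist_triangle _ _ _
        _ < ρ / 2 / κ q + ρ / 2 / κ q := by linarith
        _ = ρ / κ q := by ring
    have h1 := norm_fderiv_le_of_ball (div_pos (half_pos hρ) (hκ q))
      ((hA q).mono (hb.trans (hball q))) fun w hw => h q w (hb hw)
    calc ‖fderiv ℂ (A q) z (stdVec i)‖ ≤ ‖fderiv ℂ (A q) z‖ * ‖(stdVec i : Cn n)‖ :=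
          ContinuousLinearMap.le_opNorm _ _
      _ ≤ 2 * (C * κ q ^ p * M q) / (ρ / 2 / κ q) := by simpa using h1
      _ = 4 * C / ρ * κ q ^ (p + 1) * M q := by
          have := (hκ q).ne'
          field_simp
          ring

/-- If the derivatives of `A` have weight one, the exponential of a family `A` vanishing at the
base points has weight zero. -/
theorem exp (hU : IsOpen U) (hx : ∀ q, x q ∈ U) (hκ : ∀ q, 0 ≤ κ q)
    (hA : ∀ q, ContDiffOn ℝ ∞ (A q) U) (h0 : ∀ q, A q (x q) = 0)
    (h : ∀ N i, DerivBound x κ (fun _ => 1) N 1 (fun q w => delHol (A q) w (stdVec i))) :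
    DerivBound x κ (fun _ => 1) N 0 (fun q z => Complex.exp (A q z)) := by
  have val : ∃ C, ∀ q, ‖Complex.exp (A q (x q))‖ ≤ C * κ q ^ 0 * (fun _ => (1 : ℝ)) q :=
    ⟨1, fun q => by simp [h0]⟩
  induction N with
  | zero => exact val
  | succ N ih =>
    refine ⟨val, fun i => ?_⟩
    have h1 := (h N i).mul hU hx hκ (fun _ => zero_le_one)
      (fun q => contDiffOn_delHol hU (hA q) _) (fun q => (hA q).cexp) ih
    simp only [mul_one] at h1
    refine h1.congr hU hx fun q z hz => ?_
    exact (delHol_exp (differentiableAt_of_contDiffOn hU (hA q) hz) _).symm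

/-- Each of the `m` derivatives in `raisedDeriv` raises the weight by one. -/
theorem raisedDeriv {K : Set (Cn n)} (hK : IsCompact K) (hKU : K ⊆ U)
    (hU : IsOpen U) (hx : ∀ q, x q ∈ K) (hκ : ∀ q, 1 ≤ κ q)
    {Hi : Cn n → Matrix (Fin n) (Fin n) ℂ} (hHi : ∀ j l, ContDiffOn ℝ ∞ (fun z => Hi z j l) U)
    (hA : ∀ q, ContDiffOn ℝ ∞ (A q) U) (h : ∀ N, DerivBound x κ M N 0 A) :
    ∀ (m N : ℕ) (L : Fin m → Fin n),
      DerivBound x κ M N m (fun q => BerezinToeplitz.raisedDeriv Hi (A q) m L)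
  | 0, N, L => h N
  | m + 1, N, L => by
      have hs := fun q => contDiffOn_raisedDeriv hU hHi (hA q) m (Fin.tail L)
      have h1 := raisedDeriv hK hKU hU hx hκ hHi hA h m (N + 1) (Fin.tail L)
      refine sum _ hU (fun q => hKU (hx q))
        (A := fun i q z => Hi z (L 0) i
          * delHol (BerezinToeplitz.raisedDeriv Hi (A q) m (Fin.tail L)) z (stdVec i))
        (fun i q => (hHi _ _).mul (contDiffOn_delHol hU (hs q) _)) fun i => ?_
      have h2 := (of_contDiffOn (x := x) (κ := κ) (N := N) (p := 0) hU hK hKU hx hκ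
        (hHi (L 0) i)).mul hU
        (fun q => hKU (hx q)) (fun q => zero_le_one.trans (hκ q)) (fun _ => zero_le_one)
        (fun _ => hHi (L 0) i) (fun q => contDiffOn_delHol hU (hs q) _) (h1.2 i)
      simpa only [one_mul, zero_add] using h2

end DerivBound

end Weights

/-! ### Pointwise estimates at the scale `1 / √k` -/

section Local

variable {n : ℕ}

theorem exists_fderiv_bound {E F : Type*} [NormedAddCommGroup E] [NormedSpace ℝ E]
    [NormedAddCommGroup F] [NormedSpace ℝ F] {U K : Set E} (hU : IsOpen U) (hK : IsCompact K)
    (hKU : K ⊆ U) {g : E → F} (hg : ContDiffOn ℝ ∞ g U) :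
    ∃ C, ∀ x ∈ K, ‖fderiv ℝ g x‖ ≤ C :=
  hK.exists_bound_of_continuousOn
    ((hg.continuousOn_fderiv_of_isOpen hU (by simp)).mono hKU)

/-- A first-order Taylor estimate, uniform over a compact set. -/
theorem exists_taylor_bound {E : Type*} [NormedAddCommGroup E] [NormedSpace ℝ E] [ProperSpace E]
    {U K : Set E} (hU : IsOpen U) (hK : IsCompact K) (hKU : K ⊆ U) {φ : E → ℝ}
    (hφ : ContDiffOn ℝ ∞ φ U) :
    ∃ δ C : ℝ, 0 < δ ∧ 0 ≤ C ∧ ∀ z₀ ∈ K, Metric.ball z₀ δ ⊆ U ∧ ∀ z ∈ Metric.ball z₀ δ,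
      |φ z - φ z₀ - fderiv ℝ φ z₀ (z - z₀)| ≤ C * ‖z - z₀‖ ^ 2 := by
  obtain ⟨δ, hδ, hδU⟩ := hK.exists_cthickening_subset_open hU hKU
  have h1 : ContDiffOn ℝ ∞ (fderiv ℝ φ) U := hφ.fderiv_of_isOpen hU (by simp)
  obtain ⟨C, hC⟩ := exists_fderiv_bound hU (hK.cthickening (r := δ)) hδU h1
  refine ⟨δ, |C|, hδ, abs_nonneg C, fun z₀ hz₀ => ?_⟩
  have hsub : Metric.ball z₀ δ ⊆ Metric.cthickening δ K :=
    Metric.ball_subset_closedBall.trans (Metric.closedBall_subset_cthickening hz₀ δ)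
  refine ⟨hsub.trans hδU, fun z hz => ?_⟩
  have hlip : ∀ w ∈ Metric.ball z₀ δ, ‖fderiv ℝ φ w - fderiv ℝ φ z₀‖ ≤ |C| * ‖w - z₀‖ :=
    fun w hw => (convex_ball z₀ δ).norm_image_sub_le_of_norm_fderiv_le (𝕜 := ℝ)
      (fun y hy => (h1.differentiableOn (by simp) y (hδU (hsub hy))).differentiableAt
        (hU.mem_nhds (hδU (hsub hy))))
      (fun y hy => (hC y (hsub hy)).trans (le_abs_self C)) (Metric.mem_ball_self hδ) hw
  have h3 := ((convex_ball z₀ δ).inter (convex_closedBall z₀ ‖z - z₀‖)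
    ).norm_image_sub_le_of_norm_fderiv_le' (𝕜 := ℝ) (f := φ) (φ := fderiv ℝ φ z₀)
    (C := |C| * ‖z - z₀‖) (x := z₀) (y := z)
    (fun y hy => (hφ.differentiableOn (by simp) y (hδU (hsub hy.1))).differentiableAt
      (hU.mem_nhds (hδU (hsub hy.1))))
    (fun y hy => (hlip y hy.1).trans (by
      have := hy.2
      rw [Metric.mem_closedBall, dist_eq_norm] at this
      gcongr))
    ⟨Metric.mem_ball_self hδ, Metric.mem_closedBall_self (norm_nonneg _)⟩
    ⟨hz, by rw [Metric.mem_closedBall, dist_eq_norm]⟩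
  rw [Real.norm_eq_abs] at h3
  linarith [h3]

/-- The holomorphic affine function with the same value and the same `∂` at `z₀` as `φ`. Twice its
real part minus `φ z₀` agrees with `φ` to first order. -/
noncomputable def affineGauge (φ : Cn n → ℝ) (z₀ z : Cn n) : ℂ :=
  φ z₀ + delHol (fun w => (φ w : ℂ)) z₀ (z - z₀)

theorem affineGauge_self (φ : Cn n → ℝ) (z₀ : Cn n) : affineGauge φ z₀ z₀ = φ z₀ := by
  simp [affineGauge, delHol]

theorem two_mul_re_affineGauge {φ : Cn n → ℝ} {z₀ : Cn n} (hφ : DifferentiableAt ℝ φ z₀)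
    (z : Cn n) : 2 * (affineGauge φ z₀ z).re = 2 * φ z₀ + fderiv ℝ φ z₀ (z - z₀) := by
  have h : HasFDerivAt (fun w => (φ w : ℂ)) (Complex.ofRealCLM.comp (fderiv ℝ φ z₀)) z₀ :=
    Complex.ofRealCLM.hasFDerivAt.comp z₀ hφ.hasFDerivAt
  simp only [affineGauge, delHol, h.fderiv, ContinuousLinearMap.comp_apply,
    Complex.ofRealCLM_apply]
  simp
  ring

theorem hasFDerivAt_affineGauge (φ : Cn n → ℝ) (z₀ z : Cn n) :
    HasFDerivAt (affineGauge φ z₀)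
      (LinearMap.toContinuousLinearMap (delHolLin (fun w => (φ w : ℂ)) z₀)) z := by
  have h := (LinearMap.toContinuousLinearMap
    (delHolLin (fun w => (φ w : ℂ)) z₀)).hasFDerivAt.comp z ((hasFDerivAt_id z).sub_const z₀)
  exact h.const_add _

theorem contDiff_affineGauge (φ : Cn n → ℝ) (z₀ : Cn n) : ContDiff ℂ ∞ (affineGauge φ z₀) :=
  contDiff_const.add ((LinearMap.toContinuousLinearMap
    (delHolLin (fun w => (φ w : ℂ)) z₀)).contDiff.comp (contDiff_id.sub contDiff_const))

theorem delHol_affineGauge (φ : Cn n → ℝ) (z₀ z u : Cn n) :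
    delHol (affineGauge φ z₀) z u = delHol (fun w => (φ w : ℂ)) z₀ u := by
  rw [delHol_of_holomorphic (hasFDerivAt_affineGauge φ z₀ z).differentiableAt,
    (hasFDerivAt_affineGauge φ z₀ z).fderiv]
  rfl

/-- If `f` is the coefficient of a section of `L^k` in a frame `e^k` with `|e|² = exp (-φ)`, this is
its coefficient in the frame obtained by multiplying `e` by `exp (affineGauge φ z₀)`. The potential
of the new frame is constant to first order at `z₀`. -/
noncomputable def gauged (φ : Cn n → ℝ) (k : ℕ) (z₀ : Cn n) (f : Cn n → ℂ) (z : Cn n) : ℂ :=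
  f z * Complex.exp (-(k : ℂ) * affineGauge φ z₀ z)

theorem differentiableOn_gauged {U : Set (Cn n)} {f : Cn n → ℂ} (hf : DifferentiableOn ℂ f U)
    (φ : Cn n → ℝ) (k : ℕ) (z₀ : Cn n) : DifferentiableOn ℂ (gauged φ k z₀ f) U :=
  hf.mul (((contDiff_affineGauge φ z₀).differentiable (by simp)).const_mul _).cexp.differentiableOn

theorem norm_gauged_sq (φ : Cn n → ℝ) (k : ℕ) (z₀ : Cn n) (f : Cn n → ℂ) (z : Cn n) :
    ‖gauged φ k z₀ f z‖ ^ 2 = ‖f z‖ ^ 2 * Real.exp (-(k * (2 * (affineGauge φ z₀ z).re))) := by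
  rw [gauged, norm_mul, mul_pow, Complex.norm_exp, ← Real.exp_nat_mul]
  congr 2
  have : (-(k : ℂ) * affineGauge φ z₀ z).re = -(k * (affineGauge φ z₀ z).re) := by
    simp [Complex.mul_re]
  rw [this]
  push_cast
  ring

theorem norm_gauged_self_sq (φ : Cn n → ℝ) (k : ℕ) (z₀ : Cn n) (f : Cn n → ℂ) :
    ‖gauged φ k z₀ f z₀‖ ^ 2
      = ‖f z₀‖ ^ 2 * Real.exp (-(k * φ z₀)) * Real.exp (-(k * φ z₀)) := by
  rw [norm_gauged_sq, affineGauge_self, mul_assoc, ← Real.exp_add]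
  congr 2
  simp
  ring

/-- At distance `ρ / √k` from `z₀` the quadratic error of the potential, multiplied by `k`, stays
bounded. -/
theorem norm_gauged_sq_le {φ : Cn n → ℝ} {z₀ z : Cn n} {C ρ : ℝ} (hφ : DifferentiableAt ℝ φ z₀)
    (hC : 0 ≤ C) {k : ℕ} (hk : 1 ≤ k) (hz : z ∈ Metric.ball z₀ (ρ / √k))
    (h : |φ z - φ z₀ - fderiv ℝ φ z₀ (z - z₀)| ≤ C * ‖z - z₀‖ ^ 2) (f : Cn n → ℂ) :
    ‖gauged φ k z₀ f z‖ ^ 2 ≤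
      ‖f z‖ ^ 2 * Real.exp (-(k * φ z)) * Real.exp (-(k * φ z₀)) * Real.exp (C * ρ ^ 2) := by
  rw [norm_gauged_sq, two_mul_re_affineGauge hφ, mul_assoc, mul_assoc, ← Real.exp_add,
    ← Real.exp_add]
  have hk' : (0 : ℝ) < k := by exact_mod_cast hk
  have h1 : (k : ℝ) * ‖z - z₀‖ ^ 2 ≤ ρ ^ 2 := by
    rw [Metric.mem_ball, dist_eq_norm] at hz
    calc (k : ℝ) * ‖z - z₀‖ ^ 2 ≤ k * (ρ / √k) ^ 2 := by gcongr
      _ = ρ ^ 2 := by rw [div_pow, Real.sq_sqrt hk'.le]; field_simp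
  have h2 := neg_le_of_abs_le h
  have h4 := le_of_abs_le h
  have h3 : (k : ℝ) * (φ z - φ z₀ - fderiv ℝ φ z₀ (z - z₀)) ≤ C * ρ ^ 2 := by
    calc _ ≤ (k : ℝ) * (C * ‖z - z₀‖ ^ 2) := by gcongr
      _ = C * (k * ‖z - z₀‖ ^ 2) := by ring
      _ ≤ _ := by gcongr
  gcongr
  nlinarith

/-- Families of constants bounded by `κ ^ p` have weight `p`. -/
theorem DerivBound.of_const {P : Type*} {x : P → Cn n} {κ : P → ℝ} {N p : ℕ} {c : P → ℂ} {C : ℝ}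
    (h : ∀ q, ‖c q‖ ≤ C * κ q ^ p) : DerivBound x κ (fun _ => 1) N p (fun q _ => c q) := by
  cases N with
  | zero => exact ⟨C, fun q => by simpa using h q⟩
  | succ N =>
    exact ⟨⟨C, fun q => by simpa using h q⟩, fun i => by
      simpa only [delHol_const] using DerivBound.zero⟩

/-- The key pointwise estimate. The function `f * exp (-k φ)` is the product of a holomorphic
function and of `exp (-k (φ - affineGauge φ z₀))`, whose exponent vanishes to first order for the
operators `∂/∂z^i`; at the scale `1 / √k` both factors have weight zero. -/
theorem exists_raisedDeriv_bound {U K : Set (Cn n)} (hU : IsOpen U) (hK : IsCompact K)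
    (hKU : K ⊆ U) {φ : Cn n → ℝ} (hφ : ContDiffOn ℝ ∞ φ U)
    {Hi : Cn n → Matrix (Fin n) (Fin n) ℂ} (hHi : ∀ j l, ContDiffOn ℝ ∞ (fun z => Hi z j l) U)
    {δ C : ℝ} (hδ : 0 < δ) (hC : 0 ≤ C)
    (hT : ∀ z₀ ∈ K, Metric.ball z₀ δ ⊆ U ∧ ∀ z ∈ Metric.ball z₀ δ,
      |φ z - φ z₀ - fderiv ℝ φ z₀ (z - z₀)| ≤ C * ‖z - z₀‖ ^ 2)
    (m : ℕ) (L : Fin m → Fin n) :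
    ∃ C' : ℝ, ∀ (k : ℕ) (f : Cn n → ℂ) (z₀ : Cn n) (M : ℝ), 1 ≤ k → DifferentiableOn ℂ f U →
      z₀ ∈ K → 0 ≤ M →
      (∀ z ∈ Metric.ball z₀ (δ / √k), ‖f z‖ ^ 2 * Real.exp (-(k * φ z)) ≤ M ^ 2) →
      ‖raisedDeriv Hi (fun z => f z * Complex.exp (-((k : ℂ) * φ z))) m L z₀‖
        ≤ C' * √k ^ m * (M * Real.exp (-(k * φ z₀) / 2)) := by
  -- The weight calculus is applied to the family of all admissible data `k, f, z₀, M`, so that the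
  -- constant it yields does not depend on them.
  let P := {q : ℕ × (Cn n → ℂ) × Cn n × ℝ // 1 ≤ q.1 ∧ DifferentiableOn ℂ q.2.1 U ∧
    q.2.2.1 ∈ K ∧ 0 ≤ q.2.2.2 ∧ ∀ z ∈ Metric.ball q.2.2.1 (δ / √q.1),
      ‖q.2.1 z‖ ^ 2 * Real.exp (-(q.1 * φ z)) ≤ q.2.2.2 ^ 2}
  let k : P → ℕ := fun q => q.1.1
  let f : P → Cn n → ℂ := fun q => q.1.2.1
  let x : P → Cn n := fun q => q.1.2.2.1
  let κ : P → ℝ := fun q => √(k q)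
  let M : P → ℝ := fun q => q.1.2.2.2 * Real.exp (-(k q * φ (x q)) / 2)
  have hk : ∀ q, 1 ≤ k q := fun q => q.2.1
  have hf : ∀ q, DifferentiableOn ℂ (f q) U := fun q => q.2.2.1
  have hx : ∀ q, x q ∈ K := fun q => q.2.2.2.1
  have hxU : ∀ q, x q ∈ U := fun q => hKU (hx q)
  have hκ : ∀ q, 1 ≤ κ q := fun q => by
    rw [Real.one_le_sqrt]; exact_mod_cast hk q
  have hκ2 : ∀ q, κ q ^ 2 = k q := fun q => Real.sq_sqrt (Nat.cast_nonneg _)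
  have hM : ∀ q, 0 ≤ M q := fun q => mul_nonneg q.2.2.2.2.1 (Real.exp_pos _).le
  have hφc : ContDiffOn ℝ ∞ (fun z => (φ z : ℂ)) U := Complex.ofRealCLM.contDiff.comp_contDiffOn hφ
  let F : P → Cn n → ℂ := fun q => gauged φ (k q) (x q) (f q)
  let E : P → Cn n → ℂ := fun q z => -(k q : ℂ) * (φ z - affineGauge φ (x q) z)
  have hFh : ∀ q, DifferentiableOn ℂ (F q) U := fun q => differentiableOn_gauged (hf q) _ _ _
  have hFs : ∀ q, ContDiffOn ℝ ∞ (F q) U := fun q =>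
    contDiffOn_real_of_holomorphic (contDiffOn_of_holomorphic hU (hFh q))
  have hgs : ∀ q, ContDiffOn ℝ ∞ (affineGauge φ (x q)) U := fun q =>
    contDiffOn_real_of_holomorphic (contDiff_affineGauge φ (x q)).contDiffOn
  have hEs : ∀ q, ContDiffOn ℝ ∞ (E q) U := fun q => contDiffOn_const.mul (hφc.sub (hgs q))
  have hballδ : ∀ q, Metric.ball (x q) (δ / κ q) ⊆ Metric.ball (x q) δ := fun q =>
    Metric.ball_subset_ball (div_le_self hδ.le (hκ q))
  have wF : ∀ N, DerivBound x κ M N 0 F := fun N => by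
    refine DerivBound.of_holomorphic (C := Real.exp (C * δ ^ 2 / 2)) hU
      (fun q => zero_lt_one.trans_le (hκ q)) hδ (fun q => (hballδ q).trans (hT _ (hx q)).1) hFh
      fun q z hz => ?_
    have h1 := norm_gauged_sq_le (differentiableAt_of_contDiffOn hU hφ (hxU q)) hC (hk q) hz
      ((hT _ (hx q)).2 z (hballδ q hz)) (f q)
    have h2 := q.2.2.2.2.2 z hz
    refine le_of_sq_le_sq ?_ (by have := hM q; positivity)
    refine h1.trans ?_
    calc ‖f q z‖ ^ 2 * Real.exp (-(k q * φ z)) * Real.exp (-(k q * φ (x q))) * Real.exp (C * δ ^ 2)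
        ≤ q.1.2.2.2 ^ 2 * Real.exp (-(k q * φ (x q))) * Real.exp (C * δ ^ 2) := by
          gcongr
      _ = _ := by
          simp only [M, pow_zero, mul_one, mul_pow]
          rw [← Real.exp_nat_mul, ← Real.exp_nat_mul]
          push_cast
          rw [show 2 * (C * δ ^ 2 / 2) = C * δ ^ 2 by ring,
            show 2 * (-(k q * φ (x q)) / 2) = -(k q * φ (x q)) by ring]
          ring
  have wdE : ∀ N i, DerivBound x κ (fun _ => 1) N 1
      (fun q w => delHol (E q) w (stdVec i)) := fun N i => by
    have e : ∀ q, ∀ z ∈ U, -(k q : ℂ) * (delHol (fun w => (φ w : ℂ)) z (stdVec i)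
        - delHol (fun w => (φ w : ℂ)) (x q) (stdVec i)) = delHol (E q) z (stdVec i) := by
      intro q z hz
      have d1 := differentiableAt_of_contDiffOn hU hφc hz
      have d2 := differentiableAt_of_contDiffOn hU (hgs q) hz
      rw [delHol_const_mul _ (d1.fun_sub d2), delHol_sub d1 d2, delHol_affineGauge]
    refine DerivBound.congr hU hxU ?_ e
    have ha := contDiffOn_delHol hU hφc (stdVec i)
    -- The derivative vanishes at the base point. The next one no longer sees the affine function,
    -- and `k = κ ^ 2` gives it weight two.
    cases N with
    | zero => exact ⟨0, fun q => by simp⟩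
    | succ N =>
      refine ⟨⟨0, fun q => by simp⟩, fun j => ?_⟩
      have haj := contDiffOn_delHol hU ha (stdVec j)
      have h1 := (DerivBound.of_const (x := x) (κ := κ) (N := N) (p := 2) (C := 1)
        (c := fun q => -(k q : ℂ)) (fun q => by rw [hκ2]; simp)).mul hU hxU
        (fun q => zero_le_one.trans (hκ q)) (fun _ => zero_le_one) (fun q => contDiffOn_const)
        (fun q => haj)
        (DerivBound.of_contDiffOn (p := 0) hU hK hKU hx hκ haj)
      simp only [mul_one, add_zero] at h1
      refine h1.congr hU hxU fun q z hz => ?_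
      have d := differentiableAt_of_contDiffOn hU ha hz
      rw [delHol_const_mul _ (d.fun_sub (differentiableAt_const _)),
        delHol_sub d (differentiableAt_const _), delHol_const, sub_zero]
  have wE : ∀ N, DerivBound x κ (fun _ => 1) N 0 (fun q z => Complex.exp (E q z)) := fun N =>
    DerivBound.exp hU hxU (fun q => zero_le_one.trans (hκ q)) hEs
      (fun q => by simp [E, affineGauge_self]) wdE
  have wu : ∀ N, DerivBound x κ M N 0 (fun q z => F q z * Complex.exp (E q z)) := fun N => by
    have := (wF N).mul hU hxU (fun q => zero_le_one.trans (hκ q)) hM hFs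
      (fun q => (hEs q).cexp) (wE N)
    simpa only [mul_one, add_zero] using this
  obtain ⟨C', hC'⟩ := (DerivBound.raisedDeriv hK hKU hU hx hκ hHi
    (fun q => (hFs q).mul (hEs q).cexp) wu m 0 L).value
  refine ⟨C', fun k₁ f₁ z₁ M₁ h1 h2 h3 h4 h5 => ?_⟩
  have h6 := hC' ⟨(k₁, f₁, z₁, M₁), h1, h2, h3, h4, h5⟩
  convert! h6 using 3
  funext z
  simp only [F, E, gauged, mul_assoc, ← Complex.exp_add]
  congr 2
  simp only [k, x]
  ring

end Local

/-! ### Mean values -/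

section MeanValue

variable {n : ℕ}

/-- Multiplication by a unit complex number, as a real linear isometry. -/
noncomputable def unitRotation (c : ℂ) (hc : ‖c‖ = 1) : Cn n ≃ₗᵢ[ℝ] Cn n where
  toLinearEquiv := DistribMulAction.toLinearEquiv ℝ (Cn n)
    (Units.mk0 c (norm_ne_zero_iff.mp (by rw [hc]; exact one_ne_zero)))
  norm_map' u := by
    change ‖c • u‖ = ‖u‖
    rw [norm_smul, hc, one_mul]

theorem lintegral_unit_smul (c : ℂ) (hc : ‖c‖ = 1) {g : Cn n → ℝ≥0∞} (hg : Measurable g) :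
    ∫⁻ w, g (c • w) = ∫⁻ w, g w :=
  (unitRotation c hc).measurePreserving.lintegral_comp hg

theorem measurable_indicator_of_continuousOn {X : Type*} [TopologicalSpace X] [MeasurableSpace X]
    [OpensMeasurableSpace X] {s : Set X} (hs : MeasurableSet s) {g : X → ℝ≥0∞}
    (hg : ContinuousOn g s) : Measurable (s.indicator g) := by
  classical
  rw [← Set.piecewise_eq_indicator]
  exact hg.measurable_piecewise continuousOn_const hs

/-- The sub-mean value inequality for `‖q‖²` on the unit circle. -/
theorem norm_sq_mul_two_pi_le {q : ℂ → ℂ} {U : Set ℂ} (hq : DifferentiableOn ℂ q U)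
    (hball : Metric.closedBall 0 1 ⊆ U) :
    ENNReal.ofReal (‖q 0‖ ^ 2) * ENNReal.ofReal (2 * Real.pi)
      ≤ ∫⁻ θ in Set.Ioc 0 (2 * Real.pi), ENNReal.ofReal (‖q (circleMap 0 1 θ)‖ ^ 2) := by
  have h1 : DiffContOnCl ℂ (fun t => q t ^ 2) (Metric.ball 0 |1|) := by
    refine DifferentiableOn.diffContOnCl ?_
    rw [abs_one, closure_ball _ one_ne_zero]
    exact (hq.mono hball).fun_pow 2
  have h2 := h1.circleAverage
  rw [Real.circleAverage, intervalIntegral.integral_of_le Real.two_pi_pos.le] at h2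
  have h3 : ∫ θ in Set.Ioc 0 (2 * Real.pi), q (circleMap 0 1 θ) ^ 2
      = (2 * Real.pi : ℝ) • q 0 ^ 2 := by
    rw [← h2, smul_smul, mul_inv_cancel₀ Real.two_pi_pos.ne', one_smul]
  have h4 := enorm_integral_le_lintegral_enorm (μ := volume.restrict (Set.Ioc 0 (2 * Real.pi)))
    (fun θ => q (circleMap 0 1 θ) ^ 2)
  rw [h3] at h4
  simp only [← ofReal_norm, norm_smul, norm_pow, Real.norm_eq_abs,
    abs_of_pos Real.two_pi_pos] at h4
  rw [← ENNReal.ofReal_mul (by positivity), mul_comm]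
  exact h4

/-- The sub-mean value inequality for the squared modulus of a holomorphic function on balls. The
average over a ball is rotation invariant, and the average over the circle orbits reduces
to one complex variable. -/
theorem norm_sq_mul_volume_le {f : Cn n → ℂ} {z₀ : Cn n} {r : ℝ}
    (hf : DifferentiableOn ℂ f (Metric.ball z₀ r)) :
    ENNReal.ofReal (‖f z₀‖ ^ 2) * volume (Metric.ball (0 : Cn n) r)
      ≤ ∫⁻ w in Metric.ball z₀ r, ENNReal.ofReal (‖f w‖ ^ 2) := by
  set g : Cn n → ℝ≥0∞ := (Metric.ball 0 r).indicator fun w => ENNReal.ofReal (‖f (z₀ + w)‖ ^ 2)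
    with hg
  have hmap : ∀ w, w ∈ Metric.ball (0 : Cn n) r → z₀ + w ∈ Metric.ball z₀ r := fun w hw => by
    simpa [dist_eq_norm] using hw
  have hgm : Measurable g := by
    have hc : ContinuousOn (fun w => ENNReal.ofReal (‖f (z₀ + w)‖ ^ 2))
        (Metric.ball (0 : Cn n) r) :=
      ENNReal.continuous_ofReal.comp_continuousOn
        (((hf.continuousOn.comp (continuous_const.add continuous_id).continuousOn hmap).norm).pow 2)
    exact measurable_indicator_of_continuousOn measurableSet_ball hc
  have hI : ∫⁻ w in Metric.ball z₀ r, ENNReal.ofReal (‖f w‖ ^ 2) = ∫⁻ w, g w := by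
    rw [hg, lintegral_indicator measurableSet_ball, ← lintegral_indicator measurableSet_ball,
      ← lintegral_indicator measurableSet_ball,
      ← lintegral_add_left_eq_self _ z₀]
    refine lintegral_congr fun w => ?_
    have : z₀ + w ∈ Metric.ball z₀ r ↔ w ∈ Metric.ball (0 : Cn n) r := by simp [dist_eq_norm]
    by_cases hw : w ∈ Metric.ball (0 : Cn n) r
    · rw [Set.indicator_of_mem hw, Set.indicator_of_mem (this.mpr hw)]
    · rw [Set.indicator_of_notMem hw, Set.indicator_of_notMem (this.not.mpr hw)]
  rw [hI]
  -- The rotated integrals all agree, so the integral may be averaged over the rotations.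
  have hunit : ∀ θ, ‖circleMap 0 1 θ‖ = 1 := fun θ => by simp
  have hswap : ∫⁻ θ in Set.Ioc 0 (2 * Real.pi), ∫⁻ w, g (circleMap 0 1 θ • w)
      = ∫⁻ w, ∫⁻ θ in Set.Ioc 0 (2 * Real.pi), g (circleMap 0 1 θ • w) := by
    refine lintegral_lintegral_swap (Measurable.aemeasurable ?_)
    exact hgm.comp (((continuous_circleMap 0 1).comp continuous_fst).smul continuous_snd).measurable
  simp only [lintegral_unit_smul _ (hunit _) hgm] at hswap
  rw [setLIntegral_const, Real.volume_Ioc, sub_zero] at hswap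
  have hpi : ENNReal.ofReal (2 * Real.pi) ≠ 0 := by
    simpa using Real.pi_pos
  rw [← ENNReal.mul_le_mul_iff_left hpi ENNReal.ofReal_ne_top, hswap]
  calc ENNReal.ofReal (‖f z₀‖ ^ 2) * volume (Metric.ball (0 : Cn n) r)
        * ENNReal.ofReal (2 * Real.pi)
      = ∫⁻ w in Metric.ball (0 : Cn n) r,
          ENNReal.ofReal (‖f z₀‖ ^ 2) * ENNReal.ofReal (2 * Real.pi) := by
        rw [setLIntegral_const]; ring
    _ = ∫⁻ w, (Metric.ball (0 : Cn n) r).indicator (fun _ =>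
          ENNReal.ofReal (‖f z₀‖ ^ 2) * ENNReal.ofReal (2 * Real.pi)) w :=
        (lintegral_indicator measurableSet_ball _).symm
    _ ≤ _ := by
        refine lintegral_mono fun w => ?_
        by_cases hw : w ∈ Metric.ball (0 : Cn n) r
        · rw [Set.indicator_of_mem hw]
          have hd : DifferentiableOn ℂ (fun t : ℂ => f (z₀ + t • w))
              ((fun t : ℂ => z₀ + t • w) ⁻¹' Metric.ball z₀ r) :=
            hf.comp ((differentiable_id.smul_const w).const_add z₀).differentiableOn fun t ht => ht
          have hw' : ‖w‖ < r := by simpa using hw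
          have h1 := norm_sq_mul_two_pi_le hd (fun t ht => by
            have ht' : ‖t‖ ≤ 1 := by simpa using ht
            have : ‖t • w‖ < r := by
              rw [norm_smul]
              nlinarith [norm_nonneg w]
            simpa [dist_eq_norm] using this)
          simp only [zero_smul, add_zero] at h1
          refine h1.trans (le_of_eq (lintegral_congr fun θ => ?_))
          have : circleMap 0 1 θ • w ∈ Metric.ball (0 : Cn n) r := by
            simpa [norm_smul, hunit] using hw
          rw [hg, Set.indicator_of_mem this]
        · rw [Set.indicator_of_notMem hw]; exact zero_le

/-- The weighted sub-mean value inequality at the scale `1 / √k`. -/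
theorem weighted_norm_sq_mul_volume_le {f : Cn n → ℂ} {φ : Cn n → ℝ} {z₀ : Cn n} {δ C : ℝ}
    (hφ : DifferentiableAt ℝ φ z₀) (hC : 0 ≤ C) {k : ℕ} (hk : 1 ≤ k)
    (hf : DifferentiableOn ℂ f (Metric.ball z₀ (δ / √k)))
    (hT : ∀ z ∈ Metric.ball z₀ (δ / √k),
      |φ z - φ z₀ - fderiv ℝ φ z₀ (z - z₀)| ≤ C * ‖z - z₀‖ ^ 2) :
    ENNReal.ofReal (‖f z₀‖ ^ 2 * Real.exp (-(k * φ z₀)))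
        * volume (Metric.ball (0 : Cn n) (δ / √k))
      ≤ ENNReal.ofReal (Real.exp (C * δ ^ 2)) *
        ∫⁻ w in Metric.ball z₀ (δ / √k), ENNReal.ofReal (‖f w‖ ^ 2 * Real.exp (-(k * φ w))) := by
  set e := ENNReal.ofReal (Real.exp (-(k * φ z₀))) with he
  have he0 : e ≠ 0 := by simp [he, Real.exp_pos]
  have h1 := norm_sq_mul_volume_le (differentiableOn_gauged hf φ k z₀)
  rw [norm_gauged_self_sq, ENNReal.ofReal_mul (by positivity)] at h1
  rw [← ENNReal.mul_le_mul_iff_left he0 ENNReal.ofReal_ne_top]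
  calc _ = _ := by rw [mul_right_comm]
    _ ≤ _ := h1
    _ ≤ ∫⁻ w in Metric.ball z₀ (δ / √k), e * ENNReal.ofReal (Real.exp (C * δ ^ 2)) *
          ENNReal.ofReal (‖f w‖ ^ 2 * Real.exp (-(k * φ w))) := by
        refine setLIntegral_mono' measurableSet_ball fun w hw => ?_
        rw [he, ← ENNReal.ofReal_mul (by positivity), ← ENNReal.ofReal_mul (by positivity)]
        refine ENNReal.ofReal_le_ofReal ?_
        have := norm_gauged_sq_le hφ hC hk hw (hT w hw) f
        linarith
    _ = _ := by
        rw [lintegral_const_mul' _ _ (ENNReal.mul_ne_top ENNReal.ofReal_ne_top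
          ENNReal.ofReal_ne_top)]
        ring

/-- Averaging over balls of radius `2 r` is bounded on `L¹`. -/
theorem lintegral_lintegral_ball_le {U K : Set (Cn n)} (hU : MeasurableSet U)
    (hK : MeasurableSet K) {r : ℝ} (hr : 0 < r)
    (hsub : ∀ z ∈ K, Metric.ball z (2 * r) ⊆ U) {g : Cn n → ℝ≥0∞} (hg : Measurable g) :
    ∫⁻ z in K, ∫⁻ w in Metric.ball z (2 * r), g w
      ≤ ENNReal.ofReal (2 ^ (2 * n)) * volume (Metric.ball (0 : Cn n) r) * ∫⁻ w in U, g w := by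
  have hfin : Module.finrank ℝ (Cn n) = 2 * n := by
    rw [← Module.finrank_mul_finrank ℝ ℂ (Cn n)]
    simp
  have hvol : ∀ w : Cn n, volume (Metric.ball w (2 * r))
      = ENNReal.ofReal (2 ^ (2 * n)) * volume (Metric.ball (0 : Cn n) r) := fun w => by
    rw [Measure.addHaar_ball_of_pos _ _ (by positivity : 0 < 2 * r),
      Measure.addHaar_ball_of_pos _ _ hr, hfin, mul_pow, ENNReal.ofReal_mul (by positivity)]
    ring
  calc ∫⁻ z in K, ∫⁻ w in Metric.ball z (2 * r), g w
      ≤ ∫⁻ z in K, ∫⁻ w in U, (Metric.ball w (2 * r)).indicator (fun _ => g w) z := by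
        refine setLIntegral_mono' hK fun z hz => ?_
        rw [← lintegral_indicator measurableSet_ball, ← lintegral_indicator hU]
        refine lintegral_mono fun w => ?_
        by_cases hw : w ∈ Metric.ball z (2 * r)
        · rw [Set.indicator_of_mem hw, Set.indicator_of_mem (hsub z hz hw),
            Set.indicator_of_mem (Metric.mem_ball_comm.mp hw)]
        · rw [Set.indicator_of_notMem hw]; exact zero_le
    _ = ∫⁻ w in U, ∫⁻ z in K, (Metric.ball w (2 * r)).indicator (fun _ => g w) z := by
        refine lintegral_lintegral_swap (Measurable.aemeasurable ?_)
        have hs : MeasurableSet {p : Cn n × Cn n | dist p.1 p.2 < 2 * r} :=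
          (isOpen_lt (continuous_fst.dist continuous_snd) continuous_const).measurableSet
        exact (hg.comp measurable_snd).indicator hs
    _ ≤ ∫⁻ w in U, g w * (ENNReal.ofReal (2 ^ (2 * n)) * volume (Metric.ball (0 : Cn n) r)) := by
        refine lintegral_mono fun w => ?_
        refine (setLIntegral_le_lintegral _ _).trans ?_
        rw [lintegral_indicator measurableSet_ball, setLIntegral_const, hvol]
    _ = _ := by
        rw [lintegral_mul_const _ hg, mul_comm]

end MeanValue

/-! ### The local `L²` estimate -/

section LocalBound

variable {n : ℕ}

/-- The pointwise estimate for higher covariant derivatives: at `z₀` they are bounded by `√k ^ m`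
times the supremum of the section over the ball of radius `δ / √k`. -/
theorem exists_higherNabla_bound {U K : Set (Cn n)} (hU : IsOpen U) (hK : IsCompact K)
    (hKU : K ⊆ U) {φ : Cn n → ℝ} (hφ : ContDiffOn ℝ ∞ φ U)
    {H Hi : Cn n → Matrix (Fin n) (Fin n) ℂ} {Γ : Cn n → Fin n → Fin n → Fin n → ℂ}
    {θ : Cn n → Cn n → ℂ}
    (hD : ∀ k : ℕ, IsChernData U H Hi Γ (fun z => Complex.exp (-((k : ℂ) * φ z)))
      (fun z u => (k : ℂ) * θ z u))
    {m : ℕ} {G : Cn n → (Fin m → Fin n) → ℂ} (hG : ∀ I, ContDiffOn ℝ ∞ (fun z => G z I) U)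
    {δ C : ℝ} (hδ : 0 < δ) (hC : 0 ≤ C)
    (hT : ∀ z₀ ∈ K, Metric.ball z₀ δ ⊆ U ∧ ∀ z ∈ Metric.ball z₀ δ,
      |φ z - φ z₀ - fderiv ℝ φ z₀ (z - z₀)| ≤ C * ‖z - z₀‖ ^ 2) :
    ∃ A : ℝ, 0 < A ∧ ∀ (k : ℕ) (f : Cn n → ℂ) (z₀ : Cn n) (M : ℝ), 1 ≤ k →
      DifferentiableOn ℂ f U → z₀ ∈ K → 0 ≤ M →
      (∀ z ∈ Metric.ball z₀ (δ / √k), ‖f z‖ ^ 2 * Real.exp (-(k * φ z)) ≤ M ^ 2) →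
      ‖higherNabla Γ (fun z u => (k : ℂ) * θ z u) m G f z₀‖ ^ 2 * Real.exp (-(k * φ z₀))
        ≤ A * k ^ m * M ^ 2 := by
  have hHs := (hD 0).smooth
  have hHi := (hD 0).smooth_inv
  choose C' hC' using exists_raisedDeriv_bound hU hK hKU hφ hHi hδ hC hT m
  have hc : ∀ L : Fin m → Fin n, ContDiffOn ℝ ∞
      (fun z => ∑ I, G z I * ∏ j, H z (I j) (L j)) U := fun L =>
    ContDiffOn.sum fun I _ => (hG I).mul (contDiffOn_prod fun j _ => hHs _ _)
  choose D hD' using fun L => hK.exists_bound_of_continuousOn ((hc L).continuousOn.mono hKU)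
  set a := ∑ L, |D L| * |C' L| with ha
  have ha0 : 0 ≤ a := Finset.sum_nonneg fun L _ => by positivity
  refine ⟨a ^ 2 + 1, by positivity, fun k f z₀ M hk hf hz₀ hM hN => ?_⟩
  set X := higherNabla Γ (fun z u => (k : ℂ) * θ z u) m G f z₀
  have h1 := (hD k).higherNabla_mul_eq (contDiffOn_real_of_holomorphic
    (contDiffOn_of_holomorphic hU hf)) m G hG z₀ (hKU hz₀)
  have hW : ‖Complex.exp (-((k : ℂ) * φ z₀))‖ = Real.exp (-(k * φ z₀)) := by
    rw [Complex.norm_exp]; simp [Complex.mul_re]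
  set b := √k ^ m * (M * Real.exp (-(k * φ z₀) / 2)) with hb
  have hb0 : 0 ≤ b := by positivity
  have h2 : ‖X‖ * Real.exp (-(k * φ z₀)) ≤ a * b := by
    rw [← hW, ← norm_mul]
    change ‖higherNabla _ _ m G f z₀ * _‖ ≤ _
    rw [h1, ha, Finset.sum_mul]
    refine (norm_sum_le _ _).trans (Finset.sum_le_sum fun L _ => ?_)
    rw [norm_mul]
    have h3 := (hD' L z₀ hz₀).trans (le_abs_self _)
    have h4 := hC' L k f z₀ M hk hf hz₀ hM hN
    rw [mul_assoc, ← hb] at h4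
    have h5 := h4.trans (mul_le_mul_of_nonneg_right (le_abs_self _) hb0)
    calc _ ≤ |D L| * (|C' L| * b) := mul_le_mul h3 h5 (norm_nonneg _) (abs_nonneg _)
      _ = _ := by ring
  have hbsq : b ^ 2 = k ^ m * M ^ 2 * Real.exp (-(k * φ z₀)) := by
    rw [hb, mul_pow, mul_pow, ← Real.exp_nat_mul, ← pow_mul, mul_comm m 2, pow_mul,
      Real.sq_sqrt (Nat.cast_nonneg _)]
    rw [show ((2 : ℕ) : ℝ) * (-(k * φ z₀) / 2) = -(k * φ z₀) by push_cast; ring]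
    ring
  have h6 : (‖X‖ * Real.exp (-(k * φ z₀))) ^ 2 ≤ (a * b) ^ 2 := by gcongr
  rw [mul_pow, mul_pow, hbsq, sq (Real.exp _)] at h6
  have h7 : ‖X‖ ^ 2 * Real.exp (-(k * φ z₀)) ≤ a ^ 2 * (k ^ m * M ^ 2) :=
    le_of_mul_le_mul_right (by linarith) (Real.exp_pos (-(k * φ z₀)))
  have : (0 : ℝ) ≤ k ^ m * M ^ 2 := by positivity
  nlinarith

/-- The `L²` estimate on a compact part of a chart. The supremum in the pointwise estimate is
bounded by the mean square of `f` over a ball of radius `2 δ / √k`; integrating over `K` and exchanging the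
integrals, the volumes of the balls cancel up to the factor `2 ^ (2 n)`. -/
theorem exists_lintegral_higherNabla_bound {U K : Set (Cn n)} (hU : IsOpen U) (hK : IsCompact K)
    (hKU : K ⊆ U) {φ : Cn n → ℝ} (hφ : ContDiffOn ℝ ∞ φ U)
    {H Hi : Cn n → Matrix (Fin n) (Fin n) ℂ} {Γ : Cn n → Fin n → Fin n → Fin n → ℂ}
    {θ : Cn n → Cn n → ℂ}
    (hD : ∀ k : ℕ, IsChernData U H Hi Γ (fun z => Complex.exp (-((k : ℂ) * φ z)))
      (fun z u => (k : ℂ) * θ z u))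
    {m : ℕ} {G : Cn n → (Fin m → Fin n) → ℂ} (hG : ∀ I, ContDiffOn ℝ ∞ (fun z => G z I) U) :
    ∃ (A : ℝ) (K' : Set (Cn n)), 0 < A ∧ IsCompact K' ∧ K' ⊆ U ∧
      ∀ (k : ℕ) (f : Cn n → ℂ), 1 ≤ k → DifferentiableOn ℂ f U →
        ∫⁻ z in K, ENNReal.ofReal (‖higherNabla Γ (fun z u => (k : ℂ) * θ z u) m G f z‖ ^ 2
            * Real.exp (-(k * φ z)))
          ≤ ENNReal.ofReal (A * k ^ m) *
            ∫⁻ z in K', ENNReal.ofReal (‖f z‖ ^ 2 * Real.exp (-(k * φ z))) := by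
  obtain ⟨δ₀, hδ₀, hδ₀U⟩ := hK.exists_cthickening_subset_open hU hKU
  have hK1 : IsCompact (Metric.cthickening (δ₀ / 2) K) := hK.cthickening
  have hK1U : Metric.cthickening (δ₀ / 2) K ⊆ U :=
    (Metric.cthickening_mono (by linarith) K).trans hδ₀U
  obtain ⟨δ₁, C, hδ₁, hC, hT⟩ := exists_taylor_bound hU hK1 hK1U hφ
  set δ := min (δ₀ / 2) δ₁ with hδdef
  have hδ : 0 < δ := lt_min (by linarith) hδ₁
  have hδ2 : δ ≤ δ₀ / 2 := min_le_left _ _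
  have hTδ : ∀ z₀ ∈ Metric.cthickening (δ₀ / 2) K, Metric.ball z₀ δ ⊆ U ∧
      ∀ z ∈ Metric.ball z₀ δ,
        |φ z - φ z₀ - fderiv ℝ φ z₀ (z - z₀)| ≤ C * ‖z - z₀‖ ^ 2 := fun z₀ hz₀ =>
    have hs : Metric.ball z₀ δ ⊆ Metric.ball z₀ δ₁ := Metric.ball_subset_ball (min_le_right _ _)
    ⟨hs.trans (hT z₀ hz₀).1, fun z hz => (hT z₀ hz₀).2 z (hs hz)⟩
  obtain ⟨A, hA, hAb⟩ := exists_higherNabla_bound hU hK hKU hφ hD hG hδ hC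
    fun z₀ hz₀ => hTδ z₀ (Metric.self_subset_cthickening K hz₀)
  refine ⟨A * Real.exp (C * δ ^ 2) * 2 ^ (2 * n), Metric.cthickening δ₀ K, by positivity,
    hK.cthickening, hδ₀U, fun k f hk hf => ?_⟩
  have hκ : 1 ≤ √(k : ℝ) := by rw [Real.one_le_sqrt]; exact_mod_cast hk
  have hr : 0 < δ / √k := by positivity
  have hrδ : δ / √k ≤ δ := div_le_self hδ.le hκ
  set N : Cn n → ℝ≥0∞ := fun z => ENNReal.ofReal (‖f z‖ ^ 2 * Real.exp (-(k * φ z))) with hN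
  set v := volume (Metric.ball (0 : Cn n) (δ / √k)) with hv
  have hv0 : v ≠ 0 := (Metric.measure_ball_pos volume _ hr).ne'
  have hvt : v ≠ ⊤ := measure_ball_lt_top.ne
  set E := ENNReal.ofReal (Real.exp (C * δ ^ 2)) with hE
  have hE0 : E ≠ 0 := by simp [hE, Real.exp_pos]
  have hb2 : ∀ z₀ ∈ K, Metric.ball z₀ (2 * (δ / √k)) ⊆ Metric.cthickening δ₀ K := fun z₀ hz₀ =>
    (Metric.ball_subset_closedBall.trans (Metric.closedBall_subset_closedBall (by linarith))).trans
      (Metric.closedBall_subset_cthickening hz₀ δ₀)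
  have hpoint : ∀ z₀ ∈ K, v * ENNReal.ofReal (‖higherNabla Γ (fun z u => (k : ℂ) * θ z u) m G f z₀‖
      ^ 2 * Real.exp (-(k * φ z₀)))
      ≤ ENNReal.ofReal (A * k ^ m) * E * ∫⁻ w in Metric.ball z₀ (2 * (δ / √k)), N w := by
    intro z₀ hz₀
    set Q := ∫⁻ w in Metric.ball z₀ (2 * (δ / √k)), N w with hQ
    have hAk : ENNReal.ofReal (A * k ^ m) ≠ 0 := by
      have : (0 : ℝ) < k := by exact_mod_cast hk
      simp only [ne_eq, ENNReal.ofReal_eq_zero, not_le]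
      positivity
    by_cases hQt : Q = ⊤
    · rw [hQt, ENNReal.mul_top (mul_ne_zero hAk hE0)]
      exact le_top
    have hQE : E * Q / v ≠ ⊤ :=
      ENNReal.div_ne_top (ENNReal.mul_ne_top ENNReal.ofReal_ne_top hQt) hv0
    have hsup : ∀ z ∈ Metric.ball z₀ (δ / √k), N z ≤ E * Q / v := by
      intro z hz
      have hzK : z ∈ Metric.cthickening (δ₀ / 2) K :=
        Metric.closedBall_subset_cthickening hz₀ (δ₀ / 2)
          (Metric.closedBall_subset_closedBall (hrδ.trans hδ2) (Metric.ball_subset_closedBall hz))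
      have hs : Metric.ball z (δ / √k) ⊆ Metric.ball z δ := Metric.ball_subset_ball hrδ
      have h1 := weighted_norm_sq_mul_volume_le (differentiableAt_of_contDiffOn hU hφ (hK1U hzK))
        hC hk (hf.mono (hs.trans (hTδ z hzK).1)) (fun w hw => (hTδ z hzK).2 w (hs hw))
      rw [ENNReal.le_div_iff_mul_le (Or.inl hv0) (Or.inl hvt)]
      refine h1.trans ?_
      gcongr
      refine lintegral_mono_set fun w hw => ?_
      rw [Metric.mem_ball] at hw hz ⊢
      linarith [dist_triangle w z z₀]
    have h2 := hAb k f z₀ (√(E * Q / v).toReal) hk hf hz₀ (Real.sqrt_nonneg _) fun z hz => by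
      rw [Real.sq_sqrt ENNReal.toReal_nonneg]
      exact (ENNReal.ofReal_le_iff_le_toReal hQE).mp (hsup z hz)
    rw [Real.sq_sqrt ENNReal.toReal_nonneg] at h2
    calc _ ≤ v * ENNReal.ofReal (A * k ^ m * (E * Q / v).toReal) := by gcongr
      _ = v * (ENNReal.ofReal (A * k ^ m) * (E * Q / v)) := by
          rw [ENNReal.ofReal_mul (by positivity), ENNReal.ofReal_toReal hQE]
      _ = ENNReal.ofReal (A * k ^ m) * (v * (E * Q / v)) := by ring
      _ = _ := by rw [ENNReal.mul_div_cancel hv0 hvt, mul_assoc]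
  have hNc : ContinuousOn N U := ENNReal.continuous_ofReal.comp_continuousOn
    ((hf.continuousOn.norm.pow 2).mul
      (continuousOn_const.mul hφ.continuousOn).neg.rexp)
  have hgm := measurable_indicator_of_continuousOn hU.measurableSet hNc
  have hgN : ∀ z₀ ∈ K, ∫⁻ w in Metric.ball z₀ (2 * (δ / √k)), N w
      = ∫⁻ w in Metric.ball z₀ (2 * (δ / √k)), U.indicator N w := fun z₀ hz₀ =>
    setLIntegral_congr_fun measurableSet_ball fun w hw => by
      rw [Set.indicator_of_mem (hδ₀U (hb2 z₀ hz₀ hw))]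
  have hfinal : v * ∫⁻ z in K, ENNReal.ofReal (‖higherNabla Γ (fun z u => (k : ℂ) * θ z u) m G f z‖
      ^ 2 * Real.exp (-(k * φ z)))
      ≤ v * (ENNReal.ofReal (A * Real.exp (C * δ ^ 2) * 2 ^ (2 * n) * k ^ m) *
        ∫⁻ z in Metric.cthickening δ₀ K, N z) := by
    rw [← lintegral_const_mul' _ _ hvt]
    calc _ ≤ ∫⁻ z in K, ENNReal.ofReal (A * k ^ m) * E
            * ∫⁻ w in Metric.ball z (2 * (δ / √k)), U.indicator N w :=
          setLIntegral_mono' hK.measurableSet fun z hz => by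
            rw [← hgN z hz]; exact hpoint z hz
      _ = ENNReal.ofReal (A * k ^ m) * E *
            ∫⁻ z in K, ∫⁻ w in Metric.ball z (2 * (δ / √k)), U.indicator N w :=
          lintegral_const_mul' _ _ (ENNReal.mul_ne_top ENNReal.ofReal_ne_top ENNReal.ofReal_ne_top)
      _ ≤ ENNReal.ofReal (A * k ^ m) * E * (ENNReal.ofReal (2 ^ (2 * n)) * v *
            ∫⁻ w in Metric.cthickening δ₀ K, U.indicator N w) := by
          gcongr
          exact lintegral_lintegral_ball_le hK.cthickening.measurableSet hK.measurableSet hr hb2 hgm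
      _ ≤ ENNReal.ofReal (A * k ^ m) * E * (ENNReal.ofReal (2 ^ (2 * n)) * v *
            ∫⁻ w in Metric.cthickening δ₀ K, N w) := by
          gcongr with w
          exact Set.indicator_le_self _ _ _
      _ = _ := by
          have hconst : ENNReal.ofReal (A * Real.exp (C * δ ^ 2) * 2 ^ (2 * n) * (k : ℝ) ^ m)
              = ENNReal.ofReal (A * k ^ m) * E * ENNReal.ofReal (2 ^ (2 * n)) := by
            rw [hE, ← ENNReal.ofReal_mul (by positivity), ← ENNReal.ofReal_mul (by positivity)]
            congr 1
            ring
          rw [hconst]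
          ring
  exact (ENNReal.mul_le_mul_iff_right hv0 hvt).mp hfinal

end LocalBound

/-! ### Transition maps -/

theorem contDiffOn_matrix_det {E : Type*} [NormedAddCommGroup E] [NormedSpace ℝ E] {U : Set E}
    {n : ℕ} {A : E → Matrix (Fin n) (Fin n) ℂ} (hA : ∀ j l, ContDiffOn ℝ ∞ (fun z => A z j l) U) :
    ContDiffOn ℝ ∞ (fun z => (A z).det) U := by
  simp only [Matrix.det_apply]
  exact ContDiffOn.sum fun σ _ => (contDiffOn_prod fun i _ => hA _ _).const_smul _

theorem contDiffOn_matrix_inv {E : Type*} [NormedAddCommGroup E] [NormedSpace ℝ E] {U : Set E}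
    {n : ℕ} {A : E → Matrix (Fin n) (Fin n) ℂ} (hA : ∀ j l, ContDiffOn ℝ ∞ (fun z => A z j l) U)
    (h0 : ∀ z ∈ U, (A z).det ≠ 0) (j l : Fin n) : ContDiffOn ℝ ∞ (fun z => (A z)⁻¹ j l) U := by
  simp only [Matrix.inv_def, Matrix.smul_apply, Ring.inverse_eq_inv', smul_eq_mul,
    Matrix.adjugate_apply]
  refine ((contDiffOn_matrix_det hA).inv h0).mul (contDiffOn_matrix_det fun a b => ?_)
  by_cases h : a = l
  · subst h; simpa using contDiffOn_const
  · simpa [Matrix.updateRow_ne h] using hA a b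

section Transition

variable {n : ℕ} {X : Type*} [TopologicalSpace X] [ChartedSpace (Cn n) X]

theorem KahlerForm.form_congr (Ω : KahlerForm n X) {p q : X} (h : p = q) (u v u' v' : Cn n)
    (hu : u = u') (hv : v = v') : Ω.form p u v = Ω.form q u' v' := by
  subst h hu hv; rfl

/-- The transition map from the chart around `a` to the chart around `y`. -/
noncomputable def transition (a y : X) (z : Cn n) : Cn n :=
  chartAt (Cn n) y ((chartAt (Cn n) a).symm z)

/-- The domain of `transition a y`. -/
def overlap (a y : X) : Set (Cn n) :=
  (chartAt (Cn n) a).target ∩ (chartAt (Cn n) a).symm ⁻¹' (chartAt (Cn n) y).source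

theorem isOpen_overlap (a y : X) : IsOpen (overlap a y : Set (Cn n)) :=
  (chartAt (Cn n) a).symm.isOpen_inter_preimage (chartAt (Cn n) y).open_source

theorem symm_transition {a y : X} {z : Cn n} (hz : z ∈ overlap a y) :
    (chartAt (Cn n) y).symm (transition a y z) = (chartAt (Cn n) a).symm z :=
  (chartAt (Cn n) y).left_inv hz.2

theorem transition_mem_target {a y : X} {z : Cn n} (hz : z ∈ overlap a y) :
    transition a y z ∈ (chartAt (Cn n) y).target :=
  (chartAt (Cn n) y).map_source hz.2

theorem transition_transition {a y : X} {z : Cn n} (hz : z ∈ overlap a y) :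
    transition y a (transition a y z) = z := by
  rw [transition, symm_transition hz, (chartAt (Cn n) a).right_inv hz.1]

variable [IsManifold 𝓘(ℂ, Cn n) ω X]

theorem contDiffOn_transition (a y : X) : ContDiffOn ℂ ∞ (transition a y)
    (overlap a y : Set (Cn n)) := by
  rw [← contMDiffOn_iff_contDiffOn]
  have h1 : ContMDiffOn 𝓘(ℂ, Cn n) 𝓘(ℂ, Cn n) ω (chartAt (Cn n) y) (chartAt (Cn n) y).source :=
    contMDiffOn_chart
  have h2 : ContMDiffOn 𝓘(ℂ, Cn n) 𝓘(ℂ, Cn n) ω (chartAt (Cn n) a).symm (chartAt (Cn n) a).target :=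
    contMDiffOn_chart_symm
  exact (h1.comp' h2).of_le le_top

theorem differentiableAt_transition {a y : X} {z : Cn n} (hz : z ∈ overlap a y) :
    DifferentiableAt ℂ (transition a y) z :=
  ((contDiffOn_transition a y).differentiableOn (by simp) z hz).differentiableAt
    ((isOpen_overlap a y).mem_nhds hz)

theorem chartVec_transition {a y : X} {z : Cn n} (hz : z ∈ overlap a y) (u : Cn n) :
    (chartVec a z u : Cn n) = chartVec y (transition a y z) (fderiv ℂ (transition a y) z u) := by
  have h1 : MDifferentiableAt 𝓘(ℂ, Cn n) 𝓘(ℂ, Cn n) (chartAt (Cn n) y).symm (transition a y z) :=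
    mdifferentiableAt_atlas_symm (chart_mem_atlas _ y) (transition_mem_target hz)
  have h2 := differentiableAt_transition hz
  have h3 : HasMFDerivAt 𝓘(ℂ, Cn n) 𝓘(ℂ, Cn n) (transition a y) z (fderiv ℂ (transition a y) z) :=
    h2.hasFDerivAt.hasMFDerivAt
  have h4 := HasMFDerivAt.comp z h1.hasMFDerivAt h3
  have h5 : (chartAt (Cn n) a).symm =ᶠ[nhds z] (chartAt (Cn n) y).symm ∘ transition a y :=
    Filter.eventually_of_mem ((isOpen_overlap a y).mem_nhds hz) fun w hw =>
      (symm_transition hw).symm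
  have h6 := (h4.congr_of_eventuallyEq h5).mfderiv
  rw [chartVec, h6]
  rfl

namespace KahlerForm

variable (Ω : KahlerForm n X)

theorem inChart_transition {a y : X} {z : Cn n} (hz : z ∈ overlap a y) (u v : Cn n) :
    Ω.inChart a z u v = Ω.inChart y (transition a y z) (fderiv ℂ (transition a y) z u)
      (fderiv ℂ (transition a y) z v) :=
  Ω.form_congr (symm_transition hz).symm _ _ _ _ (chartVec_transition hz u)
    (chartVec_transition hz v)

end KahlerForm

end Transition

/-! ### The Kähler metric in coordinates -/

section Metric

open scoped ComplexOrder

variable {n : ℕ} {X : Type*} [TopologicalSpace X] [ChartedSpace (Cn n) X]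

namespace KahlerForm

variable (Ω : KahlerForm n X)

/-- The Hermitian metric `g - √-1 ω` in the chart around `a`, complex linear in the first
variable. -/
noncomputable def herm (a : X) (z u v : Cn n) : ℂ :=
  (Ω.inChart a z u (Complex.I • v) : ℂ) - Complex.I * (Ω.inChart a z u v : ℂ)

/-- The form `ω` in a chart, as a bilinear map. -/
noncomputable def inChartLin (a : X) (z : Cn n) : Cn n →ₗ[ℝ] Cn n →ₗ[ℝ] ℝ :=
  let T : Cn n →ₗ[ℝ] TangentSpace 𝓘(ℂ, Cn n) ((chartAt (Cn n) a).symm z) :=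
    (mfderiv 𝓘(ℂ, Cn n) 𝓘(ℂ, Cn n) (chartAt (Cn n) a).symm z).toLinearMap.restrictScalars ℝ
  (Ω.form ((chartAt (Cn n) a).symm z)).compl₁₂ T T

theorem inChartLin_apply (a : X) (z u v : Cn n) : Ω.inChartLin a z u v = Ω.inChart a z u v := rfl

theorem inChart_I_smul (a : X) (z u v : Cn n) :
    Ω.inChart a z (Complex.I • u) (Complex.I • v) = Ω.inChart a z u v := by
  have h : ∀ w : Cn n, chartVec a z (Complex.I • w) = Complex.I • chartVec a z w := fun w =>
    map_smul (mfderiv 𝓘(ℂ, Cn n) 𝓘(ℂ, Cn n) (chartAt (Cn n) a).symm z) Complex.I w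
  rw [inChart, h, h, Ω.invariant]
  rfl

theorem inChart_swap (a : X) (z u v : Cn n) : Ω.inChart a z u v = - Ω.inChart a z v u := by
  have h : ∀ w, Ω.inChartLin a z w w = 0 := fun w => Ω.alternating _ _
  have h1 := h (u + v)
  simp only [map_add, LinearMap.add_apply, h] at h1
  simp only [inChartLin_apply] at h1
  linarith

theorem inChart_I_smul_left (a : X) (z u v : Cn n) :
    Ω.inChart a z (Complex.I • u) v = - Ω.inChart a z u (Complex.I • v) := by
  rw [← Ω.inChart_I_smul a z u, smul_smul, Complex.I_mul_I, neg_one_smul, ← inChartLin_apply,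
    ← inChartLin_apply, map_neg, neg_neg]

theorem herm_add_left (a : X) (z u u' v : Cn n) :
    Ω.herm a z (u + u') v = Ω.herm a z u v + Ω.herm a z u' v := by
  simp only [herm, ← inChartLin_apply, map_add, LinearMap.add_apply]
  push_cast; ring

/-- Complex linearity, from the invariance of `ω` under multiplication by `√-1`. -/
theorem herm_smul_left (a : X) (z : Cn n) (c : ℂ) (u v : Cn n) :
    Ω.herm a z (c • u) v = c * Ω.herm a z u v := by
  have h : ∀ w, Ω.inChart a z (c • u) w
      = c.re * Ω.inChart a z u w - c.im * Ω.inChart a z u (Complex.I • w) := by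
    intro w
    have hc : c • u = c.re • u + c.im • (Complex.I • u) := by
      conv_lhs => rw [← Complex.re_add_im c]
      rw [add_smul, mul_smul]
      rfl
    rw [hc, ← inChartLin_apply, map_add, map_smul, map_smul, LinearMap.add_apply,
      LinearMap.smul_apply, LinearMap.smul_apply, inChartLin_apply, inChartLin_apply,
      inChart_I_smul_left, smul_eq_mul, smul_eq_mul]
    ring
  have hI : Ω.inChart a z u (Complex.I • Complex.I • v) = - Ω.inChart a z u v := by
    rw [smul_smul, Complex.I_mul_I, neg_one_smul, ← inChartLin_apply, map_neg, inChartLin_apply]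
  simp only [herm, h, hI]
  conv_rhs => rw [← Complex.re_add_im c]
  push_cast
  linear_combination (c.im * (Ω.inChart a z u v : ℂ)) * Complex.I_mul_I

theorem star_herm (a : X) (z u v : Cn n) : starRingEnd ℂ (Ω.herm a z u v) = Ω.herm a z v u := by
  have h : Ω.inChart a z v (Complex.I • u) = Ω.inChart a z u (Complex.I • v) := by
    rw [inChart_swap, inChart_I_smul_left, neg_neg]
  simp only [herm, map_sub, map_mul, Complex.conj_I, Complex.conj_ofReal, h,
    inChart_swap Ω a z v u]
  push_cast; ring

theorem herm_eq_sum (a : X) (z u v : Cn n) : Ω.herm a z u v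
    = ∑ p, ∑ q, u p * Ω.herm a z (stdVec p) (stdVec q) * starRingEnd ℂ (v q) := by
  have h1 : ∀ u v, Ω.herm a z u v = ∑ p, u p * Ω.herm a z (stdVec p) v := by
    intro u v
    let T : Cn n →ₗ[ℂ] ℂ :=
      { toFun := fun u => Ω.herm a z u v
        map_add' := fun u u' => Ω.herm_add_left a z u u' v
        map_smul' := fun c u => Ω.herm_smul_left a z c u v }
    have : T u = T (∑ p, u p • stdVec p) := by rw [← stdVec_sum]
    rw [map_sum] at this
    simpa [T, herm_smul_left] using this
  rw [h1]
  refine Finset.sum_congr rfl fun p _ => ?_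
  rw [← star_herm, h1, map_sum, Finset.mul_sum]
  refine Finset.sum_congr rfl fun q _ => ?_
  rw [map_mul, star_herm]
  ring

theorem components_eq (a : X) (z : Cn n) (j l : Fin n) :
    Ω.components a z j l = Complex.I / 2 * Ω.herm a z (stdVec j) (stdVec l) := by
  simp only [components, herm]
  linear_combination
    (1 / 2 * (Ω.inChart a z (stdVec j) (stdVec l) : ℂ)) * Complex.I_mul_I

/-- The Hermitian matrix of the metric in the chart around `a`. -/
noncomputable def hermMatrix (a : X) (z : Cn n) : Matrix (Fin n) (Fin n) ℂ :=
  Matrix.of fun j l => Ω.herm a z (stdVec j) (stdVec l)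

theorem smul_components (a : X) (z : Cn n) :
    (-2 * Complex.I) • Ω.components a z = Ω.hermMatrix a z := by
  ext j l
  rw [Matrix.smul_apply, components_eq, smul_eq_mul, hermMatrix, Matrix.of_apply]
  linear_combination (-Ω.herm a z (stdVec j) (stdVec l)) * Complex.I_mul_I

theorem components_eq_smul (a : X) (z : Cn n) :
    Ω.components a z = (Complex.I / 2) • Ω.hermMatrix a z := by
  ext j l
  rw [components_eq]; rfl

theorem contDiffOn_components (a : X) (j l : Fin n) :
    ContDiffOn ℝ ∞ (fun z => Ω.components a z j l) (chartAt (Cn n) a).target := by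
  have h : ∀ u v, ContDiffOn ℝ ∞ (fun z => (Ω.inChart a z u v : ℂ)) (chartAt (Cn n) a).target :=
    fun u v => Complex.ofRealCLM.contDiff.comp_contDiffOn (Ω.smooth a u v)
  exact contDiffOn_const.mul ((h _ _).add (contDiffOn_const.mul (h _ _)))

variable [IsManifold 𝓘(ℂ, Cn n) ω X]

/-- The matrix is positive definite because the derivative of the inverse chart is injective. -/
theorem posDef_hermMatrix {a : X} {z : Cn n} (hz : z ∈ (chartAt (Cn n) a).target) :
    (Ω.hermMatrix a z).PosDef := by
  refine Matrix.PosDef.of_dotProduct_mulVec_pos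
    (Matrix.IsHermitian.ext fun j l => Ω.star_herm a z _ _) fun w hw => ?_
  set u : Cn n := WithLp.toLp 2 (star w) with hu
  have hu0 : u ≠ 0 := fun h => hw (by
    ext j
    have := congrArg (fun v : Cn n => v j) h
    simpa [hu] using this)
  have h1 : star w ⬝ᵥ (Ω.hermMatrix a z).mulVec w = Ω.herm a z u u := by
    rw [herm_eq_sum]
    simp only [dotProduct, Matrix.mulVec, Finset.mul_sum, hermMatrix, Matrix.of_apply, hu,
      Pi.star_apply]
    refine Finset.sum_congr rfl fun p _ => Finset.sum_congr rfl fun q _ => ?_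
    simp [mul_assoc]
  have hinj : chartVec a z u ≠ 0 := by
    intro h0
    have h2 : MDifferentiableAt 𝓘(ℂ, Cn n) 𝓘(ℂ, Cn n) (chartAt (Cn n) a).symm z :=
      mdifferentiableAt_atlas_symm (chart_mem_atlas _ a) hz
    have h3 : MDifferentiableAt 𝓘(ℂ, Cn n) 𝓘(ℂ, Cn n) (chartAt (Cn n) a)
        ((chartAt (Cn n) a).symm z) :=
      mdifferentiableAt_atlas (chart_mem_atlas _ a) ((chartAt (Cn n) a).map_target hz)
    have h4 := HasMFDerivAt.comp z h3.hasMFDerivAt h2.hasMFDerivAt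
    have h5 : id =ᶠ[nhds z] (chartAt (Cn n) a) ∘ (chartAt (Cn n) a).symm :=
      Filter.eventually_of_mem ((chartAt (Cn n) a).open_target.mem_nhds hz) fun w hw =>
        ((chartAt (Cn n) a).right_inv hw).symm
    have h6 := hasMFDerivAt_unique (h4.congr_of_eventuallyEq h5) (hasMFDerivAt_id z)
    have h7 := congrArg (fun T : Cn n →L[ℂ] Cn n => T u) h6
    refine hu0 (h7.symm.trans ?_)
    change mfderiv 𝓘(ℂ, Cn n) 𝓘(ℂ, Cn n) (chartAt (Cn n) a) _ (chartVec a z u) = _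
    rw [h0, map_zero]
    rfl
  have h8 : Ω.herm a z u u = ((Ω.inChart a z u (Complex.I • u) : ℝ) : ℂ) := by
    have : Ω.inChart a z u u = 0 := Ω.alternating _ _
    simp [herm, this]
  have h9 : 0 < Ω.inChart a z u (Complex.I • u) := by
    have h := Ω.positive _ _ hinj
    have h10 : chartVec a z (Complex.I • u) = Complex.I • chartVec a z u :=
      map_smul (mfderiv 𝓘(ℂ, Cn n) 𝓘(ℂ, Cn n) (chartAt (Cn n) a).symm z) Complex.I u
    rw [inChart, h10]
    exact h
  rw [h1, h8]
  exact_mod_cast h9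

theorem density_pos {a : X} {z : Cn n} (hz : z ∈ (chartAt (Cn n) a).target) :
    0 < Ω.density a z := by
  rw [density, smul_components]
  exact (Complex.pos_iff.mp (Ω.posDef_hermMatrix hz).det_pos).1

theorem isUnit_det_components {a : X} {z : Cn n} (hz : z ∈ (chartAt (Cn n) a).target) :
    IsUnit (Ω.components a z).det := by
  rw [components_eq_smul, Matrix.det_smul]
  exact (isUnit_iff_ne_zero.mpr (pow_ne_zero _ (by simp))).mul
    (isUnit_iff_ne_zero.mpr (Ω.posDef_hermMatrix hz).det_pos.ne')

theorem hermMatrix_transition {a y : X} {z : Cn n} (hz : z ∈ overlap a y) :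
    Ω.hermMatrix a z = jacobian (transition a y) z * Ω.hermMatrix y (transition a y z)
      * (jacobian (transition a y) z).conjTranspose := by
  ext j l
  have h1 : Ω.herm a z (stdVec j) (stdVec l) = Ω.herm y (transition a y z)
      (fderiv ℂ (transition a y) z (stdVec j)) (fderiv ℂ (transition a y) z (stdVec l)) := by
    simp only [herm, Ω.inChart_transition hz, map_smul]
  rw [hermMatrix, Matrix.of_apply, h1, herm_eq_sum, Matrix.mul_apply]
  simp only [Matrix.mul_apply, Finset.sum_mul, Matrix.conjTranspose_apply]
  rw [Finset.sum_comm]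
  rfl

theorem components_transition {a y : X} {z : Cn n} (hz : z ∈ overlap a y) :
    Ω.components a z = jacobian (transition a y) z * Ω.components y (transition a y z)
      * (jacobian (transition a y) z).conjTranspose := by
  rw [components_eq_smul, components_eq_smul, Ω.hermMatrix_transition hz, Matrix.mul_smul,
    Matrix.smul_mul]

end KahlerForm

/-- The real Jacobian determinant of a holomorphic map is the squared modulus of the complex one. -/
theorem abs_det_fderiv_eq {τ : Cn n → Cn n} {z : Cn n} (hτ : DifferentiableAt ℂ τ z) :
    |(fderiv ℝ τ z).det| = Complex.normSq (jacobian τ z).det := by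
  have h1 : (fderiv ℝ τ z).det = Algebra.norm ℝ (LinearMap.det (fderiv ℂ τ z).toLinearMap) := by
    rw [← LinearMap.det_restrictScalars, hτ.fderiv_restrictScalars ℝ]
    rfl
  have h2 : LinearMap.det (fderiv ℂ τ z).toLinearMap = (jacobian τ z).det := by
    rw [← LinearMap.det_toMatrix (EuclideanSpace.basisFun (Fin n) ℂ).toBasis,
      ← Matrix.det_transpose]
    congr 1
  rw [h1, h2, Algebra.norm_complex_apply, abs_of_nonneg (Complex.normSq_nonneg _)]

/-- The densities of `ωⁿ / n!` transform as in the change of variables formula. -/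
theorem KahlerForm.density_transition [IsManifold 𝓘(ℂ, Cn n) ω X] (Ω : KahlerForm n X) {a y : X}
    {z : Cn n} (hz : z ∈ overlap a y) :
    Ω.density a z = |(fderiv ℝ (transition a y) z).det| * Ω.density y (transition a y z) := by
  rw [abs_det_fderiv_eq (differentiableAt_transition hz), density, density, smul_components,
    smul_components, Ω.hermMatrix_transition hz, Matrix.det_mul, Matrix.det_mul,
    Matrix.det_conjTranspose]
  set d := (jacobian (transition a y) z).det
  rw [mul_right_comm]
  change (d * starRingEnd ℂ d * _).re = _
  rw [Complex.mul_conj, Complex.re_ofReal_mul]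

end Metric

/-! ### The volume measure in a chart -/

section Volume

variable {n : ℕ} {X : Type*} [TopologicalSpace X] [ChartedSpace (Cn n) X]

namespace KahlerForm

variable (Ω : KahlerForm n X)

theorem continuousOn_density (a : X) :
    ContinuousOn (Ω.density a) (chartAt (Cn n) a).target := by
  have h : ContDiffOn ℝ ∞ (fun z => ((-2 * Complex.I) • Ω.components a z).det)
      (chartAt (Cn n) a).target :=
    contDiffOn_matrix_det fun j l => contDiffOn_const.mul (Ω.contDiffOn_components a j l)
  exact Complex.continuous_re.comp_continuousOn h.continuousOn

/-- The measure `ωⁿ / n!` in the coordinates of the chart around `a`. -/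
noncomputable def coordMeasure (a : X) : Measure (Cn n) :=
  (volume.restrict (chartAt (Cn n) a).target).withDensity
    (fun z => ENNReal.ofReal (Ω.density a z))

theorem aemeasurable_density (a : X) : AEMeasurable (fun z => ENNReal.ofReal (Ω.density a z))
    (volume.restrict (chartAt (Cn n) a).target) :=
  (ENNReal.continuous_ofReal.comp_continuousOn (Ω.continuousOn_density a)).aemeasurable
    (chartAt (Cn n) a).open_target.measurableSet

theorem lintegral_coordMeasure (a : X) (g : Cn n → ℝ≥0∞) :
    ∫⁻ z, g z ∂Ω.coordMeasure a
      = ∫⁻ z in (chartAt (Cn n) a).target, ENNReal.ofReal (Ω.density a z) * g z :=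
  lintegral_withDensity_eq_lintegral_mul_non_measurable₀ _ (Ω.aemeasurable_density a)
    (Filter.Eventually.of_forall fun _ => ENNReal.ofReal_lt_top) g

variable [MeasurableSpace X]

/-- The restriction of the measure `ωⁿ / n!` to the domain of the chart around `a`. -/
noncomputable def chartMeasure (a : X) : Measure X :=
  (Ω.coordMeasure a).map (chartAt (Cn n) a).symm

theorem chartMeasure_le_volumeMeasure (a : X) : Ω.chartMeasure a ≤ Ω.volumeMeasure :=
  le_iSup Ω.chartMeasure a

variable [BorelSpace X]

theorem aemeasurable_chart_symm (a : X) :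
    AEMeasurable (chartAt (Cn n) a).symm (Ω.coordMeasure a) :=
  ((chartAt (Cn n) a).continuousOn_symm.aemeasurable
    (chartAt (Cn n) a).open_target.measurableSet).mono_ac (withDensity_absolutelyContinuous _ _)

theorem chartMeasure_apply (a : X) {B : Set X} (hB : MeasurableSet B) :
    Ω.chartMeasure a B
      = ∫⁻ z in (chartAt (Cn n) a).symm ⁻¹' B ∩ (chartAt (Cn n) a).target,
          ENNReal.ofReal (Ω.density a z) := by
  rw [chartMeasure, Measure.map_apply_of_aemeasurable (Ω.aemeasurable_chart_symm a) hB,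
    coordMeasure, withDensity_apply', Measure.restrict_restrict'
      (chartAt (Cn n) a).open_target.measurableSet]

theorem setLIntegral_le_volumeMeasure (a : X) {U : Set (Cn n)} (hU : IsOpen U)
    (hUt : U ⊆ (chartAt (Cn n) a).target) {F : X → ℝ≥0∞}
    (hF : ContinuousOn (fun z => F ((chartAt (Cn n) a).symm z)) U) :
    ∫⁻ z in U, ENNReal.ofReal (Ω.density a z) * F ((chartAt (Cn n) a).symm z)
      ≤ ∫⁻ x, F x ∂Ω.volumeMeasure := by
  set S := (chartAt (Cn n) a).symm '' U with hS
  have hSo : IsOpen S := (chartAt (Cn n) a).symm.isOpen_image_of_subset_source hU hUt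
  have hSs : ∀ x ∈ S, x ∈ (chartAt (Cn n) a).source ∧ chartAt (Cn n) a x ∈ U := by
    rintro _ ⟨z, hz, rfl⟩
    exact ⟨(chartAt (Cn n) a).map_target (hUt hz), by
      rwa [(chartAt (Cn n) a).right_inv (hUt hz)]⟩
  have hFS : ContinuousOn F S := by
    have h := hF.comp ((chartAt (Cn n) a).continuousOn.mono fun x hx => (hSs x hx).1)
      fun x hx => (hSs x hx).2
    exact h.congr fun x hx => by
      simp only [Function.comp, (chartAt (Cn n) a).left_inv (hSs x hx).1]
  have hm := measurable_indicator_of_continuousOn hSo.measurableSet hFS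
  calc _ ≤ ∫⁻ z in (chartAt (Cn n) a).target, ENNReal.ofReal (Ω.density a z)
          * S.indicator F ((chartAt (Cn n) a).symm z) := by
        refine (setLIntegral_mono' hU.measurableSet fun z hz => ?_).trans (lintegral_mono_set hUt)
        rw [Set.indicator_of_mem (show (chartAt (Cn n) a).symm z ∈ S from ⟨z, hz, rfl⟩)]
    _ = ∫⁻ z, S.indicator F ((chartAt (Cn n) a).symm z) ∂Ω.coordMeasure a :=
        (Ω.lintegral_coordMeasure a _).symm
    _ = ∫⁻ x, S.indicator F x ∂Ω.chartMeasure a :=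
        (lintegral_map' hm.aemeasurable (Ω.aemeasurable_chart_symm a)).symm
    _ ≤ _ := lintegral_mono' (Ω.chartMeasure_le_volumeMeasure a) (Set.indicator_le_self _ _)

theorem measurableSet_preimage (a : X) {B : Set X} (hB : MeasurableSet B) :
    MeasurableSet ((chartAt (Cn n) a).symm ⁻¹' B ∩ (chartAt (Cn n) a).target) := by
  classical
  rw [Set.inter_comm]
  have h := ((chartAt (Cn n) a).continuousOn_symm).measurable_piecewise
    (continuousOn_const (c := a)) (chartAt (Cn n) a).open_target.measurableSet
    (s := (chartAt (Cn n) a).target) (f := (chartAt (Cn n) a).symm) |> fun h => h hB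
  convert! (chartAt (Cn n) a).open_target.measurableSet.inter h using 1
  ext z
  simp only [Set.mem_inter_iff, Set.mem_preimage]
  refine and_congr_right fun hz => ?_
  rw [Set.piecewise_eq_of_mem _ _ _ hz]

variable [IsManifold 𝓘(ℂ, Cn n) ω X]

/-- The local measures agree on the intersections of charts, by the change of variables formula. -/
theorem chartMeasure_apply_eq (a y : X) {B : Set X} (hB : MeasurableSet B)
    (hBa : B ⊆ (chartAt (Cn n) a).source) :
    Ω.chartMeasure y B = Ω.chartMeasure a (B ∩ (chartAt (Cn n) y).source) := by
  have hB' : MeasurableSet (B ∩ (chartAt (Cn n) y).source) :=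
    hB.inter (chartAt (Cn n) y).open_source.measurableSet
  rw [chartMeasure_apply Ω y hB, chartMeasure_apply Ω a hB']
  set S := (chartAt (Cn n) a).symm ⁻¹' (B ∩ (chartAt (Cn n) y).source) ∩ (chartAt (Cn n) a).target
    with hS
  have hSo : S ⊆ overlap a y := fun z hz => ⟨hz.2, hz.1.2⟩
  have himg : (chartAt (Cn n) y).symm ⁻¹' B ∩ (chartAt (Cn n) y).target = transition a y '' S := by
    ext w
    constructor
    · rintro ⟨hw1, hw2⟩
      have hw : w ∈ overlap y a := ⟨hw2, hBa hw1⟩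
      refine ⟨transition y a w, ⟨⟨?_, ?_⟩, transition_mem_target hw⟩, transition_transition hw⟩
      · rw [symm_transition hw]; exact hw1
      · rw [symm_transition hw]; exact (chartAt (Cn n) y).map_target hw2
    · rintro ⟨z, hz, rfl⟩
      refine ⟨?_, transition_mem_target (hSo hz)⟩
      rw [Set.mem_preimage, symm_transition (hSo hz)]
      exact hz.1.1
  have hinj : Set.InjOn (transition a y) S := fun z hz w hw h => by
    rw [← transition_transition (hSo hz), h, transition_transition (hSo hw)]
  rw [himg, lintegral_image_eq_lintegral_abs_det_fderiv_mul volume (measurableSet_preimage a hB')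
    (fun z hz => ((differentiableAt_transition (hSo hz)).restrictScalars
      ℝ).hasFDerivAt.hasFDerivWithinAt) hinj]
  refine setLIntegral_congr_fun (measurableSet_preimage a hB') fun z hz => ?_
  rw [Ω.density_transition (hSo hz), ENNReal.ofReal_mul (abs_nonneg _)]

/-- The volume measure is defined as the supremum of the chart measures. On the domain of one chart
the supremum is attained by the measure of that chart, because every other chart measure agrees with
it on the intersection of the two domains. -/
theorem volumeMeasure_restrict_le (a : X) :
    Ω.volumeMeasure.restrict (chartAt (Cn n) a).source ≤ Ω.chartMeasure a := by
  have hs : MeasurableSet (chartAt (Cn n) a).source := (chartAt (Cn n) a).open_source.measurableSet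
  have h1 : ∀ y, Ω.chartMeasure y
      ≤ Ω.chartMeasure a + Ω.volumeMeasure.restrict (chartAt (Cn n) a).sourceᶜ := by
    intro y
    conv_lhs => rw [← Measure.restrict_add_restrict_compl (μ := Ω.chartMeasure y) hs]
    refine add_le_add ?_ (Measure.restrict_mono le_rfl (Ω.chartMeasure_le_volumeMeasure y))
    refine Measure.le_iff.mpr fun B hB => ?_
    rw [Measure.restrict_apply hB,
      Ω.chartMeasure_apply_eq a y (hB.inter hs) Set.inter_subset_right]
    exact measure_mono fun z hz => hz.1.1
  have h2 : Ω.volumeMeasure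
      ≤ Ω.chartMeasure a + Ω.volumeMeasure.restrict (chartAt (Cn n) a).sourceᶜ := iSup_le h1
  refine Measure.le_iff.mpr fun B hB => ?_
  rw [Measure.restrict_apply hB]
  calc Ω.volumeMeasure (B ∩ (chartAt (Cn n) a).source)
      ≤ (Ω.chartMeasure a + Ω.volumeMeasure.restrict (chartAt (Cn n) a).sourceᶜ)
          (B ∩ (chartAt (Cn n) a).source) := h2 _
    _ = Ω.chartMeasure a (B ∩ (chartAt (Cn n) a).source) := by
        rw [Measure.add_apply, Measure.restrict_apply (hB.inter hs)]
        have : B ∩ (chartAt (Cn n) a).source ∩ (chartAt (Cn n) a).sourceᶜ = ∅ := by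
          ext z; simp
        rw [this, measure_empty, add_zero]
    _ ≤ _ := measure_mono Set.inter_subset_left

/-- An upper bound for integrals over a part of a chart; no measurability of the integrand is
needed. -/
theorem setLIntegral_volumeMeasure_le (a : X) {K : Set (Cn n)}
    (hK : MeasurableSet K) (hKt : K ⊆ (chartAt (Cn n) a).target)
    (hKm : MeasurableSet ((chartAt (Cn n) a).symm '' K)) (F : X → ℝ≥0∞) :
    ∫⁻ x in (chartAt (Cn n) a).symm '' K, F x ∂Ω.volumeMeasure
      ≤ ∫⁻ z in K, ENNReal.ofReal (Ω.density a z) * F ((chartAt (Cn n) a).symm z) := by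
  set S := (chartAt (Cn n) a).symm '' K with hS
  have hSs : S ⊆ (chartAt (Cn n) a).source := by
    rintro _ ⟨z, hz, rfl⟩; exact (chartAt (Cn n) a).map_target (hKt hz)
  have hmem : ∀ z ∈ (chartAt (Cn n) a).target, (chartAt (Cn n) a).symm z ∈ S ↔ z ∈ K := by
    refine fun z hz => ⟨?_, fun h => ⟨z, h, rfl⟩⟩
    rintro ⟨w, hw, hwz⟩
    rwa [← (chartAt (Cn n) a).symm.injOn (hKt hw) hz hwz]
  calc ∫⁻ x in S, F x ∂Ω.volumeMeasure
      = ∫⁻ x in S, F x ∂(Ω.volumeMeasure.restrict (chartAt (Cn n) a).source) := by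
        rw [Measure.restrict_restrict hKm, Set.inter_eq_left.mpr hSs]
    _ ≤ ∫⁻ x in S, F x ∂Ω.chartMeasure a :=
        lintegral_mono' (Measure.restrict_mono le_rfl (Ω.volumeMeasure_restrict_le a)) le_rfl
    _ = ∫⁻ x, S.indicator F x ∂Ω.chartMeasure a := (lintegral_indicator hKm _).symm
    _ ≤ ∫⁻ z, S.indicator F ((chartAt (Cn n) a).symm z) ∂Ω.coordMeasure a := lintegral_map_le _ _
    _ = ∫⁻ z in (chartAt (Cn n) a).target, ENNReal.ofReal (Ω.density a z)
          * S.indicator F ((chartAt (Cn n) a).symm z) := Ω.lintegral_coordMeasure a _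
    _ = ∫⁻ z in (chartAt (Cn n) a).target, K.indicator (fun z => ENNReal.ofReal (Ω.density a z)
          * F ((chartAt (Cn n) a).symm z)) z := by
        refine setLIntegral_congr_fun (chartAt (Cn n) a).open_target.measurableSet fun z hz => ?_
        by_cases h : z ∈ K
        · simp only [Set.indicator_of_mem h, Set.indicator_of_mem ((hmem z hz).mpr h)]
        · simp only [Set.indicator_of_notMem h, Set.indicator_of_notMem ((hmem z hz).not.mpr h),
            mul_zero]
    _ = _ := by
        rw [setLIntegral_indicator hK, Set.inter_eq_left.mpr hKt]

end KahlerForm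

end Volume

/-! ### Frames of the line bundle and tensor fields -/

theorem isOpen_localDomain {n : ℕ} {X : Type*} [TopologicalSpace X] [ChartedSpace (Cn n) X]
    {L : X → Type*} [TopologicalSpace (TotalSpace ℂ L)] [∀ x, AddCommGroup (L x)]
    [∀ x, TopologicalSpace (L x)] [FiberBundle ℂ L] (a : X) : IsOpen (localDomain n L a) :=
  (chartAt (Cn n) a).symm.isOpen_inter_preimage (trivializationAt ℂ L a).open_baseSet

section Frames

variable {n : ℕ} {X : Type*} [TopologicalSpace X] [ChartedSpace (Cn n) X]
  {L : X → Type*} [TopologicalSpace (TotalSpace ℂ L)] [∀ x, AddCommGroup (L x)]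
  [∀ x, Module ℂ (L x)] [∀ x, TopologicalSpace (L x)] [FiberBundle ℂ L] [VectorBundle ℂ ℂ L]

variable (L) in
/-- The coordinate of a vector of `L_p` with respect to the frame around `a`. -/
noncomputable def frameCoord (a p : X) : L p →L[ℂ] ℂ :=
  (trivializationAt ℂ L a).continuousLinearMapAt ℂ p

variable (L) in
/-- The transition function from the frame around `a` to the frame around `y`: the first is
the product of this function and the second. -/
noncomputable def frameTransition (a y p : X) : ℂ := frameCoord L y p (frame L a p)

theorem frame_eq_symmL {a p : X} (hp : p ∈ (trivializationAt ℂ L a).baseSet) :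
    frame L a p = (trivializationAt ℂ L a).symmL ℂ p (1 : ℂ) := by
  rw [Trivialization.symmL_apply _ hp]
  rfl

theorem frameCoord_frame {a p : X} (hp : p ∈ (trivializationAt ℂ L a).baseSet) :
    frameCoord L a p (frame L a p) = 1 := by
  rw [frame_eq_symmL hp]
  exact (trivializationAt ℂ L a).continuousLinearMapAt_symmL hp 1

theorem frameCoord_smul_frame {a p : X} (hp : p ∈ (trivializationAt ℂ L a).baseSet) (v : L p) :
    frameCoord L a p v • frame L a p = v := by
  rw [frame_eq_symmL hp, ← map_smul, smul_eq_mul, mul_one]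
  exact (trivializationAt ℂ L a).symmL_continuousLinearMapAt hp v

theorem frame_ne_zero {a p : X} (hp : p ∈ (trivializationAt ℂ L a).baseSet) :
    frame L a p ≠ 0 := fun h => by
  have := frameCoord_frame hp
  rw [h, map_zero] at this
  exact zero_ne_one this

theorem frame_eq_smul {a y p : X} (hy : p ∈ (trivializationAt ℂ L y).baseSet) :
    frame L a p = frameTransition L a y p • frame L y p :=
  (frameCoord_smul_frame hy _).symm

theorem frameCoord_eq_mul {a y p : X} (ha : p ∈ (trivializationAt ℂ L a).baseSet) (v : L p) :
    frameCoord L y p v = frameTransition L a y p * frameCoord L a p v := by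
  conv_lhs => rw [← frameCoord_smul_frame ha v, map_smul, smul_eq_mul, mul_comm]
  rfl

theorem powCoord_eq_smul {a y p : X} (ha : p ∈ (trivializationAt ℂ L a).baseSet) (k : ℕ)
    (v : ⨂[ℂ]^k (L p)) :
    powCoord k y p v = frameTransition L a y p ^ k * powCoord k a p v := by
  have h : powCoord (L := L) k y p = frameTransition L a y p ^ k • powCoord (L := L) k a p := by
    refine PiTensorProduct.ext (MultilinearMap.ext fun w => ?_)
    have e : ∀ v, (trivializationAt ℂ L y).continuousLinearMapAt ℂ p v
        = frameTransition L a y p * (trivializationAt ℂ L a).continuousLinearMapAt ℂ p v :=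
      frameCoord_eq_mul ha
    simp [powCoord, e, Finset.prod_mul_distrib]
  rw [h]
  rfl

theorem powCoord_tprod_frame {a p : X} (ha : p ∈ (trivializationAt ℂ L a).baseSet) (k : ℕ) :
    powCoord k a p (PiTensorProduct.tprod ℂ (fun _ : Fin k => frame L a p)) = 1 := by
  have e : (trivializationAt ℂ L a).continuousLinearMapAt ℂ p (frame L a p) = 1 :=
    frameCoord_frame ha
  simp [powCoord, e]

namespace HermitianMetric

variable (h : HermitianMetric n L)

theorem frameNormSq_pos {a p : X} (hp : p ∈ (trivializationAt ℂ L a).baseSet) :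
    0 < h.frameNormSq a p := h.positive _ _ (frame_ne_zero hp)

theorem frameNormSq_eq {a y p : X} (hy : p ∈ (trivializationAt ℂ L y).baseSet) :
    h.frameNormSq a p = Complex.normSq (frameTransition L a y p) * h.frameNormSq y p := by
  rw [frameNormSq, frame_eq_smul hy]
  set c := frameTransition L a y p
  have h1 : h.form p (c • frame L y p) (c • frame L y p)
      = (c * starRingEnd ℂ c) * h.form p (frame L y p) (frame L y p) := by
    simp only [map_smulₛₗ, LinearMap.smul_apply, smul_eq_mul, RingHom.id_apply]
    ring
  rw [h1, Complex.mul_conj, Complex.re_ofReal_mul]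
  rfl

/-- The potential `-log |e|²` of the metric, in the chart around `a`. -/
noncomputable def potential (a : X) (z : Cn n) : ℝ :=
  -Real.log (h.frameNormSq a ((chartAt (Cn n) a).symm z))

theorem contDiffOn_potential (a : X) : ContDiffOn ℝ ∞ (h.potential a) (localDomain n L a) :=
  ((h.smooth a).log fun _ hz => (h.frameNormSq_pos hz.2).ne').neg

theorem exp_neg_potential {a : X} {z : Cn n} (hz : z ∈ localDomain n L a) (k : ℕ) :
    Real.exp (-(k * h.potential a z)) = h.frameNormSq a ((chartAt (Cn n) a).symm z) ^ k := by
  rw [potential, mul_neg, neg_neg, Real.exp_nat_mul, Real.exp_log (h.frameNormSq_pos hz.2)]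

end HermitianMetric

variable [IsManifold 𝓘(ℂ, Cn n) ω X]

/-- The coordinate data of `X` and of the power `L^k` around `a` are as described by
`IsChernData`. -/
theorem isChernData_chart (Ω : KahlerForm n X) (h : HermitianMetric n L) (a : X) (k : ℕ) :
    IsChernData (localDomain n L a) (Ω.components a) (fun z => (Ω.components a z)⁻¹)
      (Ω.christoffel a) (fun z => Complex.exp (-((k : ℂ) * h.potential a z)))
      (fun z u => (k : ℂ) * h.connectionForm a z u) := by
  have hU := isOpen_localDomain (n := n) (L := L) a
  have hs : ∀ j l, ContDiffOn ℝ ∞ (fun z => Ω.components a z j l) (localDomain n L a) :=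
    fun j l => (Ω.contDiffOn_components a j l).mono Set.inter_subset_left
  have hdet : ∀ z ∈ localDomain n L a, IsUnit (Ω.components a z).det :=
    fun z hz => Ω.isUnit_det_components hz.1
  have hsi : ∀ j l, ContDiffOn ℝ ∞ (fun z => (Ω.components a z)⁻¹ j l) (localDomain n L a) :=
    contDiffOn_matrix_inv hs fun z hz => (hdet z hz).ne_zero
  have hp : ContDiffOn ℝ ∞ (fun z => (h.potential a z : ℂ)) (localDomain n L a) :=
    Complex.ofRealCLM.contDiff.comp_contDiffOn (h.contDiffOn_potential a)
  refine ⟨hU, hs, hsi, fun z hz => Matrix.mul_nonsing_inv _ (hdet z hz), fun i j p => ?_,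
    fun z hz i j l => ?_, (contDiffOn_const.mul hp).neg.cexp, fun z _ => Complex.exp_ne_zero _,
    fun z hz i => ?_⟩
  · exact ContDiffOn.sum fun l _ => (hsi _ _).mul (contDiffOn_delHol hU (hs _ _) _)
  · have hd : ∀ q l, ∑ p, (Ω.components a z)⁻¹ q p * Ω.components a z p l
        = if q = l then 1 else 0 := fun q l => by
      rw [← Matrix.mul_apply, Matrix.nonsing_inv_mul _ (hdet z hz), Matrix.one_apply]
    simp only [KahlerForm.christoffel, Finset.sum_mul]
    rw [Finset.sum_comm]
    have e : ∀ q, ∑ p, (Ω.components a z)⁻¹ q p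
          * delHol (fun w => Ω.components a w j q) z (stdVec i) * Ω.components a z p l
        = delHol (fun w => Ω.components a w j q) z (stdVec i) * if q = l then 1 else 0 := by
      intro q
      rw [← hd q l, Finset.mul_sum]
      exact Finset.sum_congr rfl fun p _ => by ring
    simp [e]
  · have d := differentiableAt_of_contDiffOn hU hp hz
    rw [delHol_exp (d.const_mul _).fun_neg, delHol_neg, delHol_const_mul _ d]
    congr 1
    have e : (fun w => (h.potential a w : ℂ))
        = fun w => -((Real.log (h.frameNormSq a ((chartAt (Cn n) a).symm w)) : ℝ) : ℂ) := by
      funext w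
      simp [HermitianMetric.potential]
    rw [e, delHol_neg, HermitianMetric.connectionForm]
    ring

theorem fderiv_transition_chart {a y : X} {z : Cn n} (hz : z ∈ overlap a y)
    (v : TangentSpace 𝓘(ℂ, Cn n) ((chartAt (Cn n) a).symm z)) :
    (mfderiv 𝓘(ℂ, Cn n) 𝓘(ℂ, Cn n) (chartAt (Cn n) y) ((chartAt (Cn n) a).symm z) v : Cn n)
      = fderiv ℂ (transition a y) z
        (mfderiv 𝓘(ℂ, Cn n) 𝓘(ℂ, Cn n) (chartAt (Cn n) a) ((chartAt (Cn n) a).symm z) v) := by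
  set p := (chartAt (Cn n) a).symm z with hp
  have hpa : p ∈ (chartAt (Cn n) a).source := (chartAt (Cn n) a).map_target hz.1
  have hpz : chartAt (Cn n) a p = z := (chartAt (Cn n) a).right_inv hz.1
  have h1 : MDifferentiableAt 𝓘(ℂ, Cn n) 𝓘(ℂ, Cn n) (chartAt (Cn n) a) p :=
    mdifferentiableAt_atlas (chart_mem_atlas _ a) hpa
  have h3 : HasMFDerivAt 𝓘(ℂ, Cn n) 𝓘(ℂ, Cn n) (transition a y) (chartAt (Cn n) a p)
      (fderiv ℂ (transition a y) z) := by
    rw [hpz]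
    exact (differentiableAt_transition hz).hasFDerivAt.hasMFDerivAt
  have h4 := HasMFDerivAt.comp p h3 h1.hasMFDerivAt
  have h5 : chartAt (Cn n) y =ᶠ[nhds p] transition a y ∘ chartAt (Cn n) a :=
    Filter.eventually_of_mem ((chartAt (Cn n) a).open_source.mem_nhds hpa) fun w hw => by
      simp only [Function.comp, transition, (chartAt (Cn n) a).left_inv hw]
  rw [(h4.congr_of_eventuallyEq h5).mfderiv]
  rfl

/-- The components of a tensor field transform by the Jacobian matrix. -/
theorem tensorCoord_transition {m : ℕ} (G : ∀ x : X, ⨂[ℂ]^m (TangentSpace 𝓘(ℂ, Cn n) x)) {a y : X}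
    {z : Cn n} (hz : z ∈ overlap a y) (J : Fin m → Fin n) :
    tensorCoord G y (transition a y z) J
      = ∑ I, (∏ j, jacobian (transition a y) z (I j) (J j)) * tensorCoord G a z I := by
  rw [tensorCoord, symm_transition hz]
  set p := (chartAt (Cn n) a).symm z with hp
  let D : X → (TangentSpace 𝓘(ℂ, Cn n) p →L[ℂ] Cn n) := fun b =>
    mfderiv 𝓘(ℂ, Cn n) 𝓘(ℂ, Cn n) (chartAt (Cn n) b) p
  let T : X → (Fin m → Fin n) → (⨂[ℂ]^m (TangentSpace 𝓘(ℂ, Cn n) p)) →ₗ[ℂ] ℂ := fun b J =>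
    PiTensorProduct.lift ((MultilinearMap.mkPiAlgebra ℂ (Fin m) ℂ).compLinearMap (fun j =>
      (EuclideanSpace.proj (J j) : Cn n →L[ℂ] ℂ).toLinearMap ∘ₗ (D b).toLinearMap))
  have hT : T y J = ∑ I : Fin m → Fin n,
      (∏ j, jacobian (transition a y) z (I j) (J j)) • T a I := by
    refine PiTensorProduct.ext (MultilinearMap.ext fun w => ?_)
    have e : ∀ (v : TangentSpace 𝓘(ℂ, Cn n) p) (j : Fin n), (D y v) j
        = ∑ i, jacobian (transition a y) z i j * (D a v) i := by
      intro v j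
      have h1 : D y v = fderiv ℂ (transition a y) z (D a v) := fderiv_transition_chart hz v
      rw [h1]
      conv_lhs => rw [stdVec_sum (D a v), map_sum]
      simp [jacobian, mul_comm]
    have hTy : ∀ b K, T b K (PiTensorProduct.tprod ℂ w) = ∏ j, (D b (w j)) (K j) := by
      intro b K
      simp [T]
    simp only [LinearMap.compMultilinearMap_apply, LinearMap.sum_apply, LinearMap.smul_apply, hTy,
      smul_eq_mul, e]
    rw [Finset.prod_univ_sum, Fintype.piFinset_univ]
    exact Finset.sum_congr rfl fun I _ => Finset.prod_mul_distrib
  change T y J (G p) = ∑ I, _ * T a I (G p)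
  rw [hT]
  simp

end Frames

/-! ### Higher covariant derivatives in an arbitrary chart -/

section Final

variable {n : ℕ} {X : Type*} [TopologicalSpace X] [ChartedSpace (Cn n) X]
  {L : X → Type*} [TopologicalSpace (TotalSpace ℂ L)] [∀ x, AddCommGroup (L x)]
  [∀ x, Module ℂ (L x)] [∀ x, TopologicalSpace (L x)] [FiberBundle ℂ L] [VectorBundle ℂ ℂ L]

/-- The squared length of a section, computed with the chart and frame around any point `a`. -/
theorem powNormSq_section (h : HermitianMetric n L) {k : ℕ} (s : ∀ x : X, ⨂[ℂ]^k (L x)) (a : X)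
    {z : Cn n} (hz : z ∈ localDomain n L a) :
    h.powNormSq ((chartAt (Cn n) a).symm z) (s ((chartAt (Cn n) a).symm z))
      = ‖sectionCoord s a z‖ ^ 2 * Real.exp (-(k * h.potential a z)) := by
  set y := (chartAt (Cn n) a).symm z with hy
  have hyb : y ∈ (trivializationAt ℂ L y).baseSet := mem_baseSet_trivializationAt ℂ L y
  rw [HermitianMetric.powNormSq, powCoord_eq_smul (a := a) hz.2, h.exp_neg_potential hz,
    h.frameNormSq_eq (a := a) (y := y) hyb, norm_mul, norm_pow, Complex.normSq_eq_norm_sq,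
    sectionCoord]
  ring

variable (n L) in
/-- The part of the chart around `a` on which also the chart and the frame around `y` are
defined. -/
def commonDomain (a y : X) : Set (Cn n) :=
  localDomain n L a ∩ (overlap a y ∩ (chartAt (Cn n) a).symm ⁻¹' (trivializationAt ℂ L y).baseSet)

variable [IsManifold 𝓘(ℂ, Cn n) ω X]

theorem differentiableOn_frameTransition [ContMDiffVectorBundle ω ℂ L 𝓘(ℂ, Cn n)] (a y : X) :
    DifferentiableOn ℂ (fun z => frameTransition L a y ((chartAt (Cn n) a).symm z))
      (commonDomain n L a y) := by
  have h1 := contMDiffOn_coordChangeL (n := ω) (IB := 𝓘(ℂ, Cn n)) (trivializationAt ℂ L a)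
    (trivializationAt ℂ L y)
  have h2 : ContMDiffOn 𝓘(ℂ, Cn n) 𝓘(ℂ, Cn n) ω (chartAt (Cn n) a).symm (chartAt (Cn n) a).target :=
    contMDiffOn_chart_symm
  have h3 := contMDiffOn_iff_contDiffOn.mp (h1.comp' h2)
  have h4 := (h3.clm_apply (contDiffOn_const (c := (1 : ℂ)))).differentiableOn (by simp)
  refine (h4.mono fun z hz => ⟨hz.1.1, hz.1.2, hz.2.2⟩).congr fun z hz => ?_
  simp only [Function.comp, ContinuousLinearEquiv.coe_coe]
  rw [Trivialization.coordChangeL_apply _ _ ⟨hz.1.2, hz.2.2⟩, frameTransition, frameCoord,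
    Trivialization.continuousLinearMapAt_apply, Trivialization.linearMapAt_apply,
    if_pos (show (chartAt (Cn n) a).symm z ∈ (trivializationAt ℂ L y).baseSet from hz.2.2)]
  rfl

/-- The squared length of the higher covariant derivative, computed with the chart and
frame around any point `a`. The definition uses at each point the chart and frame around this
point; the invariance under changes of both is `IsChernData.higherNabla_comp`. -/
theorem powNormSq_higherCovariantDerivative [ContMDiffVectorBundle ω ℂ L 𝓘(ℂ, Cn n)]
    (Ω : KahlerForm n X) (h : HermitianMetric n L) {m k : ℕ}
    {G : ∀ x : X, ⨂[ℂ]^m (TangentSpace 𝓘(ℂ, Cn n) x)} (hG : IsSmoothTensor G)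
    {s : ∀ x : X, ⨂[ℂ]^k (L x)} (hs : IsHolomorphicSection n s) (a : X) {z : Cn n}
    (hz : z ∈ localDomain n L a) :
    h.powNormSq ((chartAt (Cn n) a).symm z)
        (h.higherCovariantDerivative Ω G s ((chartAt (Cn n) a).symm z))
      = ‖higherNabla (Ω.christoffel a) (fun z u => (k : ℂ) * h.connectionForm a z u) m
          (tensorCoord G a) (sectionCoord s a) z‖ ^ 2 * Real.exp (-(k * h.potential a z)) := by
  set y := (chartAt (Cn n) a).symm z with hy
  have hyb : y ∈ (trivializationAt ℂ L y).baseSet := mem_baseSet_trivializationAt ℂ L y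
  have hzV : z ∈ commonDomain n L a y := ⟨hz, ⟨hz.1, mem_chart_source (Cn n) y⟩, hyb⟩
  have hV : IsOpen (commonDomain n L a y) := by
    have e : commonDomain n L a y = localDomain n L a ∩ (overlap a y ∩
        ((chartAt (Cn n) a).target ∩
          (chartAt (Cn n) a).symm ⁻¹' (trivializationAt ℂ L y).baseSet)) := by
      ext w
      simp only [commonDomain, localDomain, Set.mem_inter_iff]
      tauto
    rw [e]
    exact (isOpen_localDomain a).inter ((isOpen_overlap a y).inter
      ((chartAt (Cn n) a).symm.isOpen_inter_preimage (trivializationAt ℂ L y).open_baseSet))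
  have hVa : commonDomain n L a y ⊆ localDomain n L a := Set.inter_subset_left
  have hDa : IsChernData (commonDomain n L a y) (Ω.components a) (fun z => (Ω.components a z)⁻¹)
      (Ω.christoffel a) (fun z => Complex.exp (-((k : ℂ) * h.potential a z)))
      (fun z u => (k : ℂ) * h.connectionForm a z u) := by
    obtain ⟨-, h1, h2, h3, h4, h5, h6, h7, h8⟩ := isChernData_chart Ω h a k
    exact ⟨hV, fun j l => (h1 j l).mono hVa, fun j l => (h2 j l).mono hVa,
      fun z hz => h3 z (hVa hz), fun i j p => (h4 i j p).mono hVa, fun z hz => h5 z (hVa hz),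
      h6.mono hVa, fun z hz => h7 z (hVa hz), fun z hz => h8 z (hVa hz)⟩
  have hmap : Set.MapsTo (transition a y) (commonDomain n L a y) (localDomain n L y) := by
    intro w hw
    refine ⟨transition_mem_target hw.2.1, ?_⟩
    rw [Set.mem_preimage, symm_transition hw.2.1]
    exact hw.2.2
  have hexp : ∀ {b : X} {w : Cn n}, w ∈ localDomain n L b →
      Complex.exp (-((k : ℂ) * h.potential b w))
        = ((h.frameNormSq b ((chartAt (Cn n) b).symm w) ^ k : ℝ) : ℂ) := by
    intro b w hw
    rw [← h.exp_neg_potential hw]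
    push_cast
    rfl
  have hcomp := hDa.higherNabla_comp (isChernData_chart Ω h y k)
    ((contDiffOn_transition a y).mono fun w hw => hw.2.1) hmap
    (fun w hw => Ω.components_transition hw.2.1)
    (b := fun w => frameTransition L a y ((chartAt (Cn n) a).symm w) ^ k)
    ((differentiableOn_frameTransition a y).fun_pow k)
    (fun w hw => by
      rw [hexp (hVa hw), hexp (hmap hw), symm_transition hw.2.1, h.frameNormSq_eq hw.2.2,
        Complex.mul_conj, map_pow, mul_pow]
      push_cast
      rfl)
    (contDiffOn_real_of_holomorphic (contDiffOn_of_holomorphic hV ((hs a).mono hVa)))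
    (contDiffOn_real_of_holomorphic (contDiffOn_of_holomorphic (isOpen_localDomain y) (hs y)))
    (fun w hw => by
      rw [sectionCoord, symm_transition hw.2.1]
      exact powCoord_eq_smul hw.1.2 k _)
    (fun I => (hG a I).mono fun w hw => hw.1.1)
    (fun I => (hG y I).mono fun w hw => hw.1) hzV
    (fun J => tensorCoord_transition G hzV.2.1 J)
  have hτ : transition a y z = chartAt (Cn n) y y := rfl
  rw [hτ] at hcomp
  rw [HermitianMetric.powNormSq, HermitianMetric.higherCovariantDerivative, map_smul,
    powCoord_tprod_frame hyb, smul_eq_mul, mul_one, hcomp, h.exp_neg_potential hz,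
    h.frameNormSq_eq (a := a) (y := y) hyb, norm_mul, norm_pow, Complex.normSq_eq_norm_sq]
  ring

/-- The estimate on a compact part of a chart, for the measure `ωⁿ / n!`. -/
theorem exists_setLIntegral_bound [T2Space X] [MeasurableSpace X] [BorelSpace X]
    [ContMDiffVectorBundle ω ℂ L 𝓘(ℂ, Cn n)]
    (Ω : KahlerForm n X) (h : HermitianMetric n L) {m : ℕ}
    {G : ∀ x : X, ⨂[ℂ]^m (TangentSpace 𝓘(ℂ, Cn n) x)} (hG : IsSmoothTensor G) (a : X)
    {K : Set (Cn n)} (hK : IsCompact K) (hKU : K ⊆ localDomain n L a) :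
    ∃ A : ℝ, 0 < A ∧ ∀ k : ℕ, 1 ≤ k → ∀ s : (∀ x : X, ⨂[ℂ]^k (L x)), IsHolomorphicSection n s →
      ∫⁻ x in (chartAt (Cn n) a).symm '' K,
          ENNReal.ofReal (h.powNormSq x (h.higherCovariantDerivative Ω G s x)) ∂Ω.volumeMeasure
        ≤ ENNReal.ofReal (A * k ^ m) *
          ∫⁻ x, ENNReal.ofReal (h.powNormSq x (s x)) ∂Ω.volumeMeasure := by
  have hU : IsOpen (localDomain n L a) := isOpen_localDomain a
  have hUt : localDomain n L a ⊆ (chartAt (Cn n) a).target := Set.inter_subset_left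
  obtain ⟨A, K', hA, hK', hK'U, hb⟩ := exists_lintegral_higherNabla_bound hU hK hKU
    (h.contDiffOn_potential a) (isChernData_chart Ω h a) (fun I => (hG a I).mono hUt)
  have hdens : ContinuousOn (Ω.density a) (localDomain n L a) :=
    (Ω.continuousOn_density a).mono hUt
  obtain ⟨D, hD⟩ := hK.exists_bound_of_continuousOn (hdens.mono hKU)
  -- a positive lower bound of the density on `K'`
  obtain ⟨d, hd⟩ := hK'.exists_bound_of_continuousOn
    ((hdens.mono hK'U).inv₀ fun z hz => (Ω.density_pos (hUt (hK'U hz))).ne')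
  refine ⟨(|D| + 1) * A * (|d| + 1), by positivity, fun k hk s hs => ?_⟩
  have hKm : MeasurableSet ((chartAt (Cn n) a).symm '' K) :=
    (hK.image_of_continuousOn ((chartAt (Cn n) a).continuousOn_symm.mono
      (hKU.trans hUt))).isClosed.measurableSet
  set N : Cn n → ℝ≥0∞ := fun z =>
    ENNReal.ofReal (‖sectionCoord s a z‖ ^ 2 * Real.exp (-(k * h.potential a z))) with hN
  have hNs : ∀ z ∈ localDomain n L a,
      ENNReal.ofReal (h.powNormSq ((chartAt (Cn n) a).symm z) (s ((chartAt (Cn n) a).symm z)))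
        = N z := fun z hz => by rw [hN, powNormSq_section h s a hz]
  have hNc : ContinuousOn N (localDomain n L a) := ENNReal.continuous_ofReal.comp_continuousOn
    (((hs a).continuousOn.norm.pow 2).mul
      (continuousOn_const.mul (h.contDiffOn_potential a).continuousOn).neg.rexp)
  calc _ ≤ ∫⁻ z in K, ENNReal.ofReal (Ω.density a z) *
        ENNReal.ofReal (h.powNormSq ((chartAt (Cn n) a).symm z)
          (h.higherCovariantDerivative Ω G s ((chartAt (Cn n) a).symm z))) :=
        Ω.setLIntegral_volumeMeasure_le a hK.measurableSet (hKU.trans hUt) hKm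
          (fun x => ENNReal.ofReal (h.powNormSq x (h.higherCovariantDerivative Ω G s x)))
    _ ≤ ∫⁻ z in K, ENNReal.ofReal (|D| + 1) * ENNReal.ofReal (‖higherNabla (Ω.christoffel a)
          (fun z u => (k : ℂ) * h.connectionForm a z u) m (tensorCoord G a) (sectionCoord s a) z‖
            ^ 2 * Real.exp (-(k * h.potential a z))) := by
        refine setLIntegral_mono' hK.measurableSet fun z hz => ?_
        rw [powNormSq_higherCovariantDerivative Ω h hG hs a (hKU hz)]
        gcongr
        have := hD z hz
        rw [Real.norm_eq_abs] at this
        linarith [le_abs_self (Ω.density a z), le_abs_self D]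
    _ = ENNReal.ofReal (|D| + 1) * ∫⁻ z in K, ENNReal.ofReal (‖higherNabla (Ω.christoffel a)
          (fun z u => (k : ℂ) * h.connectionForm a z u) m (tensorCoord G a) (sectionCoord s a) z‖
            ^ 2 * Real.exp (-(k * h.potential a z))) :=
        lintegral_const_mul' _ _ ENNReal.ofReal_ne_top
    _ ≤ ENNReal.ofReal (|D| + 1) * (ENNReal.ofReal (A * k ^ m) * ∫⁻ z in K', N z) := by
        gcongr
        exact hb k (sectionCoord s a) hk (hs a)
    _ ≤ ENNReal.ofReal (|D| + 1) * (ENNReal.ofReal (A * k ^ m) * ∫⁻ z in K',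
          ENNReal.ofReal (|d| + 1) * (ENNReal.ofReal (Ω.density a z) * N z)) := by
        gcongr ENNReal.ofReal (|D| + 1) * (ENNReal.ofReal (A * k ^ m) * ?_)
        refine setLIntegral_mono' hK'.measurableSet fun z hz => ?_
        rw [← mul_assoc, ← ENNReal.ofReal_mul (by positivity)]
        have h1 := Ω.density_pos (hUt (hK'U hz))
        have h2 := hd z hz
        rw [Real.norm_eq_abs, Pi.inv_apply, abs_of_pos (inv_pos.mpr h1)] at h2
        have h3 : 1 ≤ (|d| + 1) * Ω.density a z := by
          rw [← div_le_iff₀ h1, one_div]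
          linarith [le_abs_self d]
        exact le_mul_of_one_le_left' (by simpa using ENNReal.ofReal_le_ofReal h3)
    _ = ENNReal.ofReal ((|D| + 1) * A * (|d| + 1) * k ^ m) * ∫⁻ z in K',
          ENNReal.ofReal (Ω.density a z) * N z := by
        rw [lintegral_const_mul' _ _ ENNReal.ofReal_ne_top,
          show (|D| + 1) * A * (|d| + 1) * (k : ℝ) ^ m
            = (|D| + 1) * (A * k ^ m) * (|d| + 1) by ring,
          ENNReal.ofReal_mul (p := (|D| + 1) * (A * k ^ m)) (by positivity),
          ENNReal.ofReal_mul (p := |D| + 1) (by positivity)]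
        ring
    _ ≤ _ := by
        gcongr ENNReal.ofReal ((|D| + 1) * A * (|d| + 1) * k ^ m) * ?_
        calc _ ≤ ∫⁻ z in localDomain n L a, ENNReal.ofReal (Ω.density a z) * N z :=
              lintegral_mono_set hK'U
          _ = ∫⁻ z in localDomain n L a, ENNReal.ofReal (Ω.density a z) *
                ENNReal.ofReal (h.powNormSq ((chartAt (Cn n) a).symm z)
                  (s ((chartAt (Cn n) a).symm z))) :=
              setLIntegral_congr_fun hU.measurableSet fun z hz => by rw [hNs z hz]
          _ ≤ _ := Ω.setLIntegral_le_volumeMeasure a hU hUt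
              (F := fun x => ENNReal.ofReal (h.powNormSq x (s x))) (hNc.congr hNs)

end Final

end BerezinToeplitz


theorem mainTheorem5 {n : ℕ} {X : Type*} [TopologicalSpace X] [CompactSpace X] [T2Space X]
    [ChartedSpace (BerezinToeplitz.Cn n) X] [IsManifold 𝓘(ℂ, BerezinToeplitz.Cn n) ω X]
    [MeasurableSpace X] [BorelSpace X]
    {L : X → Type*} [TopologicalSpace (TotalSpace ℂ L)] [∀ x, AddCommGroup (L x)]
    [∀ x, Module ℂ (L x)] [∀ x, TopologicalSpace (L x)] [FiberBundle ℂ L] [VectorBundle ℂ ℂ L]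
    [ContMDiffVectorBundle ω ℂ L 𝓘(ℂ, BerezinToeplitz.Cn n)]
    (Ω : BerezinToeplitz.KahlerForm n X) (h : BerezinToeplitz.HermitianMetric n L)
    (hpre : h.IsPrequantum Ω)
    (m : ℕ) (G : ∀ x : X, ⨂[ℂ]^m (TangentSpace 𝓘(ℂ, BerezinToeplitz.Cn n) x))
    (hG : BerezinToeplitz.IsSmoothTensor G) :
    ∃ C : ℝ, 0 < C ∧ ∀ k : ℕ, 1 ≤ k → ∀ s : (∀ x : X, ⨂[ℂ]^k (L x)),
      BerezinToeplitz.IsHolomorphicSection n s →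
        h.l2Norm Ω (h.higherCovariantDerivative Ω G s) ≤
          ENNReal.ofReal (C * (k : ℝ) ^ ((m : ℝ) / 2)) * h.l2Norm Ω s := by
  open BerezinToeplitz in
  -- closed balls around the points of `X`, in the coordinates of their charts
  have hballs : ∀ a : X, ∃ r : ℝ, 0 < r ∧
      Metric.closedBall (chartAt (Cn n) a a) r ⊆ localDomain n L a := fun a =>
    Metric.nhds_basis_closedBall.mem_iff.mp ((isOpen_localDomain (n := n) (L := L) a).mem_nhds
      ⟨mem_chart_target (Cn n) a, by
        rw [Set.mem_preimage, (chartAt (Cn n) a).left_inv (mem_chart_source (Cn n) a)]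
        exact mem_baseSet_trivializationAt ℂ L a⟩)
  choose r hr hrU using hballs
  obtain ⟨t, ht⟩ := CompactSpace.elim_nhds_subcover
    (fun a : X => (chartAt (Cn n) a).symm '' Metric.closedBall (chartAt (Cn n) a a) (r a))
    fun a => by
      have h1 : (chartAt (Cn n) a).symm '' Metric.ball (chartAt (Cn n) a a) (r a)
          ⊆ (chartAt (Cn n) a).symm '' Metric.closedBall (chartAt (Cn n) a a) (r a) :=
        Set.image_mono Metric.ball_subset_closedBall
      have h2 : IsOpen ((chartAt (Cn n) a).symm '' Metric.ball (chartAt (Cn n) a a) (r a)) :=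
        (chartAt (Cn n) a).symm.isOpen_image_of_subset_source Metric.isOpen_ball
          ((Metric.ball_subset_closedBall.trans (hrU a)).trans Set.inter_subset_left)
      exact Filter.mem_of_superset (h2.mem_nhds ⟨_, Metric.mem_ball_self (hr a),
        (chartAt (Cn n) a).left_inv (mem_chart_source (Cn n) a)⟩) h1
  choose A hA hAb using fun a : X => exists_setLIntegral_bound Ω h hG a
    (isCompact_closedBall (chartAt (Cn n) a a) (r a)) (hrU a)
  set B := 1 + ∑ a ∈ t, A a with hB
  have hB0 : 0 < B := add_pos_of_pos_of_nonneg one_pos (Finset.sum_nonneg fun a _ => (hA a).le)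
  -- the squares of the norms satisfy the estimate with the constant `B`
  refine ⟨√B, Real.sqrt_pos.mpr hB0, fun k hk s hs => ?_⟩
  set I := ∫⁻ x, ENNReal.ofReal (h.powNormSq x (s x)) ∂Ω.volumeMeasure with hI
  set F : X → ENNReal := fun x =>
    ENNReal.ofReal (h.powNormSq x (h.higherCovariantDerivative Ω G s x)) with hF
  have hk0 : (0 : ℝ) ≤ k := Nat.cast_nonneg k
  have hmain : ∫⁻ x, F x ∂Ω.volumeMeasure ≤ ENNReal.ofReal (B * k ^ m) * I := by
    calc ∫⁻ x, F x ∂Ω.volumeMeasure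
        = ∫⁻ x in ⋃ a ∈ t, (chartAt (Cn n) a).symm '' Metric.closedBall (chartAt (Cn n) a a) (r a),
            F x ∂Ω.volumeMeasure := by
          rw [ht, Set.top_eq_univ, Measure.restrict_univ]
      _ ≤ ∑ a ∈ t, ∫⁻ x in (chartAt (Cn n) a).symm ''
            Metric.closedBall (chartAt (Cn n) a a) (r a), F x ∂Ω.volumeMeasure :=
          by
          refine ((lintegral_mono_set (Set.iUnion₂_subset fun a ha =>
            Set.subset_iUnion (fun b : t => (chartAt (Cn n) b.1).symm ''
              Metric.closedBall (chartAt (Cn n) b.1 b.1) (r b.1)) ⟨a, ha⟩)).trans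
            (lintegral_iUnion_le _ _)).trans (le_of_eq ?_)
          rw [tsum_fintype]
          exact Finset.sum_coe_sort t fun a => ∫⁻ x in (chartAt (Cn n) a).symm ''
            Metric.closedBall (chartAt (Cn n) a a) (r a), F x ∂Ω.volumeMeasure
      _ ≤ ∑ a ∈ t, ENNReal.ofReal (A a * k ^ m) * I :=
          Finset.sum_le_sum fun a _ => hAb a k hk s hs
      _ = ENNReal.ofReal ((∑ a ∈ t, A a) * k ^ m) * I := by
          have h1 : (∑ a ∈ t, A a) * (k : ℝ) ^ m = ∑ a ∈ t, A a * k ^ m := Finset.sum_mul ..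
          rw [h1, ENNReal.ofReal_sum_of_nonneg fun a _ =>
            mul_nonneg (hA a).le (pow_nonneg hk0 m), Finset.sum_mul]
      _ ≤ _ := by
          gcongr
          linarith
  have hC : √B * (k : ℝ) ^ ((m : ℝ) / 2) = (B * k ^ m) ^ (1 / 2 : ℝ) := by
    rw [Real.mul_rpow hB0.le (pow_nonneg hk0 m), Real.sqrt_eq_rpow, ← Real.rpow_natCast,
      ← Real.rpow_mul hk0]
    congr 2
    ring
  rw [hC, ← ENNReal.ofReal_rpow_of_nonneg (mul_nonneg hB0.le (pow_nonneg hk0 m)) (by norm_num)]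
  calc h.l2Norm Ω (h.higherCovariantDerivative Ω G s)
      = (∫⁻ x, F x ∂Ω.volumeMeasure) ^ (1 / 2 : ℝ) := rfl
    _ ≤ (ENNReal.ofReal (B * k ^ m) * I) ^ (1 / 2 : ℝ) :=
        ENNReal.rpow_le_rpow hmain (by norm_num)
    _ = _ := ENNReal.mul_rpow_of_nonneg _ _ (by norm_num)
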